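/- **Setting.** Write $\mathbb T=\mathbb R/\mathbb Z$, and let $X$ be a smooth manifold. Let $\pi:Z\to X$ and $\hat\pi:\hat Z\to X$ be smooth principal $\mathbb T$-bundles with connection 1-forms $A$, $\hat A$ (real, invariant, equal to $1$ on the generators $v$, $\hat v$ of the two actions) and curvatures $F_A,F_{\hat A}\in\Omega^2(X)$. Let $H\in\Omega^3(Z)$ be closed and $\mathbb T$-invariant with $\iota_vH=\pi^*F_{\hat A}$. Then $H-A\wedge \pi^*F_{\hat A}=\pi^*\Omega$ for a form $\Omega\in\Omega^3(X)$, and the T-dual flux is $\hat H=\hat\pi^*F_A\wedge\hat A+\hat\pi^*\Omega\in\Omega^3(\hat Z)$. Let $\xi,\hat\xi$ be the complex line bundles on $X$ associated with $Z,\hat Z$ and the standard representation, with the induced connections ($d+2\pi i\,s^*A$ in the frame given by a local section $s$ of $Z$), and let $\rho$ be the tautological section of the pullback of $\xi$ to $Z$ (and hence to $Z\times_X\hat Z$). For $n\in\mathbb Z$ put $$\Omega^*_{-n}(Z)=\{\omega\in\Omega^*(Z;\mathbb C): L_v\omega=-2\pi i n\,\omega\},\qquad \mathcal A^*_n(\hat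 Z)=\Omega^*(\hat Z,\hat\pi^*\xi^{\otimes n})^{\hat{\mathbb T}}.$$ Integration $\int^{\mathbb T}$ along the fibre contracts with the generator of the fibre in the first slot and then integrates over the fibre (of length $1$); $\int^{\mathbb T,n}\eta=\int^{\mathbb T}\eta\otimes\rho^{\otimes n}$. Define $$\tau_n(\omega)=\int^{\mathbb T,n}\omega\, e^{-A\wedge\hat A}\quad(\omega\in\Omega^*_{-n}(Z)),\qquad \hat\sigma_n(\theta)=\int^{\hat{\mathbb T}}\theta\cdot\rho^{-n}\cdot e^{A\wedge\hat A}\quad(\theta\in\mathcal A^*_n(\hat Z)).$$ For $X_0+\alpha\in\Gamma(TZ\oplus T^*Z)^{\mathbb T}$ write $X_0=x+fv$, $\alpha=\pi^*\theta+gA$ with $x$ the horizontal lift of a vector field on $X$, $\theta\in\Omega^1(X)$ and $f,g\in C^\infty(X)$, and let $\phi(X_0+\alpha)=(x+g\hat v)+(\hat\pi^*\theta+f\hat A)\in\Gamma(T\hat Z\oplus T^*\hat Z)^{\hat{\mathbb T}}$, where $x$ now denotes the horizontal lift to $\hat Z$. The pairing is $\langle Y+\beta,Y'+\beta'\rangle=\tfrac12(\iota_Y\beta'+\iota_{Y'}\beta)$,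 the Clifford action is $\gamma_{Y+\beta}\cdot\omega=\iota_Y\omega+\beta\wedge\omega$, and the twisted Courant bracket is the antisymmetrization of $(Y+\beta)\circ_H(Y'+\beta')=[Y,Y']+L_Y\beta'-\iota_{Y'}d\beta+\iota_Y\iota_{Y'}H$. **Theorem.** (1) $\phi$ is a $C^\infty(X)$-linear isomorphism $\Gamma(TZ\oplus T^*Z)^{\mathbb T}\to\Gamma(T\hat Z\oplus T^*\hat Z)^{\hat{\mathbb T}}$ (its inverse is the dual map $\hat\phi$, defined by exchanging $Z$ and $\hat Z$), orthogonal for the pairings; hence it induces isomorphisms of Clifford algebras $\gamma_U\mapsto\gamma_{\phi(U)}$, both of the fibres at points $z\in Z$, $\hat z\in\hat Z$ over the same point of $X$ and of the algebras of sections generated by the $\gamma_U$ with $U$ invariant. (2) $\phi([[U,W]]_H)=[[\phi(U),\phi(W)]]_{\hat H}$ for all invariant sections $U,W$. (3) For every $n\in\mathbb Z$, $\tau_n$ is a $\mathbb C$-linear bijection $\Omega^*_{-n}(Z)\to\mathcal A^*_n(\hat Z)$, $\hat\sigma_n$ is a $\mathbb C$-linear bijection $\mathcal A^*_n(\hat Z)\to\Omega^*_{-n}(Z)$,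 and $\hat\sigma_n=-\tau_n^{-1}$. For every invariant section $U$ of $TZ\oplus T^*Z$, $\omega\in\Omega^*_{-n}(Z)$ and $\theta\in\mathcal A_n^*(\hat Z)$, $$\tau_n(\gamma_U\cdot\omega)=-\gamma_{\phi(U)}\cdot\tau_n(\omega),\qquad \hat\sigma_n(\gamma_{\phi(U)}\cdot\theta)=-\gamma_U\cdot\hat\sigma_n(\theta),$$ so that $\tau_n$ and $\hat\sigma_n$ are isomorphisms of Clifford modules, up to the sign attached to maps of odd degree. (4) For every $n\in\mathbb Z$, $d+H$ preserves $\Omega^*_{-n}(Z)$, the operator $\hat D_n=\hat\pi^*\nabla^{\xi^{\otimes n}}-\iota_{2\pi i n\hat v}+\hat H$ preserves $\mathcal A^*_n(\hat Z)$, and $$\tau_n\circ(d+H)=-\hat D_n\circ\tau_n,\qquad \hat\sigma_n\circ\hat D_n=-(d+H)\circ\hat\sigma_n .$$ The dual statements of (3) and (4), obtained by exchanging $(Z,A,H,\xi,\phi)$ and $(\hat Z,\hat A,\hat H,\hat\xi,\hat\phi)$, hold for $\hat\tau_n(\hat\omega)=\int^{\hat{\mathbb T},n}\hat\omega\,e^{A\wedge\hat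 A}$ and $\sigma_n(\theta)=\int^{\mathbb T}\theta\cdot\hat\rho^{-n}\cdot e^{-A\wedge\hat A}$, where $\hat\rho$ is the tautological section of the pullback of $\hat\xi$. -/

import Mathlib

open scoped Manifold ContDiff

noncomputable section

namespace ExoticHori

/-! ### Pointwise exterior algebra

All forms are alternating multilinear maps; the wedge product is normalised by
`(α ∧ β)(v) = 1/(k! l!) ∑_σ sign σ • α (v_σ(1), …, v_σ(k)) β (v_σ(k+1), …, v_σ(k+l))`. -/

section Pointwise

variable {V : Type*} [AddCommGroup V] [Module ℝ V] [TopologicalSpace V]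
  {F : Type*} [AddCommGroup F] [Module ℝ F] [TopologicalSpace F]

/-- The multilinear map `(v₁, …, v_m) ↦ α (v₁, …, v_k) • β (v_{k+1}, …, v_m)`, `m = k + l`. -/
def wedgeAux [ContinuousSMul ℝ F] {k l m : ℕ} (h : k + l = m)
    (α : V [⋀^Fin k]→L[ℝ] ℝ) (β : V [⋀^Fin l]→L[ℝ] F) :
    ContinuousMultilinearMap ℝ (fun _ : Fin m => V) F where
  toFun v := α (fun i => v (Fin.cast h (Fin.castAdd l i))) •
    β (fun j => v (Fin.cast h (Fin.natAdd k j)))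
  map_update_add' := by
    subst h
    intro inst v i x y
    obtain rfl : inst = instDecidableEqFin _ := Subsingleton.elim _ _
    induction i using Fin.addCases with
    | left i =>
      have e : ∀ z : V, (fun j => Function.update v (Fin.castAdd l i) z (Fin.castAdd l j)) =
          Function.update (fun j => v (Fin.castAdd l j)) i z := fun z =>
        Function.update_comp_eq_of_injective v (Fin.castAdd_injective k l) i z
      have e' : ∀ z : V, (fun j => Function.update v (Fin.castAdd l i) z (Fin.natAdd k j)) =
          (fun j => v (Fin.natAdd k j)) := fun z => by
        funext j
        exact Function.update_of_ne (by simp [Fin.ext_iff]; omega) _ _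
      simp [e, e', add_smul]
    | right i =>
      have e : ∀ z : V, (fun j => Function.update v (Fin.natAdd k i) z (Fin.natAdd k j)) =
          Function.update (fun j => v (Fin.natAdd k j)) i z := fun z =>
        Function.update_comp_eq_of_injective v (Fin.natAdd_injective l k) i z
      have e' : ∀ z : V, (fun j => Function.update v (Fin.natAdd k i) z (Fin.castAdd l j)) =
          (fun j => v (Fin.castAdd l j)) := fun z => by
        funext j
        exact Function.update_of_ne (by simp [Fin.ext_iff]; omega) _ _
      simp [e, e', smul_add]
  map_update_smul' := by
    subst h
    intro inst v i c x
    obtain rfl : inst = instDecidableEqFin _ := Subsingleton.elim _ _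
    induction i using Fin.addCases with
    | left i =>
      have e : ∀ z : V, (fun j => Function.update v (Fin.castAdd l i) z (Fin.castAdd l j)) =
          Function.update (fun j => v (Fin.castAdd l j)) i z := fun z =>
        Function.update_comp_eq_of_injective v (Fin.castAdd_injective k l) i z
      have e' : ∀ z : V, (fun j => Function.update v (Fin.castAdd l i) z (Fin.natAdd k j)) =
          (fun j => v (Fin.natAdd k j)) := fun z => by
        funext j
        exact Function.update_of_ne (by simp [Fin.ext_iff]; omega) _ _
      simp [e, e', mul_smul]
    | right i =>
      have e : ∀ z : V, (fun j => Function.update v (Fin.natAdd k i) z (Fin.natAdd k j)) =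
          Function.update (fun j => v (Fin.natAdd k j)) i z := fun z =>
        Function.update_comp_eq_of_injective v (Fin.natAdd_injective l k) i z
      have e' : ∀ z : V, (fun j => Function.update v (Fin.natAdd k i) z (Fin.castAdd l j)) =
          (fun j => v (Fin.castAdd l j)) := fun z => by
        funext j
        exact Function.update_of_ne (by simp [Fin.ext_iff]; omega) _ _
      simp only [Fin.cast_eq_self, e, e', ContinuousAlternatingMap.map_update_smul]
      exact smul_comm _ _ _
  cont := by
    refine Continuous.smul ?_ ?_
    · exact α.cont.comp (continuous_pi fun i => continuous_apply _)
    · exact β.cont.comp (continuous_pi fun i => continuous_apply _)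

/-- The wedge product of a real `k`-form with an `F`-valued `l`-form. -/
def wedge [IsTopologicalAddGroup F] [ContinuousSMul ℝ F] {k l m : ℕ} (h : k + l = m)
    (α : V [⋀^Fin k]→L[ℝ] ℝ) (β : V [⋀^Fin l]→L[ℝ] F) : V [⋀^Fin m]→L[ℝ] F :=
  ((k.factorial * l.factorial : ℕ) : ℝ)⁻¹ • (wedgeAux h α β).alternatization

/-- The interior product `ι_x η = η (x, ·, …, ·)`. -/
def contract {k : ℕ} (x : V) (η : V [⋀^Fin (k + 1)]→L[ℝ] F) : V [⋀^Fin k]→L[ℝ] F where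
  toMultilinearMap := (η.toAlternatingMap.curryLeft x).toMultilinearMap
  map_eq_zero_of_eq' := (η.toAlternatingMap.curryLeft x).map_eq_zero_of_eq'
  cont := η.cont.comp (Continuous.matrixVecCons continuous_const continuous_id)

variable (V F) in
/-- `F`-valued alternating forms of mixed degree on `V`. -/
abbrev GAlt : Type _ := ∀ k : ℕ, V [⋀^Fin k]→L[ℝ] F

/-- Wedge product of a real `p`-form with a form of mixed degree. -/
def gwedge [IsTopologicalAddGroup F] [ContinuousSMul ℝ F] {p : ℕ}
    (α : V [⋀^Fin p]→L[ℝ] ℝ) (η : GAlt V F) : GAlt V F :=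
  fun m => if h : p ≤ m then wedge (Nat.add_sub_of_le h) α (η (m - p)) else 0

/-- Interior product on forms of mixed degree. -/
def gcontract (x : V) (η : GAlt V F) : GAlt V F := fun k => contract x (η (k + 1))

/-- `e^B ∧ η = ∑_j (1/j!) B ∧ ⋯ ∧ B ∧ η` for a 2-form `B`. In degree `m` the terms with
`2 * j > m` vanish, so that the sum may be cut off at `j = m`. -/
def expWedge [IsTopologicalAddGroup F] [ContinuousSMul ℝ F]
    (B : V [⋀^Fin 2]→L[ℝ] ℝ) (η : GAlt V F) : GAlt V F :=
  fun m => ∑ j ∈ Finset.range (m + 1), ((j.factorial : ℕ) : ℝ)⁻¹ • ((gwedge B)^[j] η) m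

end Pointwise

/-! ### Differential forms on a manifold -/

section Forms

variable (E : Type*) [NormedAddCommGroup E] [NormedSpace ℝ E]
  (M : Type*) [TopologicalSpace M] [ChartedSpace E M]
  {E' : Type*} [NormedAddCommGroup E'] [NormedSpace ℝ E']
  {M' : Type*} [TopologicalSpace M'] [ChartedSpace E' M']

/-- The tangent space of `M` at `x`. -/
abbrev Tan (x : M) : Type _ := TangentSpace 𝓘(ℝ, E) x

/-- `F`-valued differential `k`-forms on `M` (not necessarily smooth). -/
abbrev DForm (k : ℕ) (F : Type*) [AddCommGroup F] [Module ℝ F] [TopologicalSpace F] : Type _ :=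
  ∀ x : M, Tan E M x [⋀^Fin k]→L[ℝ] F

/-- `F`-valued differential forms of mixed degree on `M` (not necessarily smooth). Forms of degree
larger than the dimension vanish, so that this is the direct sum over all degrees. -/
abbrev GForm (F : Type*) [AddCommGroup F] [Module ℝ F] [TopologicalSpace F] : Type _ :=
  ∀ k : ℕ, DForm E M k F

/-- Vector fields on `M` (not necessarily smooth). -/
abbrev VField : Type _ := ∀ x : M, Tan E M x

variable {E M}

/-- The form `η` in the preferred chart at `x₀`, i.e. its pullback by the inverse of the chart. -/
def chartRep {k : ℕ} {F : Type*} [AddCommGroup F] [Module ℝ F] [TopologicalSpace F]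
    (η : DForm E M k F) (x₀ : M) (y : E) : E [⋀^Fin k]→L[ℝ] F :=
  (η ((extChartAt 𝓘(ℝ, E) x₀).symm y)).compContinuousLinearMap
    (mfderiv 𝓘(ℝ, E) 𝓘(ℝ, E) (extChartAt 𝓘(ℝ, E) x₀).symm y)

/-- The form `η` is smooth at `x`. -/
def SmoothFormAt {k : ℕ} {F : Type*} [NormedAddCommGroup F] [NormedSpace ℝ F]
    (η : DForm E M k F) (x : M) : Prop :=
  ContDiffAt ℝ ∞ (chartRep η x) (extChartAt 𝓘(ℝ, E) x x)

/-- The exterior derivative, computed at `x` in the preferred chart at `x`. -/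
def extD {k : ℕ} {F : Type*} [NormedAddCommGroup F] [NormedSpace ℝ F]
    (η : DForm E M k F) : DForm E M (k + 1) F :=
  fun x => (extDeriv (chartRep η x) (extChartAt 𝓘(ℝ, E) x x)).compContinuousLinearMap
    (mfderiv 𝓘(ℝ, E) 𝓘(ℝ, E) (extChartAt 𝓘(ℝ, E) x) x)

/-- The exterior derivative on forms of mixed degree. -/
def gextD {F : Type*} [NormedAddCommGroup F] [NormedSpace ℝ F]
    (η : GForm E M F) : GForm E M F
  | 0 => 0
  | k + 1 => extD (η k)

/-- The pullback `f^* η`. -/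
def pull {k : ℕ} {F : Type*} [AddCommGroup F] [Module ℝ F] [TopologicalSpace F]
    (f : M → M') (η : DForm E' M' k F) : DForm E M k F :=
  fun x => (η (f x)).compContinuousLinearMap (mfderiv 𝓘(ℝ, E) 𝓘(ℝ, E') f x)

/-- The wedge product of a real `k`-form and an `l`-form. -/
def fwedge {k l m : ℕ} (h : k + l = m) {F : Type*} [AddCommGroup F] [Module ℝ F]
    [TopologicalSpace F] [IsTopologicalAddGroup F] [ContinuousSMul ℝ F]
    (α : DForm E M k ℝ) (β : DForm E M l F) : DForm E M m F :=
  fun x => wedge h (α x) (β x)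

/-- The interior product with a vector field. -/
def inter {k : ℕ} {F : Type*} [AddCommGroup F] [Module ℝ F] [TopologicalSpace F]
    (X : VField E M) (η : DForm E M (k + 1) F) : DForm E M k F :=
  fun x => contract (X x) (η x)

/-- Interior product with a vector field on forms of mixed degree. -/
def ginter {F : Type*} [AddCommGroup F] [Module ℝ F] [TopologicalSpace F]
    (X : VField E M) (η : GForm E M F) : GForm E M F :=
  fun k => inter X (η (k + 1))

/-- Wedge product of a real `p`-form with a form of mixed degree. -/
def gfwedge {p : ℕ} {F : Type*} [AddCommGroup F] [Module ℝ F]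
    [TopologicalSpace F] [IsTopologicalAddGroup F] [ContinuousSMul ℝ F]
    (α : DForm E M p ℝ) (η : GForm E M F) : GForm E M F :=
  fun m x => gwedge (α x) (fun k => η k x) m

/-! ### Generalized tangent bundle -/

variable (E M) in
/-- The fibre of `TM ⊕ T^*M` at `x`. -/
abbrev GTan (x : M) : Type _ := Tan E M x × (Tan E M x [⋀^Fin 1]→L[ℝ] ℝ)

variable (E M) in
/-- Sections `X + α` of `TM ⊕ T^*M` (not necessarily smooth). -/
abbrev GSec : Type _ := ∀ x : M, GTan E M x

/-- The pairing `⟨X + α, Y + β⟩ = (ι_X β + ι_Y α) / 2` on the fibre of `TM ⊕ T^*M` at `x`. -/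
def pairing (x : M) : LinearMap.BilinForm ℝ (GTan E M x) :=
  LinearMap.mk₂ ℝ (fun U W => (1 / 2 : ℝ) * (W.2 ![U.1] + U.2 ![W.1]))
    (fun U U' W => by
      have h : W.2 ![U.1 + U'.1] = W.2 ![U.1] + W.2 ![U'.1] := W.2.vecCons_add ![] U.1 U'.1
      simp only [Prod.fst_add, Prod.snd_add, h, ContinuousAlternatingMap.add_apply]; ring)
    (fun c U W => by
      have h : W.2 ![c • U.1] = c • W.2 ![U.1] := W.2.vecCons_smul ![] c U.1
      simp only [Prod.smul_fst, Prod.smul_snd, h, ContinuousAlternatingMap.smul_apply,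
        smul_eq_mul]; ring)
    (fun U W W' => by
      have h : U.2 ![W.1 + W'.1] = U.2 ![W.1] + U.2 ![W'.1] := U.2.vecCons_add ![] W.1 W'.1
      simp only [Prod.fst_add, Prod.snd_add, h, ContinuousAlternatingMap.add_apply]; ring)
    (fun c U W => by
      have h : U.2 ![c • W.1] = c • U.2 ![W.1] := U.2.vecCons_smul ![] c W.1
      simp only [Prod.smul_fst, Prod.smul_snd, h, ContinuousAlternatingMap.smul_apply,
        smul_eq_mul]; ring)

/-- The quadratic form `U ↦ ⟨U, U⟩`; its Clifford algebra is generated by symbols `γ_U` with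
`γ_U γ_V + γ_V γ_U = 2 ⟨U, V⟩`. -/
def pairingQ (x : M) : QuadraticForm ℝ (GTan E M x) :=
  (pairing (E := E) x).toQuadraticMap

/-- The Clifford action `γ_{X + α} · η = ι_X η + α ∧ η`. -/
def cliff {F : Type*} [AddCommGroup F] [Module ℝ F]
    [TopologicalSpace F] [IsTopologicalAddGroup F] [ContinuousSMul ℝ F]
    (U : GSec E M) (η : GForm E M F) : GForm E M F :=
  ginter (fun x => (U x).1) η + gfwedge (fun x => (U x).2) η

/-- The twisted Dorfman bracket
`(X + α) ∘_H (Y + β) = [X, Y] + L_X β - ι_Y dα + ι_X ι_Y H`, where `L_X β = d ι_X β + ι_X d β`. -/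
def dorfman (H : DForm E M 3 ℝ) (U W : GSec E M) : GSec E M := fun x =>
  let X : VField E M := fun x => (U x).1
  let Y : VField E M := fun x => (W x).1
  let α : DForm E M 1 ℝ := fun x => (U x).2
  let β : DForm E M 1 ℝ := fun x => (W x).2
  (VectorField.mlieBracket 𝓘(ℝ, E) X Y x,
    extD (inter X β) x + inter X (extD β) x - inter Y (extD α) x + inter X (inter Y H) x)

/-- The twisted Courant bracket, the antisymmetrization of the Dorfman bracket. -/
def courant (H : DForm E M 3 ℝ) (U W : GSec E M) : GSec E M :=
  (1 / 2 : ℝ) • (dorfman H U W - dorfman H W U)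

end Forms

/-! ### Principal circle bundles with connection -/

/-- The element `e^{2πit}` of the circle group `𝕋 = ℝ/ℤ`. -/
def rot (t : ℝ) : Circle := Circle.exp (2 * Real.pi * t)

section Bundles

variable {E : Type*} [NormedAddCommGroup E] [NormedSpace ℝ E]
  {M : Type*} [TopologicalSpace M] [ChartedSpace E M] [MulAction Circle M]

variable (E) in
/-- The vector field generating a circle action, `v_z = d/dt|_{t = 0} (e^{2πit} · z)`. -/
def vert (z : M) : Tan E M z :=
  (mfderiv 𝓘(ℝ, ℝ) 𝓘(ℝ, E) (fun t : ℝ => rot t • z) 0 (1 : ℝ) :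
    Tan E M (rot 0 • z))

/-- A section `X + α` of `TM ⊕ T^*M` which is smooth and `𝕋`-invariant. -/
structure IsInvSection [IsManifold 𝓘(ℝ, E) ∞ M] (U : GSec E M) : Prop where
  smooth_vec : ContMDiff 𝓘(ℝ, E) 𝓘(ℝ, E).tangent ∞
    (fun x => (⟨x, (U x).1⟩ : TangentBundle 𝓘(ℝ, E) M))
  smooth_form : ∀ x, SmoothFormAt (fun x => (U x).2) x
  inv_vec : ∀ (c : Circle) (x : M),
    mfderiv 𝓘(ℝ, E) 𝓘(ℝ, E) (fun y : M => c • y) x (U x).1 = (U (c • x)).1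
  inv_form : ∀ c : Circle, pull (fun y : M => c • y) (fun x => (U x).2) = fun x => (U x).2

/-- The section of the bundle of Clifford algebras of `TM ⊕ T^*M` given by `U`. -/
def gammaSec (U : GSec E M) : ∀ x : M, CliffordAlgebra (pairingQ (E := E) x) :=
  fun x => CliffordAlgebra.ι (pairingQ (E := E) x) (U x)

/-- The algebra of sections of the bundle of Clifford algebras of `TM ⊕ T^*M` which is generated by
the `γ_U` for smooth `𝕋`-invariant sections `U` of `TM ⊕ T^*M`. -/
def invCliff (E : Type*) [NormedAddCommGroup E] [NormedSpace ℝ E]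
    (M : Type*) [TopologicalSpace M] [ChartedSpace E M] [MulAction Circle M]
    [IsManifold 𝓘(ℝ, E) ∞ M] :
    Subalgebra ℝ (∀ x : M, CliffordAlgebra (pairingQ (E := E) x)) :=
  Algebra.adjoin ℝ {a | ∃ U : GSec E M, IsInvSection U ∧ a = gammaSec U}

/-- The space `Ω^*_n(M) = {η ∈ Ω^*(M, ℂ) | L_v η = 2πi n η}` of forms of weight `n`, where `L_v` is
the Lie derivative along the generator of the circle action,
`(L_v η)_z = d/dt|_{t = 0} ((e^{2πit})^* η)_z`. -/
def weightForms (E : Type*) [NormedAddCommGroup E] [NormedSpace ℝ E]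
    (M : Type*) [TopologicalSpace M] [ChartedSpace E M] [MulAction Circle M] (n : ℤ) :
    Set (GForm E M ℂ) :=
  {η | (∀ k x, SmoothFormAt (η k) x) ∧
    ∀ (k : ℕ) (x : M) (u : Fin k → Tan E M x),
      HasDerivAt (fun t : ℝ => pull (fun y : M => rot t • y) (η k) x u)
        (2 * Real.pi * Complex.I * n * η k x u) 0}

end Bundles

variable {EX : Type*} [NormedAddCommGroup EX] [NormedSpace ℝ EX]
  {X : Type*} [TopologicalSpace X] [ChartedSpace EX X]
  {EP : Type*} [NormedAddCommGroup EP] [NormedSpace ℝ EP]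
  {P : Type*} [TopologicalSpace P] [ChartedSpace EP P] [MulAction Circle P]
  {EQ : Type*} [NormedAddCommGroup EQ] [NormedSpace ℝ EQ]
  {Q : Type*} [TopologicalSpace Q] [ChartedSpace EQ Q] [MulAction Circle Q]

/-- A smooth section `s` of a map `proj : P → X` and a smooth equivariant function
`h : P → Circle`, both over the open set `U`, with `z = h z • s (proj z)`. Equivalently, `z ↦
(proj z, h z)` is an equivariant diffeomorphism of `proj⁻¹ U` with `U × 𝕋`. -/
structure IsLocalTriv (EX EP : Type*) [NormedAddCommGroup EX] [NormedSpace ℝ EX]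
    [NormedAddCommGroup EP] [NormedSpace ℝ EP]
    {X P : Type*} [TopologicalSpace X] [ChartedSpace EX X]
    [TopologicalSpace P] [ChartedSpace EP P] [MulAction Circle P]
    (proj : P → X) (U : Set X) (s : X → P) (h : P → Circle) : Prop where
  isOpen : IsOpen U
  smooth_section : ContMDiffOn 𝓘(ℝ, EX) 𝓘(ℝ, EP) ∞ s U
  smooth_angle : ContMDiffOn 𝓘(ℝ, EP) (𝓡 1) ∞ h (proj ⁻¹' U)
  proj_section : ∀ x ∈ U, proj (s x) = x
  angle_smul : ∀ z ∈ proj ⁻¹' U, ∀ c : Circle, h (c • z) = c * h z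
  angle_smul_section : ∀ z ∈ proj ⁻¹' U, h z • s (proj z) = z

/-- A smooth principal circle bundle `P → X` with a connection 1-form `conn`: a real invariant
1-form which is `1` on the generator of the action of `𝕋 = ℝ/ℤ`. -/
structure CircleBundle (EX X EP P : Type*) [NormedAddCommGroup EX] [NormedSpace ℝ EX]
    [TopologicalSpace X] [ChartedSpace EX X] [NormedAddCommGroup EP] [NormedSpace ℝ EP]
    [TopologicalSpace P] [ChartedSpace EP P] [MulAction Circle P] where
  proj : P → X
  smooth_proj : ContMDiff 𝓘(ℝ, EP) 𝓘(ℝ, EX) ∞ proj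
  smooth_action : ContMDiff ((𝓡 1).prod 𝓘(ℝ, EP)) 𝓘(ℝ, EP) ∞ (fun q : Circle × P => q.1 • q.2)
  proj_smul : ∀ (c : Circle) (z : P), proj (c • z) = proj z
  exists_localTriv : ∀ x : X, ∃ (U : Set X) (s : X → P) (h : P → Circle),
    x ∈ U ∧ IsLocalTriv EX EP proj U s h
  conn : DForm EP P 1 ℝ
  conn_smooth : ∀ z, SmoothFormAt conn z
  conn_inv : ∀ c : Circle, pull (fun y : P => c • y) conn = conn
  conn_vert : ∀ z : P, conn z ![vert EP z] = 1

namespace CircleBundle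

variable (p : CircleBundle EX X EP P) (q : CircleBundle EX X EQ Q)

theorem proj_surjective : Function.Surjective p.proj := fun x => by
  obtain ⟨U, s, h, hx, t⟩ := p.exists_localTriv x
  exact ⟨s x, t.proj_section x hx⟩

/-- A point of the fibre over `x`. -/
def pt (x : X) : P := Function.surjInv p.proj_surjective x

/-- The differential of the projection (`T_x X` is the model space `EX`). -/
def dproj (z : P) : Tan EP P z →L[ℝ] EX := mfderiv 𝓘(ℝ, EP) 𝓘(ℝ, EX) p.proj z

theorem smooth_rot (p : CircleBundle EX X EP P) (z : P) :
    ContMDiff 𝓘(ℝ, ℝ) 𝓘(ℝ, EP) ∞ (fun t : ℝ => rot t • z) := by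
  have h1 : ContMDiff 𝓘(ℝ, ℝ) (𝓡 1) ∞ (fun t : ℝ => rot t) := by
    refine contMDiff_circleExp.comp ?_
    exact (contDiff_const.mul contDiff_id).contMDiff
  exact p.smooth_action.comp (h1.prodMk contMDiff_const)

theorem dproj_vert (z : P) : p.dproj z (vert EP z) = 0 := by
  have h0 : rot 0 • z = z := by simp [rot]
  have hf : MDifferentiableAt 𝓘(ℝ, ℝ) 𝓘(ℝ, EP) (fun t : ℝ => rot t • z) 0 :=
    (p.smooth_rot z).mdifferentiableAt (by simp)
  have hg : MDifferentiableAt 𝓘(ℝ, EP) 𝓘(ℝ, EX) p.proj (rot 0 • z) :=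
    p.smooth_proj.mdifferentiableAt (by simp)
  have hc := mfderiv_comp (0 : ℝ) hg hf
  have hk : p.proj ∘ (fun t : ℝ => rot t • z) = fun _ => p.proj z := by
    funext t; exact p.proj_smul _ _
  rw [hk, mfderiv_const] at hc
  have := congrArg (fun L => (L (1 : ℝ) : EX)) hc
  unfold dproj vert
  rw [h0] at this
  exact this.symm

open Classical in
/-- The horizontal lift `T_x X → T_z P` of the connection: the linear right inverse of the
differential of the projection with values in the kernel of the connection form. -/
def hor (z : P) : EX →L[ℝ] Tan EP P z :=
  if h : ∃ L : EX →L[ℝ] Tan EP P z, ∀ u, p.dproj z (L u) = u ∧ p.conn z ![L u] = 0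
  then h.choose else 0

/-! ### The line bundle `ξ^{⊗n}` -/

/-- The fibre at `x` of the line bundle `ξ^{⊗n}` associated with `P` and the `n`-th power of the
standard representation of the circle: functions `f` on the fibre of `P` over `x` (extended by
zero) with `f (c • z) = c^{-n} f z`. The value `f z` is the coefficient of `f` with respect to the
basis vector `z^{⊗n}`, a point `z` of `P` being regarded as a unit vector of `ξ`. -/
def line (n : ℤ) (x : X) : Submodule ℂ (P → ℂ) where
  carrier := {f | (∀ z, p.proj z ≠ x → f z = 0) ∧
    ∀ (c : Circle) (z : P), f (c • z) = (c : ℂ) ^ (-n) * f z}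
  add_mem' {f g} hf hg := ⟨fun z hz => by simp [hf.1 z hz, hg.1 z hz],
    fun c z => by simp [hf.2 c z, hg.2 c z, mul_add]⟩
  zero_mem' := ⟨fun _ _ => rfl, fun c z => by simp⟩
  smul_mem' a f hf := ⟨fun z hz => by simp [hf.1 z hz],
    fun c z => by simp [hf.2 c z]; ring⟩

/-- The coefficient of a form on `Q` with values in (the pullback to `Q` of) `ξ^{⊗n}` with respect
to the local frame `s^{⊗n}`, where `s` is a local section of `P`. -/
def coeff (s : X → P) {k : ℕ} (ψ : DForm EQ Q k (P → ℂ)) : DForm EQ Q k ℂ := fun w =>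
  (ContinuousLinearMap.proj (R := ℝ) (φ := fun _ : P => ℂ)
    (s (q.proj w))).compContinuousAlternatingMap (ψ w)

/-- The space of `𝕋̂`-invariant smooth forms on `Q` with values in the pullback of `ξ^{⊗n}` to `Q`.
Smoothness means that the coefficients with respect to `s^{⊗n}` are smooth for all local smooth
sections `s` of `P`. The circle acting on `Q` acts trivially on the fibres of the pullback. -/
def twistedForms (n : ℤ) : Set (GForm EQ Q (P → ℂ)) :=
  {ψ | (∀ k w u, ψ k w u ∈ p.line n (q.proj w)) ∧
    (∀ (U : Set X) (s : X → P), IsOpen U → ContMDiffOn 𝓘(ℝ, EX) 𝓘(ℝ, EP) ∞ s U →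
      (∀ x ∈ U, p.proj (s x) = x) →
      ∀ k, ∀ w ∈ q.proj ⁻¹' U, SmoothFormAt (coeff q s (ψ k)) w) ∧
    ∀ (c : Circle) (k : ℕ), pull (fun y : Q => c • y) (ψ k) = ψ k}

/-- A smooth section of `P` near `proj z` which passes through `z`. -/
def secThrough (z : P) : X → P :=
  let s := (p.exists_localTriv (p.proj z)).choose_spec.choose
  let h := (p.exists_localTriv (p.proj z)).choose_spec.choose_spec.choose
  fun x => h z • s x

open Classical in
/-- The exterior covariant derivative on forms on `Q` with values in the pullback of `ξ^{⊗n}`, for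
the pullback of the connection on `ξ^{⊗n}` induced by the connection of `P`. With respect to a local
frame `s^{⊗n}` it is `d + 2πi n A_s`, where `A_s` is the pullback of the connection form by `s`. -/
def covD (n : ℤ) (ψ : GForm EQ Q (P → ℂ)) : GForm EQ Q (P → ℂ) := fun k w =>
  ContinuousAlternatingMap.pi fun z : P =>
    if p.proj z = q.proj w then
      let s := p.secThrough z
      let A : DForm EQ Q 1 ℝ := pull q.proj (pull s p.conn : DForm EX X 1 ℝ)
      let σ : GForm EQ Q ℂ := fun k => coeff q s (ψ k)
      (gextD σ + (2 * Real.pi * Complex.I * n : ℂ) • gfwedge A σ) k w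
    else 0

/-- The differential `∇^{ξ^{⊗n}} - ι_{2πi n v̂} + Ĥ` on forms on `Q` with values in the pullback of
`ξ^{⊗n}`; here `v̂` generates the circle action on `Q`. -/
def twistedD (n : ℤ) (K : DForm EQ Q 3 ℝ) (ψ : GForm EQ Q (P → ℂ)) : GForm EQ Q (P → ℂ) :=
  covD p q n ψ - (2 * Real.pi * Complex.I * n : ℂ) • ginter (vert EQ) ψ + gfwedge K ψ

/-! ### The correspondence space and fibre integration -/

/-- The correspondence space `P ×_X Q`. -/
def Corr : Type _ := {a : P × Q // p.proj a.1 = q.proj a.2}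

/-- The tangent space of `P ×_X Q` at `a`. -/
def corrTan (a : Corr p q) : Submodule ℝ (Tan EP P a.1.1 × Tan EQ Q a.1.2) :=
  LinearMap.ker (((p.dproj a.1.1).comp (ContinuousLinearMap.fst ℝ _ _) -
    (q.dproj a.1.2).comp (ContinuousLinearMap.snd ℝ _ _) :
      Tan EP P a.1.1 × Tan EQ Q a.1.2 →L[ℝ] EX) : Tan EP P a.1.1 × Tan EQ Q a.1.2 →ₗ[ℝ] EX)

/-- The differential of `P ×_X Q → P`. -/
def dfst (a : Corr p q) : corrTan p q a →L[ℝ] Tan EP P a.1.1 :=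
  (ContinuousLinearMap.fst ℝ _ _).comp (corrTan p q a).subtypeL

/-- The differential of `P ×_X Q → Q`. -/
def dsnd (a : Corr p q) : corrTan p q a →L[ℝ] Tan EQ Q a.1.2 :=
  (ContinuousLinearMap.snd ℝ _ _).comp (corrTan p q a).subtypeL

/-- The tangent vector of `P ×_X Q` generating the circle action on `P`. -/
def corrVert (a : Corr p q) : corrTan p q a :=
  ⟨(vert EP a.1.1, 0), by simp [corrTan, p.dproj_vert]⟩

open Classical in
/-- A linear right inverse of the differential of `P ×_X Q → Q`. -/
def corrLift (a : Corr p q) : Tan EQ Q a.1.2 →L[ℝ] corrTan p q a :=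
  if h : ∃ L : Tan EQ Q a.1.2 →L[ℝ] corrTan p q a, ∀ u, dsnd p q a (L u) = u
  then h.choose else 0

/-- Complex forms of mixed degree on `P ×_X Q`. -/
abbrev CorrForm : Type _ := ∀ a : Corr p q, GAlt (corrTan p q a) ℂ

/-- The 2-form `A ∧ Â` on `P ×_X Q`, where `A` and `Â` are the connection forms of `P` and `Q`. -/
def connWedge (a : Corr p q) : corrTan p q a [⋀^Fin 2]→L[ℝ] ℝ :=
  wedge rfl ((p.conn a.1.1).compContinuousLinearMap (dfst p q a))
    ((q.conn a.1.2).compContinuousLinearMap (dsnd p q a))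

/-- The integrand of fibre integration along `P ×_X Q → Q` at the point `a`: the contraction of the
form with the generator of the circle action on `P` (in the first slot), regarded as a form on the
tangent space of `Q`. It does not depend on the choice of the lift. -/
def fibIntegrand (η : CorrForm p q) (a : Corr p q) : GAlt (Tan EQ Q a.1.2) ℂ := fun k =>
  (gcontract (corrVert p q a) (η a) k).compContinuousLinearMap (corrLift p q a)

/-- Twisted integration along the fibres of `P ×_X Q → Q`: the coefficient of
`∫^{𝕋, n} η ∈ Ω^*(Q, ξ^{⊗n})` at `a = (z, w)` with respect to the basis vector `z^{⊗n}`, that is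
`∫ e^{2πi n t} η`, where `t` is the coordinate of the point `e^{2πit} • z` of the fibre. For `n = 0`
this is the usual integration along the fibre. -/
def fibInt (n : ℤ) (η : CorrForm p q) (a : Corr p q) : GAlt (Tan EQ Q a.1.2) ℂ := fun k =>
  let g : ℝ → (EQ [⋀^Fin k]→L[ℝ] ℂ) := fun t =>
    ((rot t : ℂ) ^ n) • fibIntegrand p q η
      ⟨(rot t • a.1.1, a.1.2), (p.proj_smul _ _).trans a.2⟩ k
  (∫ t in (0 : ℝ)..1, g t : EQ [⋀^Fin k]→L[ℝ] ℂ)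

open Classical in
/-- The exotic Hori formula `τ_n η = ∫^{𝕋, n} η e^{-A ∧ Â}`, from forms on `P` to forms on `Q` with
values in the pullback of `ξ^{⊗n}`. Exchanging `P` and `Q` gives the dual formula with
`e^{-Â ∧ A} = e^{A ∧ Â}`. -/
def tau (n : ℤ) (η : GForm EP P ℂ) : GForm EQ Q (P → ℂ) := fun k w =>
  ContinuousAlternatingMap.pi fun z : P =>
    if h : p.proj z = q.proj w then
      fibInt p q n (fun a => expWedge (-connWedge p q a)
        (fun k => (η k a.1.1).compContinuousLinearMap (dfst p q a))) ⟨(z, w), h⟩ k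
    else 0

/-- The inverse exotic Hori formula `σ̂_n θ = ∫^{𝕋̂} θ · ρ^{-n} · e^{A ∧ Â}`, from forms on `Q` with
values in the pullback of `ξ^{⊗n}` to forms on `P`. Here `ρ` is the tautological section of `ξ` over
`P`, so that the value of `θ · ρ^{-n}` at `(z, w)` is the coefficient of `θ_w` with respect to
`z^{⊗n}` (on coefficients the formula is the same for all `n`); the integral is over the fibres of
`P ×_X Q → P`, so the correspondence space is written
as `Q ×_X P`, and `A ∧ Â = -Â ∧ A`. Exchanging `P` and `Q` gives the dual formula with
`e^{-A ∧ Â}`. -/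
def sigmaInv (θ : GForm EQ Q (P → ℂ)) : GForm EP P ℂ := fun k z =>
  fibInt q p 0 (fun a => expWedge (-connWedge q p a)
    (fun k => ((ContinuousLinearMap.proj (R := ℝ) (φ := fun _ : P => ℂ)
      a.1.2).compContinuousAlternatingMap (θ k a.1.1)).compContinuousLinearMap (dfst q p a)))
    ⟨(q.pt (p.proj z), z), Function.surjInv_eq _ _⟩ k

/-- The twisted de Rham differential `d + H`. -/
def twistedDeRham (H : DForm EP P 3 ℝ) (η : GForm EP P ℂ) : GForm EP P ℂ :=
  gextD η + gfwedge H η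

/-! ### The map `φ` on generalized vector fields -/

/-- Let `z` and `w` be points of `P` and `Q` over the same point of `X`. For an element
`(x + f v) + (θ + g A)` of the fibre of `TP ⊕ T^*P` at `z`, where `x` is horizontal and `θ` is pulled
back from `X`, this is `(x + g v̂) + (θ + f Â)` at `w`. -/
def phiAt (z : P) (w : Q) (U : GTan EP P z) : GTan EQ Q w :=
  (q.hor w (p.dproj z U.1) + U.2 ![vert EP z] • vert EQ w,
    U.2.compContinuousLinearMap ((p.hor z).comp (q.dproj w)) + p.conn z ![U.1] • q.conn w)

/-- The map `φ` from invariant sections of `TP ⊕ T^*P` to invariant sections of `TQ ⊕ T^*Q`. -/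
def phi (U : GSec EP P) : GSec EQ Q := fun w =>
  phiAt p q (p.pt (q.proj w)) w (U (p.pt (q.proj w)))

end CircleBundle

end ExoticHori

end

open ExoticHori ExoticHori.CircleBundle

set_option linter.unusedSectionVars false

namespace ExoticHori

/-! ### Exterior algebra at a point -/

/-! The connection splits each tangent space of `P` into a horizontal part and the line spanned by
v. A form at a point is therefore uniquely π^*a + A ∧ π^*b with forms a, b on the tangent space of
the base (`IsSplitting.assemble_parts`), and (a, b) serves as its coordinates. Since A ∧ Â has
square zero, e^{-A ∧ Â} = 1 - A ∧ Â, and contracting the product with v leaves b - Â ∧ a. On a form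
of weight -n the factor e^{2πint} makes the integrand constant along the fibre, so fibre integration
is evaluation (`fibInt_formula`). In coordinates τ_n and σ̂_n are thus both the quarter turn (a, b)
↦ (b, -a) (`coeffAt_tau`, `formAt_sigmaInv`), whose square is -1; this gives σ̂_n = -τ_n⁻¹.

The element (x + f v) + (θ + g A) acts by (a, b) ↦ (ι_x a + f b + θ ∧ a, -ι_x b + g a - θ ∧ b). Up
to the sign -1, the quarter turn carries this to the same formula with f and g exchanged, and φ is
exactly this exchange (`tau_cliff`). The pairing is half of θ(x') + θ'(x) + f g' + f' g, which the
exchange preserves; so φ is orthogonal and acts on Clifford algebras.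

For the differentials, take a local section s of `P`, put α = s^*A, and let t be the angle relative
to s, so that dt = A - π^*α. A form of weight -n is locally e^{-2πint}(π^*a + A ∧ π^*b) with a, b on
the base, and dA = π^*F gives d + H in coordinates (`formAt_twistedDeRham`). The coefficient of its
image in the frame defined by s is b - Â ∧ a. There F' enters through dÂ and F through Ĥ, the
reverse of the situation on `P`, and the term -2πin a produced by the A in dt is matched by the
contraction with 2πin v̂ (`tau_twistedDeRham`).

For the bracket, an invariant section amounts to data x, f, g, θ on the base (`exists_hasBase`). The
formula dβ(V, W) = V β(W) - W β(V) - β([V, W]), applied to A and to dπ in a chart, expresses the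
Dorfman bracket in these data. The result is symmetric under exchanging (f, F) with (g, F'), because
H = A ∧ F' + Ω and Ĥ = Â ∧ F + Ω (`dorfmanHor_swap`, `phiAt_dorfman`). -/

theorem sum_perm_succ {A : Type*} [AddCommMonoid A] {m : ℕ}
    (g : Equiv.Perm (Fin (m + 1)) → A) :
    ∑ σ, g σ = ∑ i : Fin (m + 1), ∑ τ : Equiv.Perm (Fin m),
      g (Equiv.Perm.decomposeFin.symm (0, τ) * i.cycleRange) := by
  rw [← Fintype.sum_prod_type' (fun (i : Fin (m + 1)) (τ : Equiv.Perm (Fin m)) =>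
      g (Equiv.Perm.decomposeFin.symm (0, τ) * i.cycleRange))]
  -- Here i is the preimage of 0: `i.cycleRange` moves i to 0 and keeps the order of the rest, after
  -- which τ permutes the nonzero places. Injectivity and (m + 1)! = (m + 1) · m! suffice.
  have hb : Function.Bijective (fun q : Fin (m + 1) × Equiv.Perm (Fin m) =>
      Equiv.Perm.decomposeFin.symm (0, q.2) * q.1.cycleRange) := by
    rw [Fintype.bijective_iff_injective_and_card]
    constructor
    · rintro ⟨i, τ⟩ ⟨j, τ'⟩ hq
      dsimp only at hq
      have hi : i = j := by
        have h1 := congrArg (fun e : Equiv.Perm (Fin (m + 1)) => e i) hq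
        have h2 : Equiv.Perm.decomposeFin.symm (0, τ') (i.cycleRange i) = 0 := by
          rw [Fin.cycleRange_self]; simp
        have h3 : Equiv.Perm.decomposeFin.symm (0, τ') (j.cycleRange i) = 0 := by
          have h4 : Equiv.Perm.decomposeFin.symm (0, τ) (i.cycleRange i) = 0 := by
            rw [Fin.cycleRange_self]; simp
          simpa [Equiv.Perm.mul_apply, h4] using h1.symm
        have h5 := (Equiv.Perm.decomposeFin.symm (0, τ')).injective (h2.trans h3.symm)
        rw [Fin.cycleRange_self] at h5
        have h6 : j.cycleRange j = 0 := Fin.cycleRange_self j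
        exact j.cycleRange.injective (h5.symm.trans h6.symm)
      subst hi
      have := mul_right_cancel hq
      have := Equiv.Perm.decomposeFin.symm.injective this
      simpa using this
    · simp [Fintype.card_perm, Nat.factorial_succ]
  exact (Function.Bijective.sum_comp hb g).symm

section Pointwise

variable {V : Type*} [AddCommGroup V] [Module ℝ V] [TopologicalSpace V]
  {W : Type*} [AddCommGroup W] [Module ℝ W] [TopologicalSpace W]
  {F : Type*} [AddCommGroup F] [Module ℝ F] [TopologicalSpace F]

theorem contract_apply {k : ℕ} (x : V) (η : V [⋀^Fin (k + 1)]→L[ℝ] F) (u : Fin k → V) :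
    contract x η u = η (Matrix.vecCons x u) := rfl

theorem form_ext_zero {α β : V [⋀^Fin 0]→L[ℝ] F} (h : α ![] = β ![]) : α = β := by
  ext u
  rw [Subsingleton.elim u ![]]
  exact h

/-- The induction device for the identities of exterior algebra below: inserting one arbitrary
vector lowers the degree by one. -/
theorem form_ext_succ {k : ℕ} {α β : V [⋀^Fin (k + 1)]→L[ℝ] F}
    (h : ∀ x, contract x α = contract x β) : α = β := by
  ext u
  have := congrArg (fun γ : V [⋀^Fin k]→L[ℝ] F => γ (Matrix.vecTail u)) (h (Matrix.vecHead u))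
  simpa [contract_apply] using this

theorem map_insertNth_eq {k : ℕ} (η : V [⋀^Fin (k + 1)]→L[ℝ] F) (i : Fin (k + 1)) (x : V)
    (u : Fin k → V) : η (i.insertNth x u) = (-1) ^ (i : ℕ) • contract x η u :=
  η.toAlternatingMap.map_insertNth i x u

theorem contract_comp {k : ℕ} (L : W →L[ℝ] V) (x : W) (η : V [⋀^Fin (k + 1)]→L[ℝ] F) :
    contract x (η.compContinuousLinearMap L) = (contract (L x) η).compContinuousLinearMap L := by
  ext u
  simp only [contract_apply, ContinuousAlternatingMap.compContinuousLinearMap_apply]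
  congr 1
  funext i
  refine Fin.cases ?_ (fun j => ?_) i <;> rfl

theorem contract_zero {k : ℕ} (x : V) : contract x (0 : V [⋀^Fin (k + 1)]→L[ℝ] F) = 0 := rfl

theorem contract_smul {R : Type*} [Monoid R] [DistribMulAction R F] [ContinuousConstSMul R F]
    [SMulCommClass ℝ R F] {k : ℕ} (x : V) (c : R) (η : V [⋀^Fin (k + 1)]→L[ℝ] F) :
    contract x (c • η) = c • contract x η := rfl

theorem contract_smul_vec [ContinuousConstSMul ℝ F] {k : ℕ} (x : V) (c : ℝ)
    (η : V [⋀^Fin (k + 1)]→L[ℝ] F) :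
    contract (c • x) η = c • contract x η := by
  ext u
  exact η.toAlternatingMap.map_vecCons_smul u c x

theorem contract_contract_self {k : ℕ} (x : V) (η : V [⋀^Fin (k + 2)]→L[ℝ] F) :
    contract x (contract x η) = 0 := by
  ext u
  exact η.map_eq_zero_of_eq _ (i := 0) (j := 1) rfl (by simp)

variable [IsTopologicalAddGroup F] [ContinuousSMul ℝ F]

theorem contract_add {k : ℕ} (x : V) (η ζ : V [⋀^Fin (k + 1)]→L[ℝ] F) :
    contract x (η + ζ) = contract x η + contract x ζ := rfl

theorem contract_add_vec {k : ℕ} (x y : V) (η : V [⋀^Fin (k + 1)]→L[ℝ] F) :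
    contract (x + y) η = contract x η + contract y η := by
  ext u
  exact η.toAlternatingMap.map_vecCons_add u x y

/-- Polarization of `contract_contract_self` at x + y. -/
theorem contract_contract_swap {k : ℕ} (x y : V) (η : V [⋀^Fin (k + 2)]→L[ℝ] F) :
    contract x (contract y η) = -contract y (contract x η) := by
  have h := contract_contract_self (x + y) η
  rw [contract_add_vec x y η, contract_add, contract_add_vec, contract_add_vec,
    contract_contract_self, contract_contract_self] at h
  simp only [zero_add, add_zero] at h
  exact eq_neg_of_add_eq_zero_right h

theorem wedge_apply {k l m : ℕ} (h : k + l = m) (α : V [⋀^Fin k]→L[ℝ] ℝ)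
    (β : V [⋀^Fin l]→L[ℝ] F) (v : Fin m → V) :
    wedge h α β v = ((k.factorial * l.factorial : ℕ) : ℝ)⁻¹ •
      ∑ σ : Equiv.Perm (Fin m), Equiv.Perm.sign σ •
        (α (fun i => v (σ (Fin.cast h (Fin.castAdd l i)))) •
          β (fun j => v (σ (Fin.cast h (Fin.natAdd k j))))) := by
  rw [wedge, ContinuousAlternatingMap.smul_apply,
    ContinuousMultilinearMap.alternatization_apply_apply]
  rfl

theorem wedge_comp {k l m : ℕ} (h : k + l = m) (α : V [⋀^Fin k]→L[ℝ] ℝ)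
    (β : V [⋀^Fin l]→L[ℝ] F) (L : W →L[ℝ] V) :
    (wedge h α β).compContinuousLinearMap L =
      wedge h (α.compContinuousLinearMap L) (β.compContinuousLinearMap L) := by
  ext v
  rw [ContinuousAlternatingMap.compContinuousLinearMap_apply, wedge_apply, wedge_apply]
  rfl

theorem wedge_add_left {k l m : ℕ} (h : k + l = m) (α α' : V [⋀^Fin k]→L[ℝ] ℝ)
    (β : V [⋀^Fin l]→L[ℝ] F) : wedge h (α + α') β = wedge h α β + wedge h α' β := by
  ext v
  simp only [wedge_apply, ContinuousAlternatingMap.add_apply, add_smul, smul_add,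
    Finset.sum_add_distrib]

theorem wedge_add_right {k l m : ℕ} (h : k + l = m) (α : V [⋀^Fin k]→L[ℝ] ℝ)
    (β β' : V [⋀^Fin l]→L[ℝ] F) : wedge h α (β + β') = wedge h α β + wedge h α β' := by
  ext v
  simp only [wedge_apply, ContinuousAlternatingMap.add_apply, smul_add,
    Finset.sum_add_distrib]

theorem wedge_smul_left {k l m : ℕ} (h : k + l = m) (c : ℝ) (α : V [⋀^Fin k]→L[ℝ] ℝ)
    (β : V [⋀^Fin l]→L[ℝ] F) : wedge h (c • α) β = c • wedge h α β := by
  ext v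
  simp only [wedge_apply, ContinuousAlternatingMap.smul_apply, smul_eq_mul, mul_smul,
    Finset.smul_sum]
  refine Finset.sum_congr rfl fun σ _ => ?_
  rw [smul_comm _ c, smul_comm _ c]

theorem wedge_smul_right {R : Type*} [Monoid R] [DistribMulAction R F] [ContinuousConstSMul R F]
    [SMulCommClass ℝ R F] {k l m : ℕ} (h : k + l = m) (c : R) (α : V [⋀^Fin k]→L[ℝ] ℝ)
    (β : V [⋀^Fin l]→L[ℝ] F) : wedge h α (c • β) = c • wedge h α β := by
  ext v
  simp only [wedge_apply, ContinuousAlternatingMap.smul_apply, Finset.smul_sum]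
  refine Finset.sum_congr rfl fun σ _ => ?_
  rw [smul_comm _ c (β _), ← smul_comm c (Equiv.Perm.sign σ), smul_comm]

theorem wedge_zero_right {k l m : ℕ} (h : k + l = m) (α : V [⋀^Fin k]→L[ℝ] ℝ) :
    wedge h α (0 : V [⋀^Fin l]→L[ℝ] F) = 0 := by
  ext v; simp [wedge_apply]

theorem wedge_neg_left {k l m : ℕ} (h : k + l = m) (α : V [⋀^Fin k]→L[ℝ] ℝ)
    (β : V [⋀^Fin l]→L[ℝ] F) : wedge h (-α) β = -wedge h α β := by
  rw [← neg_one_smul ℝ α, wedge_smul_left, neg_one_smul]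

theorem wedge_neg_right {k l m : ℕ} (h : k + l = m) (α : V [⋀^Fin k]→L[ℝ] ℝ)
    (β : V [⋀^Fin l]→L[ℝ] F) : wedge h α (-β) = -wedge h α β := by
  rw [← neg_one_smul ℝ β, wedge_smul_right, neg_one_smul]

/-- The wedge product with a form of degree zero is multiplication by its value. -/
theorem wedge_deg_zero {l : ℕ} (h : 0 + l = l) (α : V [⋀^Fin 0]→L[ℝ] ℝ)
    (β : V [⋀^Fin l]→L[ℝ] F) : wedge h α β = α ![] • β := by
  ext v
  rw [wedge_apply, ContinuousAlternatingMap.smul_apply]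
  -- The sign cancels against the one from reordering the arguments of β, so all l! summands agree
  -- and cancel the normalising factor.
  have : ∀ σ : Equiv.Perm (Fin l), Equiv.Perm.sign σ •
        (α (fun i => v (σ (Fin.cast h (Fin.castAdd l i)))) •
          β (fun j => v (σ (Fin.cast h (Fin.natAdd 0 j))))) = α ![] • β v := by
    intro σ
    rw [Subsingleton.elim (fun i => v (σ (Fin.cast h (Fin.castAdd l i)))) ![],
      smul_comm]
    congr 1
    have e : (fun j => v (σ (Fin.cast h (Fin.natAdd 0 j)))) = v ∘ σ := by
      funext j; simp only [Function.comp_apply]; congr 2; ext; simp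
    rw [e]
    have := β.toAlternatingMap.map_perm v σ
    erw [this]
    rw [smul_smul, Int.units_mul_self, one_smul]
    rfl
  rw [Finset.sum_congr rfl fun σ _ => this σ, Finset.sum_const, Finset.card_univ,
    Fintype.card_perm, Fintype.card_fin, ← Nat.cast_smul_eq_nsmul ℝ, smul_smul]
  simp [Nat.factorial_ne_zero]

/-- `i.cycleRange` is a cycle on i + 1 places, hence has sign (-1)^i, and adjoining the fixed point
0 does not change the sign of τ. -/
theorem sign_decompose_mul_cycleRange {m : ℕ} (τ : Equiv.Perm (Fin m)) (i : Fin (m + 1)) :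
    Equiv.Perm.sign (Equiv.Perm.decomposeFin.symm (0, τ) * i.cycleRange) =
      (-1) ^ (i : ℕ) * Equiv.Perm.sign τ := by
  rw [Equiv.Perm.sign_mul, Fin.sign_cycleRange, Equiv.Perm.decomposeFin.symm_sign]
  simp [mul_comm]

theorem vecCons_decompose_mul_cycleRange {m : ℕ} (x : V) (v : Fin m → V)
    (τ : Equiv.Perm (Fin m)) (i : Fin (m + 1)) (a : Fin (m + 1)) :
    (Matrix.vecCons x v : Fin (m + 1) → V)
      ((Equiv.Perm.decomposeFin.symm (0, τ) * i.cycleRange) a) =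
      (i.insertNth x (v ∘ τ) : Fin (m + 1) → V) a := by
  refine Fin.succAboveCases i ?_ (fun b => ?_) a
  · rw [Equiv.Perm.mul_apply, Fin.cycleRange_self]
    simp
  · rw [Equiv.Perm.mul_apply, Fin.cycleRange_succAbove, Equiv.Perm.decomposeFin_symm_apply_succ]
    simp

/-- Bookkeeping for the antiderivation rule: this lemma and the next three say that x lands either
in the block of α or in the block of β, and that the other block does not notice it. -/
theorem insertNth_left {k l m : ℕ} (h : k + 1 + l = m + 1) (h1 : k + l = m) (i : Fin (k + 1))
    (x : V) (v : Fin m → V) :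
    (fun a : Fin (k + 1) => (Fin.insertNth (Fin.cast h (Fin.castAdd l i)) x v : Fin (m + 1) → V)
      (Fin.cast h (Fin.castAdd l a))) =
      (i.insertNth x (fun a : Fin k => v (Fin.cast h1 (Fin.castAdd l a))) : Fin (k + 1) → V) := by
  funext a
  refine Fin.succAboveCases i ?_ (fun b => ?_) a
  · simp
  · have : Fin.cast h (Fin.castAdd l (i.succAbove b)) =
        (Fin.cast h (Fin.castAdd l i)).succAbove (Fin.cast h1 (Fin.castAdd l b)) := by
      ext
      simp only [Fin.succAbove, Fin.lt_def, Fin.val_castSucc, Fin.val_cast, Fin.val_castAdd]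
      split_ifs <;> simp
    rw [this]
    simp

theorem insertNth_left' {k l m : ℕ} (h : k + 1 + l = m + 1) (h1 : k + l = m) (i : Fin (k + 1))
    (x : V) (v : Fin m → V) :
    (fun a : Fin l => (Fin.insertNth (Fin.cast h (Fin.castAdd l i)) x v : Fin (m + 1) → V)
      (Fin.cast h (Fin.natAdd (k + 1) a))) =
      fun a : Fin l => v (Fin.cast h1 (Fin.natAdd k a)) := by
  funext a
  have : Fin.cast h (Fin.natAdd (k + 1) a) =
      (Fin.cast h (Fin.castAdd l i)).succAbove (Fin.cast h1 (Fin.natAdd k a)) := by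
    ext
    have := i.2
    simp only [Fin.succAbove, Fin.lt_def, Fin.val_castSucc, Fin.val_cast, Fin.val_castAdd,
      Fin.val_natAdd]
    split_ifs <;> simp <;> omega
  rw [this]
  simp

theorem insertNth_right {k l m : ℕ} (h : k + (l + 1) = m + 1) (h1 : k + l = m) (i : Fin (l + 1))
    (x : V) (v : Fin m → V) :
    (fun a : Fin (l + 1) => (Fin.insertNth (Fin.cast h (Fin.natAdd k i)) x v : Fin (m + 1) → V)
      (Fin.cast h (Fin.natAdd k a))) =
      (i.insertNth x (fun a : Fin l => v (Fin.cast h1 (Fin.natAdd k a))) : Fin (l + 1) → V) := by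
  funext a
  refine Fin.succAboveCases i ?_ (fun b => ?_) a
  · simp
  · have : Fin.cast h (Fin.natAdd k (i.succAbove b)) =
        (Fin.cast h (Fin.natAdd k i)).succAbove (Fin.cast h1 (Fin.natAdd k b)) := by
      ext
      simp only [Fin.succAbove, Fin.lt_def, Fin.val_castSucc, Fin.val_cast, Fin.val_natAdd,
        add_lt_add_iff_left]
      split_ifs <;> simp [add_assoc]
    rw [this]
    simp

theorem insertNth_right' {k l m : ℕ} (h : k + (l + 1) = m + 1) (h1 : k + l = m) (i : Fin (l + 1))
    (x : V) (v : Fin m → V) :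
    (fun a : Fin k => (Fin.insertNth (Fin.cast h (Fin.natAdd k i)) x v : Fin (m + 1) → V)
      (Fin.cast h (Fin.castAdd (l + 1) a))) =
      fun a : Fin k => v (Fin.cast h1 (Fin.castAdd l a)) := by
  funext a
  have : Fin.cast h (Fin.castAdd (l + 1) a) =
      (Fin.cast h (Fin.natAdd k i)).succAbove (Fin.cast h1 (Fin.castAdd l a)) := by
    ext
    have := a.2
    simp only [Fin.succAbove, Fin.lt_def, Fin.val_castSucc, Fin.val_cast, Fin.val_castAdd,
      Fin.val_natAdd]
    split_ifs <;> simp; omega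
  rw [this]
  simp

/-- The part of `ι_x (α ∧ β)` in which `x` is inserted at the position `i`. -/
def insertTerm {k l m : ℕ} (h : k + l = m + 1) (α : V [⋀^Fin k]→L[ℝ] ℝ)
    (β : V [⋀^Fin l]→L[ℝ] F) (x : V) (v : Fin m → V) (i : Fin (m + 1)) : F :=
  ∑ τ : Equiv.Perm (Fin m), ((-1) ^ (i : ℕ) * Equiv.Perm.sign τ) •
    (α (fun a => (i.insertNth x (v ∘ τ) : Fin (m + 1) → V) (Fin.cast h (Fin.castAdd l a))) •
      β (fun a => (i.insertNth x (v ∘ τ) : Fin (m + 1) → V) (Fin.cast h (Fin.natAdd k a))))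

/-- `sum_perm_succ` groups the permutations by the place which receives x; these places form the
block of α and the block of β. -/
theorem contract_wedge_aux {k l m : ℕ} (h : k + l = m + 1) (α : V [⋀^Fin k]→L[ℝ] ℝ)
    (β : V [⋀^Fin l]→L[ℝ] F) (x : V) (v : Fin m → V) :
    contract x (wedge h α β) v = ((k.factorial * l.factorial : ℕ) : ℝ)⁻¹ •
      (∑ i : Fin k, insertTerm h α β x v (Fin.cast h (Fin.castAdd l i)) +
        ∑ i : Fin l, insertTerm h α β x v (Fin.cast h (Fin.natAdd k i))) := by
  rw [contract_apply, wedge_apply, sum_perm_succ,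
    ← Fin.sum_univ_add (fun i => insertTerm h α β x v (Fin.cast h i)),
    ← (finCongr h).sum_comp]
  congr 1
  refine Finset.sum_congr rfl fun i _ => Finset.sum_congr rfl fun τ _ => ?_
  rw [sign_decompose_mul_cycleRange]
  simp only [vecCons_decompose_mul_cycleRange]
  rfl

theorem units_neg_one_pow_smul_smul {A : Type*} [AddCommGroup A] (n : ℕ) (ε : ℤˣ) (a : A) :
    ((-1 : ℤˣ) ^ n * ε) • ((-1 : ℤ) ^ n • a) = ε • a := by
  rw [Units.smul_def, smul_smul, Units.smul_def]
  congr 1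
  push_cast
  rw [mul_assoc, mul_comm, mul_assoc, ← pow_add, ← two_mul, pow_mul]
  simp

/-- The sign (-1)^i of the permutation cancels the cost of moving x to the first slot of α, so every
place in the block of α contributes the same amount. -/
theorem insertTerm_left {k l m : ℕ} (h : k + 1 + l = m + 1) (h1 : k + l = m)
    (α : V [⋀^Fin (k + 1)]→L[ℝ] ℝ) (β : V [⋀^Fin l]→L[ℝ] F) (x : V) (v : Fin m → V)
    (i : Fin (k + 1)) :
    insertTerm h α β x v (Fin.cast h (Fin.castAdd l i)) =
      ((k.factorial * l.factorial : ℕ) : ℝ) • wedge h1 (contract x α) β v := by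
  rw [wedge_apply, smul_smul, mul_inv_cancel₀ (by positivity), one_smul, insertTerm]
  refine Finset.sum_congr rfl fun τ _ => ?_
  rw [insertNth_left h h1, insertNth_left' h h1, map_insertNth_eq, smul_assoc]
  exact units_neg_one_pow_smul_smul _ _ _

/-- The place is now k + i, while moving x to the front of β costs only (-1)^i; the sign (-1)^k
survives. -/
theorem insertTerm_right {k l m : ℕ} (h : k + (l + 1) = m + 1) (h1 : k + l = m)
    (α : V [⋀^Fin k]→L[ℝ] ℝ) (β : V [⋀^Fin (l + 1)]→L[ℝ] F) (x : V) (v : Fin m → V)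
    (i : Fin (l + 1)) :
    insertTerm h α β x v (Fin.cast h (Fin.natAdd k i)) =
      ((k.factorial * l.factorial : ℕ) : ℝ) • (-1 : ℝ) ^ k • wedge h1 α (contract x β) v := by
  rw [wedge_apply, smul_comm ((-1 : ℝ) ^ k), smul_smul, mul_inv_cancel₀ (by positivity), one_smul,
    insertTerm, Finset.smul_sum]
  refine Finset.sum_congr rfl fun τ _ => ?_
  rw [insertNth_right h h1, insertNth_right' h h1, map_insertNth_eq, smul_comm (α _) (_ : ℤ),
    smul_comm ((-1 : ℝ) ^ k) (Equiv.Perm.sign τ)]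
  have : ((-1 : ℤˣ) ^ ((Fin.cast h (Fin.natAdd k i) : Fin (m + 1)) : ℕ) * Equiv.Perm.sign τ) =
      (-1) ^ (i : ℕ) * (Equiv.Perm.sign τ * (-1) ^ k) := by
    simp only [Fin.val_cast, Fin.val_natAdd, pow_add]
    rw [mul_comm (Equiv.Perm.sign τ), ← mul_assoc, mul_comm ((-1 : ℤˣ) ^ k)]
  rw [this, units_neg_one_pow_smul_smul, mul_smul]
  congr 1
  rcases neg_one_pow_eq_or ℝ k with hk | hk <;>
    rcases Nat.even_or_odd k with he | he <;> simp [he.neg_one_pow]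

/-- The interior product is an antiderivation. -/
theorem contract_wedge {k l m : ℕ} (h : k + 1 + (l + 1) = m + 1) (h1 : k + (l + 1) = m)
    (h2 : k + 1 + l = m) (α : V [⋀^Fin (k + 1)]→L[ℝ] ℝ) (β : V [⋀^Fin (l + 1)]→L[ℝ] F) (x : V) :
    contract x (wedge h α β) =
      wedge h1 (contract x α) β + (-1 : ℝ) ^ (k + 1) • wedge h2 α (contract x β) := by
  ext v
  rw [contract_wedge_aux]
  simp only [insertTerm_left h h1, insertTerm_right h h2, Finset.sum_const, Finset.card_univ,
    Fintype.card_fin, ContinuousAlternatingMap.add_apply, ContinuousAlternatingMap.smul_apply,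
    ← Nat.cast_smul_eq_nsmul ℝ, smul_add, smul_smul]
  congr 1
  -- There are k + 1 equal terms, each k! l! times the wedge product, against the normalisation (k +
  -- 1)! (l + 1)! in which β of degree l + 1 is untouched.
  · convert one_smul ℝ _
    rw [Nat.factorial_succ k]
    push_cast
    field_simp
  · congr 1
    rw [Nat.factorial_succ l]
    push_cast
    field_simp

/-- A factor of degree zero has no slot for x, so only one term of the antiderivation rule remains.
The case of a left factor of degree zero comes next. -/
theorem contract_wedge_left {k m : ℕ} (h : k + 1 + 0 = m + 1) (h1 : k + 0 = m)
    (α : V [⋀^Fin (k + 1)]→L[ℝ] ℝ) (β : V [⋀^Fin 0]→L[ℝ] F) (x : V) :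
    contract x (wedge h α β) = wedge h1 (contract x α) β := by
  ext v
  rw [contract_wedge_aux]
  simp only [insertTerm_left h h1, Finset.sum_const, Finset.card_univ, Finset.univ_eq_empty,
    Finset.sum_empty, add_zero,
    Fintype.card_fin, ← Nat.cast_smul_eq_nsmul ℝ, smul_smul]
  rw [Nat.factorial_succ k]
  push_cast
  convert one_smul ℝ _
  field_simp

theorem contract_wedge_right {l m : ℕ} (h : 0 + (l + 1) = m + 1) (h1 : 0 + l = m)
    (α : V [⋀^Fin 0]→L[ℝ] ℝ) (β : V [⋀^Fin (l + 1)]→L[ℝ] F) (x : V) :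
    contract x (wedge h α β) = wedge h1 α (contract x β) := by
  obtain rfl : l = m := by omega
  ext v
  rw [wedge_deg_zero, contract_apply]
  obtain rfl : h = zero_add _ := rfl
  rw [wedge_deg_zero]
  rfl

end Pointwise

end ExoticHori

namespace ExoticHori

/-! ### Forms of mixed degree: commutation relations of contractions and wedge products. -/

section Graded

variable {V : Type*} [AddCommGroup V] [Module ℝ V] [TopologicalSpace V]
  {W : Type*} [AddCommGroup W] [Module ℝ W] [TopologicalSpace W]
  {F : Type*} [AddCommGroup F] [Module ℝ F] [TopologicalSpace F]

/-- Pullback of a form of mixed degree by a linear map. -/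
def gcomp (L : W →L[ℝ] V) (η : GAlt V F) : GAlt W F := fun k => (η k).compContinuousLinearMap L

theorem gcontract_gcomp (L : W →L[ℝ] V) (x : W) (η : GAlt V F) :
    gcontract x (gcomp L η) = gcomp L (gcontract (L x) η) :=
  funext fun _ => contract_comp _ _ _

theorem gcomp_gcomp {W' : Type*} [AddCommGroup W'] [Module ℝ W'] [TopologicalSpace W']
    (L : W →L[ℝ] V) (L' : W' →L[ℝ] W) (η : GAlt V F) :
    gcomp L' (gcomp L η) = gcomp (L.comp L') η := rfl

theorem gcomp_id (η : GAlt V F) : gcomp (ContinuousLinearMap.id ℝ V) η = η := rfl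

variable [IsTopologicalAddGroup F] [ContinuousSMul ℝ F]

theorem gcomp_add (L : W →L[ℝ] V) (η ζ : GAlt V F) : gcomp L (η + ζ) = gcomp L η + gcomp L ζ := rfl

theorem gcomp_sub (L : W →L[ℝ] V) (η ζ : GAlt V F) : gcomp L (η - ζ) = gcomp L η - gcomp L ζ := rfl

theorem gcomp_neg (L : W →L[ℝ] V) (η : GAlt V F) : gcomp L (-η) = -gcomp L η := rfl

theorem gcomp_smul {R : Type*} [Monoid R] [DistribMulAction R F] [ContinuousConstSMul R F]
    [SMulCommClass ℝ R F] (L : W →L[ℝ] V) (c : R) (η : GAlt V F) :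
    gcomp L (c • η) = c • gcomp L η := rfl

theorem gcontract_add (x : V) (η ζ : GAlt V F) :
    gcontract x (η + ζ) = gcontract x η + gcontract x ζ := rfl

theorem gcontract_sub (x : V) (η ζ : GAlt V F) :
    gcontract x (η - ζ) = gcontract x η - gcontract x ζ := rfl

theorem gcontract_neg (x : V) (η : GAlt V F) : gcontract x (-η) = -gcontract x η := rfl

theorem gcontract_smul {R : Type*} [Monoid R] [DistribMulAction R F] [ContinuousConstSMul R F]
    [SMulCommClass ℝ R F] (x : V) (c : R) (η : GAlt V F) :
    gcontract x (c • η) = c • gcontract x η := rfl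

theorem gcontract_add_vec (x y : V) (η : GAlt V F) :
    gcontract (x + y) η = gcontract x η + gcontract y η :=
  funext fun _ => contract_add_vec _ _ _

theorem gcontract_smul_vec (c : ℝ) (x : V) (η : GAlt V F) :
    gcontract (c • x) η = c • gcontract x η :=
  funext fun _ => contract_smul_vec _ _ _

theorem gcontract_zero_vec (η : GAlt V F) : gcontract (0 : V) η = 0 := by
  simpa using gcontract_smul_vec (0 : ℝ) (0 : V) η

theorem gcontract_self (x : V) (η : GAlt V F) : gcontract x (gcontract x η) = 0 :=
  funext fun _ => contract_contract_self _ _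

theorem gcontract_swap (x y : V) (η : GAlt V F) :
    gcontract x (gcontract y η) = -gcontract y (gcontract x η) :=
  funext fun _ => contract_contract_swap _ _ _

/-- Replaces the truncated subtraction in `gwedge` by any complementary degree l, which can then be
chosen in a convenient form. -/
theorem gwedge_eq {p l m : ℕ} (h : p + l = m) (α : V [⋀^Fin p]→L[ℝ] ℝ) (η : GAlt V F) :
    gwedge α η m = wedge h α (η l) := by
  obtain rfl : l = m - p := by omega
  rw [gwedge, dif_pos (by omega)]

theorem gwedge_of_lt {p m : ℕ} (h : m < p) (α : V [⋀^Fin p]→L[ℝ] ℝ) (η : GAlt V F) :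
    gwedge α η m = 0 := by
  rw [gwedge, dif_neg (by omega)]

theorem gwedge_comp {p : ℕ} (α : V [⋀^Fin p]→L[ℝ] ℝ) (η : GAlt V F) (L : W →L[ℝ] V) :
    gcomp L (gwedge α η) = gwedge (α.compContinuousLinearMap L) (gcomp L η) := by
  funext m
  rcases lt_or_ge m p with h | h
  · rw [gcomp, gwedge_of_lt h, gwedge_of_lt h]; rfl
  · rw [gcomp, gwedge_eq (Nat.add_sub_of_le h), gwedge_eq (Nat.add_sub_of_le h), wedge_comp]; rfl

theorem gwedge_add_left {p : ℕ} (α β : V [⋀^Fin p]→L[ℝ] ℝ) (η : GAlt V F) :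
    gwedge (α + β) η = gwedge α η + gwedge β η := by
  funext m
  rcases lt_or_ge m p with h | h
  · simp [gwedge_of_lt h]
  · simp [gwedge_eq (Nat.add_sub_of_le h), wedge_add_left]

theorem gwedge_smul_left {p : ℕ} (c : ℝ) (α : V [⋀^Fin p]→L[ℝ] ℝ) (η : GAlt V F) :
    gwedge (c • α) η = c • gwedge α η := by
  funext m
  rcases lt_or_ge m p with h | h
  · simp [gwedge_of_lt h]
  · simp [gwedge_eq (Nat.add_sub_of_le h), wedge_smul_left]

theorem gwedge_neg_left {p : ℕ} (α : V [⋀^Fin p]→L[ℝ] ℝ) (η : GAlt V F) :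
    gwedge (-α) η = -gwedge α η := by
  rw [← neg_one_smul ℝ α, gwedge_smul_left, neg_one_smul]

theorem gwedge_add {p : ℕ} (α : V [⋀^Fin p]→L[ℝ] ℝ) (η ζ : GAlt V F) :
    gwedge α (η + ζ) = gwedge α η + gwedge α ζ := by
  funext m
  rcases lt_or_ge m p with h | h
  · simp [gwedge_of_lt h]
  · simp [gwedge_eq (Nat.add_sub_of_le h), wedge_add_right]

theorem gwedge_smul {R : Type*} [Monoid R] [DistribMulAction R F] [ContinuousConstSMul R F]
    [SMulCommClass ℝ R F] {p : ℕ} (c : R) (α : V [⋀^Fin p]→L[ℝ] ℝ) (η : GAlt V F) :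
    gwedge α (c • η) = c • gwedge α η := by
  funext m
  rcases lt_or_ge m p with h | h
  · simp [gwedge_of_lt h]
  · simp [gwedge_eq (Nat.add_sub_of_le h), wedge_smul_right]

theorem gwedge_neg {p : ℕ} (α : V [⋀^Fin p]→L[ℝ] ℝ) (η : GAlt V F) :
    gwedge α (-η) = -gwedge α η := by
  rw [← neg_one_smul ℝ η, gwedge_smul, neg_one_smul]

theorem gwedge_sub {p : ℕ} (α : V [⋀^Fin p]→L[ℝ] ℝ) (η ζ : GAlt V F) :
    gwedge α (η - ζ) = gwedge α η - gwedge α ζ := by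
  rw [sub_eq_add_neg, gwedge_add, gwedge_neg, sub_eq_add_neg]

theorem gwedge_zero {p : ℕ} (α : V [⋀^Fin p]→L[ℝ] ℝ) : gwedge α (0 : GAlt V F) = 0 := by
  simpa using gwedge_smul (0 : ℝ) α (0 : GAlt V F)

theorem gwedge_zero_left {p : ℕ} (η : GAlt V F) :
    gwedge (0 : V [⋀^Fin p]→L[ℝ] ℝ) η = 0 := by
  simpa using gwedge_smul_left (0 : ℝ) (0 : V [⋀^Fin p]→L[ℝ] ℝ) η

theorem gwedge_deg_zero (α : V [⋀^Fin 0]→L[ℝ] ℝ) (η : GAlt V F) : gwedge α η = α ![] • η := by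
  funext m
  rw [gwedge_eq (zero_add m), wedge_deg_zero]
  rfl

theorem gcontract_gwedge_zero (x : V) (α : V [⋀^Fin 0]→L[ℝ] ℝ) (η : GAlt V F) :
    gcontract x (gwedge α η) = gwedge α (gcontract x η) := by
  rw [gwedge_deg_zero, gwedge_deg_zero, gcontract_smul]

theorem gcontract_gwedge_succ {p : ℕ} (x : V) (α : V [⋀^Fin (p + 1)]→L[ℝ] ℝ) (η : GAlt V F) :
    gcontract x (gwedge α η) =
      gwedge (contract x α) η + (-1 : ℝ) ^ (p + 1) • gwedge α (gcontract x η) := by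
  funext m
  rw [gcontract, Pi.add_apply, Pi.smul_apply]
  -- For m < p everything vanishes; for m = p the form η enters in degree zero and has no slot for
  -- x; for m > p the general antiderivation rule applies.
  rcases lt_trichotomy m p with h | rfl | h
  · rw [gwedge_of_lt (by omega), gwedge_of_lt (by omega), gwedge_of_lt (by omega)]
    simp [contract_zero]
  · rw [gwedge_eq (add_zero _), gwedge_eq (add_zero _), gwedge_of_lt (by omega),
      contract_wedge_left _ (add_zero _), smul_zero, add_zero]
  · obtain ⟨l, rfl⟩ := Nat.exists_eq_add_of_lt h
    rw [gwedge_eq (l := l + 1) (by omega), gwedge_eq (l := l + 1) (by omega),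
      gwedge_eq (l := l) (by omega), contract_wedge]
    rfl

theorem gcontract_gwedge_one (x : V) (α : V [⋀^Fin 1]→L[ℝ] ℝ) (η : GAlt V F) :
    gcontract x (gwedge α η) = α ![x] • η - gwedge α (gcontract x η) := by
  rw [gcontract_gwedge_succ, gwedge_deg_zero, contract_apply]
  simp [sub_eq_add_neg]

theorem form_ext_one {α β : V [⋀^Fin 1]→L[ℝ] F} (h : ∀ x, α ![x] = β ![x]) : α = β :=
  form_ext_succ fun x => form_ext_zero (h x)

theorem one_form_comp_apply (α : V [⋀^Fin 1]→L[ℝ] F) (L : W →L[ℝ] V) (x : W) :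
    α.compContinuousLinearMap L ![x] = α ![L x] := by
  rw [ContinuousAlternatingMap.compContinuousLinearMap_apply]
  congr 1
  funext i
  rw [Subsingleton.elim i 0]
  rfl

theorem contract_wedge_one {l : ℕ} (h : 1 + (l + 1) = l + 2) (h' : 1 + l = l + 1) (x : V)
    (α : V [⋀^Fin 1]→L[ℝ] ℝ) (β : V [⋀^Fin (l + 1)]→L[ℝ] F) :
    contract x (wedge h α β) = α ![x] • β - wedge h' α (contract x β) := by
  rw [contract_wedge h (zero_add _) h', wedge_deg_zero, contract_apply]
  simp [sub_eq_add_neg]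

theorem contract_wedge_one_zero (h : 1 + 0 = 0 + 1) (x : V)
    (α : V [⋀^Fin 1]→L[ℝ] ℝ) (β : V [⋀^Fin 0]→L[ℝ] F) :
    contract x (wedge h α β) = α ![x] • β := by
  rw [contract_wedge_left h (zero_add _), wedge_deg_zero, contract_apply]

/-- The wedge product of two 1-forms. -/
theorem wedge_one_one_apply (h : 1 + 1 = 2) (α : V [⋀^Fin 1]→L[ℝ] ℝ) (β : V [⋀^Fin 1]→L[ℝ] F)
    (x y : V) : wedge h α β ![x, y] = α ![x] • β ![y] - α ![y] • β ![x] := by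
  have h1 := congrArg (fun γ : V [⋀^Fin 1]→L[ℝ] F => γ ![y])
    (contract_wedge_one h rfl x α β)
  have h2 : wedge (rfl : 1 + 0 = 1) α (contract x β) ![y] = α ![y] • β ![x] :=
    congrArg (fun γ : V [⋀^Fin 0]→L[ℝ] F => γ ![])
      (contract_wedge_one_zero rfl y α (contract x β))
  simpa [contract_apply, h2] using h1

/-- Associativity by induction on the output degree: after contraction with x the antiderivation
rule leaves only instances of smaller degree. A left factor of degree one suffices, as only products
starting with a connection form occur. -/
theorem gwedge_wedge_aux (m : ℕ) : ∀ {p q : ℕ} (h : 1 + p = q) (α : V [⋀^Fin 1]→L[ℝ] ℝ)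
    (β : V [⋀^Fin p]→L[ℝ] ℝ) (η : GAlt V F),
    gwedge (wedge h α β) η m = gwedge α (gwedge β η) m := by
  induction m with
  | zero =>
    intro p q h α β η
    rw [gwedge_of_lt (by omega), gwedge_of_lt (by omega)]
  | succ m ih =>
    intro p q h α β η
    refine form_ext_succ fun x => ?_
    obtain rfl : q = p + 1 := by omega
    change gcontract x (gwedge (wedge h α β) η) m = gcontract x (gwedge α (gwedge β η)) m
    rw [gcontract_gwedge_one, gcontract_gwedge_succ]
    cases p with
    | zero =>
      rw [contract_wedge_one_zero, gcontract_gwedge_zero, gwedge_smul_left]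
      simp only [Pi.add_apply, Pi.smul_apply, Pi.sub_apply, ih]
      simp [sub_eq_add_neg]
    | succ p =>
      rw [contract_wedge_one h (by omega), gcontract_gwedge_succ, sub_eq_add_neg,
        gwedge_add_left, gwedge_smul_left, gwedge_neg_left, gwedge_add, gwedge_smul]
      simp only [Pi.add_apply, Pi.smul_apply, Pi.sub_apply, Pi.neg_apply, ih]
      rw [pow_succ (-1 : ℝ) (p + 1)]
      module

theorem gwedge_wedge {p q : ℕ} (h : 1 + p = q) (α : V [⋀^Fin 1]→L[ℝ] ℝ)
    (β : V [⋀^Fin p]→L[ℝ] ℝ) (η : GAlt V F) :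
    gwedge (wedge h α β) η = gwedge α (gwedge β η) :=
  funext fun m => gwedge_wedge_aux m h α β η

/-- The same induction on the output degree as for associativity. -/
theorem gwedge_swap_aux (m : ℕ) : ∀ {p : ℕ} (α : V [⋀^Fin 1]→L[ℝ] ℝ)
    (β : V [⋀^Fin p]→L[ℝ] ℝ) (η : GAlt V F),
    gwedge β (gwedge α η) m = (-1 : ℝ) ^ p • gwedge α (gwedge β η) m := by
  induction m with
  | zero =>
    intro p α β η
    rw [gwedge_of_lt (by omega : 0 < 1) α]
    rcases p.eq_zero_or_pos with rfl | hp
    · rw [gwedge_deg_zero, Pi.smul_apply, gwedge_of_lt (by omega)]; simp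
    · rw [gwedge_of_lt hp]; simp
  | succ m ih =>
    intro p α β η
    refine form_ext_succ fun x => ?_
    rw [contract_smul]
    change gcontract x (gwedge β (gwedge α η)) m =
      (-1 : ℝ) ^ p • gcontract x (gwedge α (gwedge β η)) m
    cases p with
    | zero =>
      rw [gcontract_gwedge_one, gcontract_gwedge_zero, gcontract_gwedge_one, gwedge_deg_zero,
        gcontract_gwedge_zero, gwedge_deg_zero, gwedge_deg_zero, gwedge_smul]
      simp only [Pi.smul_apply, Pi.sub_apply]
      module
    | succ p =>
      rw [gcontract_gwedge_one, gcontract_gwedge_succ x β, gcontract_gwedge_succ x β,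
        gcontract_gwedge_one]
      simp only [gwedge_add, gwedge_sub, gwedge_smul, Pi.add_apply, Pi.smul_apply, Pi.sub_apply,
        ih, pow_succ]
      module

/-- A 1-form and a `p`-form commute up to the sign `(-1)^p`. -/
theorem gwedge_swap {p : ℕ} (α : V [⋀^Fin 1]→L[ℝ] ℝ) (β : V [⋀^Fin p]→L[ℝ] ℝ) (η : GAlt V F) :
    gwedge β (gwedge α η) = (-1 : ℝ) ^ p • gwedge α (gwedge β η) :=
  funext fun m => gwedge_swap_aux m α β η

theorem gwedge_self (α : V [⋀^Fin 1]→L[ℝ] ℝ) (η : GAlt V F) : gwedge α (gwedge α η) = 0 := by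
  have h := gwedge_swap α α η
  rw [pow_one, neg_one_smul] at h
  have h2 : (2 : ℝ) • gwedge α (gwedge α η) = 0 := by
    rw [two_smul]; nth_rewrite 1 [h]; exact neg_add_cancel _
  exact (smul_eq_zero.mp h2).resolve_left two_ne_zero

/-- Needed because the dual flux is given with the connection form as right factor, whereas all
computations keep 1-forms on the left. -/
theorem wedge_one_right : ∀ {k m : ℕ} (h : k + 1 = m) (h' : 1 + k = m)
    (β : V [⋀^Fin k]→L[ℝ] ℝ) (α : V [⋀^Fin 1]→L[ℝ] ℝ),
    wedge h β α = (-1 : ℝ) ^ k • wedge h' α β := by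
  intro k
  induction k with
  | zero =>
    rintro m rfl h' β α
    rw [wedge_deg_zero]
    refine form_ext_succ fun x => ?_
    rw [contract_smul, contract_smul, contract_wedge_one_zero]
    refine form_ext_zero ?_
    simp [contract_apply, mul_comm]
  | succ k ih =>
    rintro m hm h' β α
    obtain rfl : m = k + 2 := by omega
    refine form_ext_succ fun x => ?_
    rw [contract_wedge (l := 0) hm rfl rfl, contract_smul, contract_wedge_one h' (by omega),
      ih rfl (by omega)]
    have : wedge (rfl : k + 1 + 0 = k + 1) β (contract x α) = α ![x] • β := by
      have e : ∀ (n : ℕ) (γ : V [⋀^Fin n]→L[ℝ] ℝ) (f : V [⋀^Fin 0]→L[ℝ] ℝ),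
          wedge (add_zero n) γ f = f ![] • γ := by
        intro n
        induction n with
        | zero =>
          intro γ f
          rw [wedge_deg_zero]
          exact form_ext_zero (by simp [mul_comm])
        | succ n ih' =>
          intro γ f
          refine form_ext_succ fun y => ?_
          rw [contract_wedge_left _ (add_zero _), ih', contract_smul]
      exact e _ β (contract x α)
    rw [this, pow_succ]
    module

/-- `e^{-α ∧ β} = 1 - α ∧ β` for 1-forms `α` and `β`. -/
theorem expWedge_neg_wedge (h : 1 + 1 = 2) (α β : V [⋀^Fin 1]→L[ℝ] ℝ) (η : GAlt V F) :
    expWedge (-wedge h α β) η = η - gwedge α (gwedge β η) := by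
  have h1 : ∀ ζ : GAlt V F, gwedge (-wedge h α β) ζ = -gwedge α (gwedge β ζ) := fun ζ => by
    rw [gwedge_neg_left, gwedge_wedge]
  -- α ∧ β has square zero, so the exponential series stops after j = 1.
  have h2 : ∀ j, (gwedge (-wedge h α β))^[j + 2] η = 0 := by
    intro j
    induction j with
    | zero =>
      rw [Function.iterate_succ_apply, Function.iterate_succ_apply, Function.iterate_zero_apply]
      rw [h1, h1, gwedge_neg, gwedge_neg, neg_neg, gwedge_swap α β (gwedge β η), gwedge_self,
        gwedge_zero, smul_zero, gwedge_zero]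
    | succ j ih =>
      rw [show j + 1 + 2 = (j + 2) + 1 from rfl, Function.iterate_succ_apply', ih, h1,
        gwedge_zero, gwedge_zero, neg_zero]
  funext m
  -- In degree zero the truncated sum only contains j = 0, but there α ∧ β ∧ η vanishes as well; in
  -- positive degrees both j = 0 and j = 1 are in range.
  cases m with
  | zero =>
    simp [expWedge, gwedge_of_lt (by omega : 0 < 1) α]
  | succ m =>
    rw [expWedge, Finset.sum_range_succ', Finset.sum_range_succ', Finset.sum_eq_zero]
    · simp [h1, sub_eq_add_neg, add_comm]
    · intro j _
      rw [show j + 1 + 1 = j + 2 from rfl, h2]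
      simp

end Graded

/-! ### Splittings of the tangent space of a bundle with connection -/

section Splitting

variable {B : Type*} [AddCommGroup B] [Module ℝ B] [TopologicalSpace B]
  {V : Type*} [AddCommGroup V] [Module ℝ V] [TopologicalSpace V]
  {V' : Type*} [AddCommGroup V'] [Module ℝ V'] [TopologicalSpace V']
  {C : Type*} [AddCommGroup C] [Module ℝ C] [TopologicalSpace C]
  {F : Type*} [AddCommGroup F] [Module ℝ F] [TopologicalSpace F]

/-- `s` is the horizontal lift for a projection `π` whose kernel is spanned by `v`, with respect
to a connection form `A`. -/
structure IsSplitting (π : V →L[ℝ] B) (A : V [⋀^Fin 1]→L[ℝ] ℝ) (v : V) (s : B →L[ℝ] V) :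
    Prop where
  proj_vert : π v = 0
  conn_vert : A ![v] = 1
  proj_lift : ∀ b, π (s b) = b
  conn_lift : ∀ b, A ![s b] = 0
  decomp : ∀ u, u = s (π u) + A ![u] • v

variable [IsTopologicalAddGroup F] [ContinuousSMul ℝ F]

/-- The form `π^* a + A ∧ π^* b`. -/
noncomputable def assemble (π : V →L[ℝ] B) (A : V [⋀^Fin 1]→L[ℝ] ℝ) (a b : GAlt B F) : GAlt V F :=
  gcomp π a + gwedge A (gcomp π b)

theorem gcomp_zero_deg (π : V →L[ℝ] B) (a : GAlt B F) : gcomp π a 0 ![] = a 0 ![] := by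
  rw [gcomp, ContinuousAlternatingMap.compContinuousLinearMap_apply]
  congr 1
  exact Subsingleton.elim _ _

theorem assemble_add (π : V →L[ℝ] B) (A : V [⋀^Fin 1]→L[ℝ] ℝ) (a b a' b' : GAlt B F) :
    assemble π A (a + a') (b + b') = assemble π A a b + assemble π A a' b' := by
  simp only [assemble, gcomp_add, gwedge_add]
  abel

theorem assemble_smul {R : Type*} [Monoid R] [DistribMulAction R F] [ContinuousConstSMul R F]
    [SMulCommClass ℝ R F] (π : V →L[ℝ] B) (A : V [⋀^Fin 1]→L[ℝ] ℝ) (c : R) (a b : GAlt B F) :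
    assemble π A (c • a) (c • b) = c • assemble π A a b := by
  simp only [assemble, gcomp_smul, gwedge_smul, smul_add]

theorem assemble_neg (π : V →L[ℝ] B) (A : V [⋀^Fin 1]→L[ℝ] ℝ) (a b : GAlt B F) :
    assemble π A (-a) (-b) = -assemble π A a b := by
  simp only [assemble, gcomp_neg, gwedge_neg, neg_add]

namespace IsSplitting

variable {π : V →L[ℝ] B} {A : V [⋀^Fin 1]→L[ℝ] ℝ} {v : V} {s : B →L[ℝ] V}

theorem gcomp_lift_proj (h : IsSplitting π A v s) (a : GAlt B F) : gcomp s (gcomp π a) = a := by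
  have : π.comp s = ContinuousLinearMap.id ℝ B := ContinuousLinearMap.ext h.proj_lift
  rw [gcomp_gcomp, this, gcomp_id]

theorem conn_comp_lift (h : IsSplitting π A v s) : A.compContinuousLinearMap s = 0 := by
  refine form_ext_one fun u => ?_
  rw [one_form_comp_apply, h.conn_lift]
  rfl

theorem gcontract_vert_assemble (h : IsSplitting π A v s) (a b : GAlt B F) :
    gcontract v (assemble π A a b) = gcomp π b := by
  rw [assemble, gcontract_add, gcontract_gcomp, h.proj_vert, gcontract_zero_vec,
    gcontract_gwedge_one, h.conn_vert, gcontract_gcomp, h.proj_vert, gcontract_zero_vec, one_smul]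
  have : gcomp π (0 : GAlt B F) = 0 := rfl
  rw [this, gwedge_zero]
  simp

theorem hpart_assemble (h : IsSplitting π A v s) (a b : GAlt B F) :
    gcomp s (assemble π A a b) = a := by
  rw [assemble, gcomp_add, h.gcomp_lift_proj, gwedge_comp, h.conn_comp_lift, gwedge_zero_left,
    add_zero]

theorem vpart_assemble (h : IsSplitting π A v s) (a b : GAlt B F) :
    gcomp s (gcontract v (assemble π A a b)) = b := by
  rw [h.gcontract_vert_assemble, h.gcomp_lift_proj]

/-- A form killed by v only sees the projections of its arguments: u and s (π u) differ by a
multiple of v. One slot is treated at a time, and ι_u η is again killed by v because contractions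
anticommute. -/
theorem gcomp_eq_of_horizontal_aux (h : IsSplitting π A v s) (k : ℕ) : ∀ η : GAlt V F,
    gcontract v η = 0 → gcomp π (gcomp s η) k = η k := by
  induction k with
  | zero =>
    intro η _
    refine form_ext_zero ?_
    rw [gcomp_zero_deg, gcomp_zero_deg]
  | succ k ih =>
    intro η hη
    refine form_ext_succ fun u => ?_
    change gcontract u (gcomp π (gcomp s η)) k = gcontract u η k
    have hu : gcontract (s (π u)) η = gcontract u η := by
      conv_rhs => rw [h.decomp u]
      rw [gcontract_add_vec, gcontract_smul_vec, hη, smul_zero, add_zero]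
    rw [gcontract_gcomp, gcontract_gcomp, hu]
    refine ih _ ?_
    rw [gcontract_swap, hη]
    exact neg_eq_zero.mpr rfl

theorem gcomp_eq_of_horizontal (h : IsSplitting π A v s) {η : GAlt V F} (hη : gcontract v η = 0) :
    gcomp π (gcomp s η) = η :=
  funext fun k => h.gcomp_eq_of_horizontal_aux k η hη

/-- Both ι_v η and η - A ∧ ι_v η are killed by v, hence are pulled back from the base. This is the
decomposition on which the whole proof rests. -/
theorem assemble_parts (h : IsSplitting π A v s) (η : GAlt V F) :
    assemble π A (gcomp s η) (gcomp s (gcontract v η)) = η := by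
  have h1 := h.gcomp_eq_of_horizontal (gcontract_self v η)
  have h2 : gcontract v (η - gwedge A (gcontract v η)) = 0 := by
    rw [gcontract_sub, gcontract_gwedge_one, h.conn_vert, gcontract_self, gwedge_zero]
    simp
  have h3 := h.gcomp_eq_of_horizontal h2
  rw [gcomp_sub, gwedge_comp, h.conn_comp_lift, gwedge_zero_left, sub_zero] at h3
  rw [assemble, h1, h3]
  abel

theorem one_form_decomp (h : IsSplitting π A v s) (α : V [⋀^Fin 1]→L[ℝ] ℝ) :
    α = (α.compContinuousLinearMap s).compContinuousLinearMap π + α ![v] • A := by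
  have e : ∀ (x y : V), α ![x + y] = α ![x] + α ![y] := fun x y => α.vecCons_add ![] x y
  have e' : ∀ (c : ℝ) (x : V), α ![c • x] = c • α ![x] := fun c x => α.vecCons_smul ![] c x
  refine form_ext_one fun u => ?_
  rw [ContinuousAlternatingMap.add_apply, one_form_comp_apply, one_form_comp_apply]
  conv_lhs => rw [h.decomp u]
  rw [e, e', ContinuousAlternatingMap.smul_apply]
  simp [mul_comm]

/-- The Clifford action of `u + α` on `π^* a + A ∧ π^* b`. -/
theorem cliff_assemble (h : IsSplitting π A v s) (u : V) (α : V [⋀^Fin 1]→L[ℝ] ℝ)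
    (a b : GAlt B F) :
    gcontract u (assemble π A a b) + gwedge α (assemble π A a b) =
      assemble π A
        (gcontract (π u) a + A ![u] • b + gwedge (α.compContinuousLinearMap s) a)
        (-gcontract (π u) b + α ![v] • a - gwedge (α.compContinuousLinearMap s) b) := by
  -- With α = π^*θ + g A the signs come only from moving ι_u and θ past A, and A ∧ A = 0 removes one
  -- term.
  suffices key : ∀ (θ : B [⋀^Fin 1]→L[ℝ] ℝ) (g : ℝ), gcontract u (assemble π A a b) +
      gwedge (θ.compContinuousLinearMap π + g • A) (assemble π A a b) =
        assemble π A (gcontract (π u) a + A ![u] • b + gwedge θ a)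
          (-gcontract (π u) b + g • a - gwedge θ b) by
    have := key (α.compContinuousLinearMap s) (α ![v])
    rwa [← h.one_form_decomp α] at this
  intro θ g
  simp only [assemble, gcontract_add, gcontract_gcomp, gcontract_gwedge_one, gcomp_add, gcomp_neg,
    gcomp_smul, gcomp_sub, gwedge_comp, gwedge_add, gwedge_sub, gwedge_neg, gwedge_smul,
    gwedge_add_left, gwedge_smul_left, gwedge_self]
  rw [gwedge_swap A (θ.compContinuousLinearMap π)]
  simp only [pow_one, neg_one_smul, smul_zero]
  abel

/-- The contraction of `η e^{-A ∧ A'}` with the generator of the fibre of the correspondence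
space. -/
theorem gcomp_gcontract_expWedge (h : IsSplitting π A v s) {π' : V' →L[ℝ] B}
    (A' : V' [⋀^Fin 1]→L[ℝ] ℝ) {P₁ : C →L[ℝ] V} {P₂ : C →L[ℝ] V'} {c : C}
    (hP : ∀ u, π (P₁ u) = π' (P₂ u)) (hc₁ : P₁ c = v) (hc₂ : P₂ c = 0)
    {L : V' →L[ℝ] C} (hL : ∀ u, P₂ (L u) = u) (h11 : 1 + 1 = 2) (η : GAlt V F) :
    gcomp L (gcontract c (expWedge (-wedge h11 (A.compContinuousLinearMap P₁)
      (A'.compContinuousLinearMap P₂)) (gcomp P₁ η))) =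
      assemble π' A' (gcomp s (gcontract v η)) (-gcomp s η) := by
  set a := gcomp s η with ha
  set b := gcomp s (gcontract v η) with hb
  have hη : η = assemble π A a b := (h.assemble_parts η).symm
  have hκ : π.comp P₁ = π'.comp P₂ := ContinuousLinearMap.ext hP
  set α := A.compContinuousLinearMap P₁ with hα
  set β := A'.compContinuousLinearMap P₂ with hβ
  -- On the correspondence space, forms of the base have the same pullback along either projection,
  -- so a and b may be read on the side of V'.
  have hη' : gcomp P₁ η = gcomp P₂ (gcomp π' a) + gwedge α (gcomp P₂ (gcomp π' b)) := by
    have h1 : ∀ ζ : GAlt B F, gcomp P₁ (gcomp π ζ) = gcomp P₂ (gcomp π' ζ) := fun ζ => by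
      rw [gcomp_gcomp, hκ, gcomp_gcomp]
    rw [hη, assemble, gcomp_add, gwedge_comp, h1, h1]
  have hβ0 : β ![c] = 0 := by
    rw [hβ, one_form_comp_apply, hc₂]
    have := A'.vecCons_smul ![] (0 : ℝ) 0
    rw [zero_smul, zero_smul] at this
    exact this
  have hα1 : α ![c] = 1 := by
    rw [hα, one_form_comp_apply, hc₁, h.conn_vert]
  have h0 : ∀ ζ : GAlt V' F, gcontract c (gcomp P₂ ζ) = 0 := fun ζ => by
    rw [gcontract_gcomp, hc₂, gcontract_zero_vec]; rfl
  have hid : P₂.comp L = ContinuousLinearMap.id ℝ V' := ContinuousLinearMap.ext hL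
  have hβL : β.compContinuousLinearMap L = A' := by
    have : β.compContinuousLinearMap L = A'.compContinuousLinearMap (P₂.comp L) := rfl
    rw [this, hid]; rfl
  have hL' : ∀ ζ : GAlt V' F, gcomp L (gcomp P₂ ζ) = ζ := fun ζ => by
    rw [gcomp_gcomp, hid, gcomp_id]
  -- With η = a + α ∧ b the product with 1 - α ∧ β is a + α ∧ b - α ∧ β ∧ a, since α ∧ β ∧ α = 0. As
  -- α(c) = 1, β(c) = 0 and c is killed by forms pulled back from V', contraction gives b - β ∧ a.
  rw [expWedge_neg_wedge, hη', gwedge_add, gwedge_add, gwedge_swap α β, gwedge_smul, gwedge_self,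
    smul_zero, add_zero, gcontract_sub, gcontract_add, h0, gcontract_gwedge_one,
    gcontract_gwedge_one, gcontract_gwedge_one, h0, h0, hα1, hβ0, gwedge_zero, one_smul, one_smul,
    zero_smul, sub_zero, zero_add, gwedge_zero]
  simp only [sub_zero, gcomp_sub, gwedge_zero, gwedge_comp, hL', hβL, assemble, gcomp_neg,
    gwedge_neg]
  abel

end IsSplitting

end Splitting

end ExoticHori

namespace ExoticHori

/-! ### Differential forms on a vector space -/

section Flat

open Module

variable {E : Type*} [NormedAddCommGroup E] [NormedSpace ℝ E] [FiniteDimensional ℝ E]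
  {F : Type*} [NormedAddCommGroup F] [NormedSpace ℝ F] [FiniteDimensional ℝ F]
  {G : Type*} [NormedAddCommGroup G] [NormedSpace ℝ G]

/-- A form is determined by its values on tuples of basis vectors. Finite dimension makes wedge
product and contraction continuous, hence smooth, without norm estimates. -/
instance finiteDimensional_forms (k : ℕ) : FiniteDimensional ℝ (E [⋀^Fin k]→L[ℝ] F) := by
  let b := Module.finBasis ℝ E
  let Φ : (E [⋀^Fin k]→L[ℝ] F) →ₗ[ℝ] ((Fin k → Fin (finrank ℝ E)) → F) :=
    { toFun := fun η r => η (fun i => b (r i))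
      map_add' := fun _ _ => rfl
      map_smul' := fun _ _ => rfl }
  refine FiniteDimensional.of_injective Φ fun η ζ h => ?_
  have : η.toAlternatingMap = ζ.toAlternatingMap :=
    b.ext_alternating fun r _ => congrFun h r
  exact ContinuousAlternatingMap.toAlternatingMap_injective this

/-- The values on tuples of basis vectors embed the forms linearly; a linear left inverse of this
embedding recovers f from finitely many smooth functions. -/
theorem contDiffAt_form {k : ℕ} {n : ℕ∞ω} {f : G → E [⋀^Fin k]→L[ℝ] F} {x : G}
    (h : ∀ u : Fin k → E, ContDiffAt ℝ n (fun y => f y u) x) : ContDiffAt ℝ n f x := by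
  let b := Module.finBasis ℝ E
  let Φ : (E [⋀^Fin k]→L[ℝ] F) →ₗ[ℝ] ((Fin k → Fin (finrank ℝ E)) → F) :=
    { toFun := fun η r => η (fun i => b (r i))
      map_add' := fun _ _ => rfl
      map_smul' := fun _ _ => rfl }
  have hΦ : Function.Injective Φ := fun η ζ h => by
    have : η.toAlternatingMap = ζ.toAlternatingMap :=
      b.ext_alternating fun r _ => congrFun h r
    exact ContinuousAlternatingMap.toAlternatingMap_injective this
  obtain ⟨R, hR⟩ := LinearMap.exists_leftInverse_of_injective Φ (LinearMap.ker_eq_bot.mpr hΦ)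
  have e : f = fun y => R.toContinuousLinearMap (fun r => f y (fun i => b (r i))) := by
    funext y
    exact (congrArg (fun T : (E [⋀^Fin k]→L[ℝ] F) →ₗ[ℝ] (E [⋀^Fin k]→L[ℝ] F) => T (f y)) hR).symm
  rw [e]
  exact R.toContinuousLinearMap.contDiff.contDiffAt.comp x (contDiffAt_pi.mpr fun r => h _)

/-- The wedge product as a bilinear map. -/
noncomputable def wedgeLin {k l m : ℕ} (h : k + l = m) :
    (E [⋀^Fin k]→L[ℝ] ℝ) →ₗ[ℝ] (E [⋀^Fin l]→L[ℝ] F) →ₗ[ℝ] (E [⋀^Fin m]→L[ℝ] F) :=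
  LinearMap.mk₂ ℝ (fun α β => wedge h α β) (fun α α' β => wedge_add_left h α α' β)
    (fun c α β => wedge_smul_left h c α β) (fun α β β' => wedge_add_right h α β β')
    (fun c α β => wedge_smul_right h c α β)

/-- The wedge product as a continuous bilinear map. -/
noncomputable def wedgeB {k l m : ℕ} (h : k + l = m) :
    (E [⋀^Fin k]→L[ℝ] ℝ) →L[ℝ] (E [⋀^Fin l]→L[ℝ] F) →L[ℝ] (E [⋀^Fin m]→L[ℝ] F) :=
  LinearMap.toContinuousLinearMap
    ((LinearMap.toContinuousLinearMap : _ ≃ₗ[ℝ] _).toLinearMap.comp (wedgeLin h))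

theorem wedgeB_apply {k l m : ℕ} (h : k + l = m) (α : E [⋀^Fin k]→L[ℝ] ℝ)
    (β : E [⋀^Fin l]→L[ℝ] F) : wedgeB h α β = wedge h α β := rfl

/-- The interior product as a bilinear map. -/
noncomputable def contractLin (k : ℕ) :
    E →ₗ[ℝ] (E [⋀^Fin (k + 1)]→L[ℝ] F) →ₗ[ℝ] (E [⋀^Fin k]→L[ℝ] F) :=
  LinearMap.mk₂ ℝ (fun x η => contract x η) (fun x y η => contract_add_vec x y η)
    (fun c x η => contract_smul_vec x c η)
    (fun x η ζ => contract_add x η ζ) (fun c x η => contract_smul x c η)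

/-- The interior product as a continuous bilinear map. -/
noncomputable def contractB (k : ℕ) :
    E →L[ℝ] (E [⋀^Fin (k + 1)]→L[ℝ] F) →L[ℝ] (E [⋀^Fin k]→L[ℝ] F) :=
  LinearMap.toContinuousLinearMap
    ((LinearMap.toContinuousLinearMap : _ ≃ₗ[ℝ] _).toLinearMap.comp (contractLin k))

theorem contDiffAt_wedge {k l m : ℕ} (h : k + l = m) {n : ℕ∞ω} {f : G → E [⋀^Fin k]→L[ℝ] ℝ}
    {g : G → E [⋀^Fin l]→L[ℝ] F} {x : G} (hf : ContDiffAt ℝ n f x) (hg : ContDiffAt ℝ n g x) :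
    ContDiffAt ℝ n (fun y => wedge h (f y) (g y)) x := by
  have h1 : ContDiffAt ℝ n (fun y => wedgeB (F := F) h (f y)) x := by
    have h0 : ContDiff ℝ n (fun α => wedgeB (E := E) (F := F) h α) := ContinuousLinearMap.contDiff _
    exact h0.contDiffAt.comp x hf
  exact h1.clm_apply hg

theorem contDiffAt_contract {k : ℕ} {n : ℕ∞ω} {f : G → E}
    {g : G → E [⋀^Fin (k + 1)]→L[ℝ] F} {x : G} (hf : ContDiffAt ℝ n f x)
    (hg : ContDiffAt ℝ n g x) : ContDiffAt ℝ n (fun y => contract (f y) (g y)) x := by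
  have h1 : ContDiffAt ℝ n (fun y => contractB (F := F) k (f y)) x := by
    have h0 : ContDiff ℝ n (fun α => contractB (E := E) (F := F) k α) :=
      ContinuousLinearMap.contDiff _
    exact h0.contDiffAt.comp x hf
  exact h1.clm_apply hg

theorem contDiffAt_form_apply {n : ℕ∞ω} {x : G} : ∀ {k : ℕ} {f : G → E [⋀^Fin k]→L[ℝ] F}
    {w : Fin k → G → E}, ContDiffAt ℝ n f x → (∀ i, ContDiffAt ℝ n (w i) x) →
    ContDiffAt ℝ n (fun y => f y (fun i => w i y)) x := by
  intro k
  induction k with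
  | zero =>
    intro f w hf _
    have e : (fun y => f y (fun i => w i y)) = fun y =>
        ContinuousAlternatingMap.apply ℝ E F ![] (f y) := by
      funext y
      exact congrArg (f y) (Subsingleton.elim _ _)
    rw [e]
    exact (ContinuousAlternatingMap.apply ℝ E F ![]).contDiff.contDiffAt.comp x hf
  | succ k ih =>
    intro f w hf hw
    have e : (fun y => f y (fun i => w i y)) = fun y =>
        contract (w 0 y) (f y) (fun i => w i.succ y) := by
      funext y
      rw [contract_apply]
      congr 1
      funext i
      refine Fin.cases ?_ (fun j => ?_) i <;> rfl
    rw [e]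
    exact ih (contDiffAt_contract (hw 0) hf) fun i => hw i.succ

theorem contDiffAt_form_comp {E' : Type*} [NormedAddCommGroup E'] [NormedSpace ℝ E']
    [FiniteDimensional ℝ E'] {k : ℕ} {n : ℕ∞ω} {f : G → E [⋀^Fin k]→L[ℝ] F} {L : G → E' →L[ℝ] E}
    {x : G} (hf : ContDiffAt ℝ n f x) (hL : ContDiffAt ℝ n L x) :
    ContDiffAt ℝ n (fun y => (f y).compContinuousLinearMap (L y)) x :=
  contDiffAt_form fun u =>
    contDiffAt_form_apply (w := fun i y => L y (u i)) hf fun _ => hL.clm_apply contDiffAt_const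

theorem fderiv_wedge {k l m : ℕ} (h : k + l = m) {f : E → E [⋀^Fin k]→L[ℝ] ℝ}
    {g : E → E [⋀^Fin l]→L[ℝ] F} {x : E} (hf : DifferentiableAt ℝ f x)
    (hg : DifferentiableAt ℝ g x) (u : E) :
    fderiv ℝ (fun y => wedge h (f y) (g y)) x u =
      wedge h (fderiv ℝ f x u) (g x) + wedge h (f x) (fderiv ℝ g x u) := by
  have := ((wedgeB h).isBoundedBilinearMap.hasFDerivAt (f x, g x)).comp x
    (hf.hasFDerivAt.prodMk hg.hasFDerivAt)
  have h2 : HasFDerivAt (fun y => wedge h (f y) (g y)) _ x := this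
  rw [h2.fderiv]
  simp [wedgeB_apply, add_comm]

theorem fderiv_contract {k : ℕ} {g : E → E [⋀^Fin (k + 1)]→L[ℝ] F} {x : E}
    (hg : DifferentiableAt ℝ g x) (v u : E) :
    fderiv ℝ (fun y => contract v (g y)) x u = contract v (fderiv ℝ g x u) := by
  have h2 : HasFDerivAt (fun y => contract v (g y)) ((contractB k v).comp (fderiv ℝ g x)) x :=
    (contractB (F := F) k v).hasFDerivAt.comp x hg.hasFDerivAt
  rw [h2.fderiv]
  rfl

/-- Cartan's formula for a constant vector field. -/
theorem contract_extDeriv_succ {k : ℕ} {g : E → E [⋀^Fin (k + 1)]→L[ℝ] F} {x : E}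
    (hg : DifferentiableAt ℝ g x) (v : E) :
    contract v (extDeriv g x) = fderiv ℝ g x v - extDeriv (fun y => contract v (g y)) x := by
  ext u
  rw [contract_apply, extDeriv, ContinuousAlternatingMap.alternatizeUncurryFin_apply,
    Fin.sum_univ_succ, ContinuousAlternatingMap.sub_apply, extDeriv,
    ContinuousAlternatingMap.alternatizeUncurryFin_apply, sub_eq_add_neg, ← Finset.sum_neg_distrib]
  congr 1
  · simp
  · refine Finset.sum_congr rfl fun i _ => ?_
    rw [fderiv_contract hg, contract_apply, Fin.val_succ, pow_succ, mul_neg_one, neg_smul]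
    congr 3
    funext j
    refine Fin.cases ?_ (fun j => ?_) j
    · simp [Fin.removeNth]
    · simp [Fin.removeNth]

theorem contract_extDeriv_zero {g : E → E [⋀^Fin 0]→L[ℝ] F} {x : E} (v : E) :
    contract v (extDeriv g x) = fderiv ℝ g x v := by
  refine form_ext_zero ?_
  rw [contract_apply, extDeriv, ContinuousAlternatingMap.alternatizeUncurryFin_apply]
  simp

theorem differentiableAt_contract {k : ℕ} {g : E → E [⋀^Fin (k + 1)]→L[ℝ] F} {x : E}
    (hg : DifferentiableAt ℝ g x) (v : E) : DifferentiableAt ℝ (fun y => contract v (g y)) x :=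
  (contractB (F := F) k v).differentiableAt.comp x hg

theorem differentiableAt_wedge {k l m : ℕ} (h : k + l = m) {f : E → E [⋀^Fin k]→L[ℝ] ℝ}
    {g : E → E [⋀^Fin l]→L[ℝ] F} {x : E} (hf : DifferentiableAt ℝ f x)
    (hg : DifferentiableAt ℝ g x) : DifferentiableAt ℝ (fun y => wedge h (f y) (g y)) x := by
  have h1 : DifferentiableAt ℝ (fun y => wedgeB (F := F) h (f y)) x := by
    have h0 : ContDiff ℝ 1 (fun α => wedgeB (E := E) (F := F) h α) := ContinuousLinearMap.contDiff _
    exact (h0.differentiable one_ne_zero _).comp x hf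
  exact h1.clm_apply hg

theorem extDeriv_const_smul {k : ℕ} (c : ℝ) (g : E → E [⋀^Fin k]→L[ℝ] F) (x : E) :
    extDeriv (fun y => c • g y) x = c • extDeriv g x := extDeriv_smul c g

/-- Induction on the total degree N. For a constant vector v, Cartan's formula ι_v d = ∂_v - d ι_v
turns the claim into the product rule for ∂_v and the Leibniz rule for the pairs (ι_v f, g) and (f,
ι_v g). Factors of degree zero are separated because they cannot be contracted. -/
theorem extDeriv_wedge_aux (N : ℕ) : ∀ {k l m : ℕ} (_ : k + l = N) (h : k + l = m)
    (h1 : k + 1 + l = m + 1) (h2 : k + (l + 1) = m + 1) {f : E → E [⋀^Fin k]→L[ℝ] ℝ}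
    {g : E → E [⋀^Fin l]→L[ℝ] F} {x : E} (_ : DifferentiableAt ℝ f x)
    (_ : DifferentiableAt ℝ g x),
    extDeriv (fun y => wedge h (f y) (g y)) x =
      wedge h1 (extDeriv f x) (g x) + (-1 : ℝ) ^ k • wedge h2 (f x) (extDeriv g x) := by
  induction N with
  | zero =>
    intro k l m hN h h1 h2 f g x hf hg
    obtain rfl : k = 0 := by omega
    obtain rfl : l = 0 := by omega
    obtain rfl : m = 0 := by omega
    refine form_ext_succ fun v => ?_
    rw [contract_extDeriv_zero, fderiv_wedge h hf hg, contract_add, contract_smul,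
      contract_wedge_left _ h, contract_wedge_right _ h, contract_extDeriv_zero,
      contract_extDeriv_zero]
    simp
  | succ N ih =>
    intro k l m hN h h1 h2 f g x hf hg
    obtain rfl : m = N + 1 := by omega
    refine form_ext_succ fun v => ?_
    rw [contract_extDeriv_succ (differentiableAt_wedge h hf hg), fderiv_wedge h hf hg,
      contract_add, contract_smul]
    rcases k with _ | k <;> rcases l with _ | l
    · omega
    · have e : (fun y => contract v (wedge h (f y) (g y))) =
          fun y => wedge (by omega : 0 + l = N) (f y) (contract v (g y)) :=
        funext fun y => contract_wedge_right _ _ _ _ _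
      rw [e, ih (by omega) _ (by omega) (by omega) hf (differentiableAt_contract hg v),
        contract_wedge _ (by omega : 0 + (l + 1) = N + 1) (by omega), contract_extDeriv_zero,
        contract_wedge_right _ (by omega : 0 + (l + 1) = N + 1), contract_extDeriv_succ hg,
        sub_eq_add_neg (fderiv ℝ g x v), wedge_add_right, wedge_neg_right]
      module
    · have e : (fun y => contract v (wedge h (f y) (g y))) =
          fun y => wedge (by omega : k + 0 = N) (contract v (f y)) (g y) :=
        funext fun y => contract_wedge_left _ _ _ _ _
      rw [e, ih (by omega) _ (by omega) (by omega) (differentiableAt_contract hf v) hg,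
        contract_wedge_left _ (by omega : k + 1 + 0 = N + 1),
        contract_wedge _ (by omega : k + (0 + 1) = N + 1) (by omega), contract_extDeriv_zero,
        contract_extDeriv_succ hf,
        sub_eq_add_neg (fderiv ℝ f x v), wedge_add_left, wedge_neg_left, smul_add, smul_smul,
        ← pow_add, Even.neg_one_pow ⟨k + 1, rfl⟩, pow_succ]
      module
    · have e : (fun y => contract v (wedge h (f y) (g y))) =
          fun y => wedge (by omega : k + (l + 1) = N) (contract v (f y)) (g y) +
            (-1 : ℝ) ^ (k + 1) • wedge (by omega : k + 1 + l = N) (f y) (contract v (g y)) :=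
        funext fun y => contract_wedge _ _ _ _ _ _
      have e' := extDeriv_fun_add
        (differentiableAt_wedge (by omega : k + (l + 1) = N) (differentiableAt_contract hf v) hg)
        (ω₂ := fun y => (-1 : ℝ) ^ (k + 1) •
          wedge (by omega : k + 1 + l = N) (f y) (contract v (g y)))
        (DifferentiableAt.fun_const_smul (differentiableAt_wedge (by omega : k + 1 + l = N) hf
          (differentiableAt_contract hg v)) _)
      rw [e, e', extDeriv_const_smul,
        ih (by omega) _ (by omega) (by omega) (differentiableAt_contract hf v) hg,
        ih (by omega) _ (by omega) (by omega) hf (differentiableAt_contract hg v),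
        contract_wedge _ (by omega : k + 1 + (l + 1) = N + 1) (by omega : k + 1 + 1 + l = N + 1),
        contract_wedge _ (by omega : k + (l + 1 + 1) = N + 1) (by omega : k + 1 + (l + 1) = N + 1),
        contract_extDeriv_succ hf, contract_extDeriv_succ hg,
        sub_eq_add_neg (fderiv ℝ f x v), wedge_add_left, wedge_neg_left,
        sub_eq_add_neg (fderiv ℝ g x v), wedge_add_right, wedge_neg_right]
      simp only [smul_add, smul_smul, ← pow_add, smul_neg]
      rw [Even.neg_one_pow ⟨k + 1, rfl⟩, pow_succ (-1 : ℝ) (k + 1), pow_succ (-1 : ℝ) k]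
      module

/-- The Leibniz rule for the exterior derivative. -/
theorem extDeriv_wedge {k l m : ℕ} (h : k + l = m) (h1 : k + 1 + l = m + 1)
    (h2 : k + (l + 1) = m + 1) {f : E → E [⋀^Fin k]→L[ℝ] ℝ}
    {g : E → E [⋀^Fin l]→L[ℝ] F} {x : E} (hf : DifferentiableAt ℝ f x)
    (hg : DifferentiableAt ℝ g x) :
    extDeriv (fun y => wedge h (f y) (g y)) x =
      wedge h1 (extDeriv f x) (g x) + (-1 : ℝ) ^ k • wedge h2 (f x) (extDeriv g x) :=
  extDeriv_wedge_aux (k + l) rfl h h1 h2 hf hg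

/-- The Leibniz rule for the product with a complex function whose logarithmic derivative is
`c τ` for a real 1-form `τ`. -/
theorem extDeriv_complex_smul {c : ℂ} {x : E} {f : E → ℂ} {τ : E [⋀^Fin 1]→L[ℝ] ℝ}
    (hf : DifferentiableAt ℝ f x) (hτ : ∀ u, fderiv ℝ f x u = f x * (c * τ ![u])) :
    ∀ {k : ℕ} (h : 1 + k = k + 1) {g : E → E [⋀^Fin k]→L[ℝ] ℂ} (_ : DifferentiableAt ℝ g x),
    extDeriv (fun y => f y • g y) x = f x • (extDeriv g x + c • wedge h τ (g x)) := by
  -- The left factor of `wedge` is real, so the complex constant c is kept outside the wedge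
  -- product.
  have key : ∀ {k : ℕ} {g : E → E [⋀^Fin k]→L[ℝ] ℂ} (_ : DifferentiableAt ℝ g x) (v : E),
      fderiv ℝ (fun y => f y • g y) x v =
        f x • fderiv ℝ g x v + f x • c • τ ![v] • g x := by
    intro k g hg v
    rw [fderiv_fun_smul hf hg]
    simp only [add_apply, smul_apply,
      ContinuousLinearMap.smulRight_apply, hτ]
    rw [mul_smul, mul_smul]
    rfl
  intro k
  induction k with
  | zero =>
    intro h g hg
    refine form_ext_succ fun v => ?_
    rw [contract_extDeriv_zero, key hg, contract_smul, contract_add, contract_smul,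
      contract_extDeriv_zero, contract_wedge_one_zero, smul_add]
  | succ k ih =>
    intro h g hg
    refine form_ext_succ fun v => ?_
    have e : (fun y => contract v (f y • g y)) = fun y => f y • contract v (g y) := rfl
    rw [contract_extDeriv_succ (g := fun y => f y • g y) (hf.smul hg), key hg, contract_smul, contract_add, contract_smul,
      contract_extDeriv_succ hg, contract_wedge_one h (by omega), e,
      ih (by omega) (differentiableAt_contract hg v), smul_add, smul_add, smul_sub, smul_sub,
      smul_sub]
    abel

/-- The exterior derivative of a 1-form on a pair of vector fields. -/
theorem extDeriv_one_form {g : E → E [⋀^Fin 1]→L[ℝ] F} {V W : E → E} {x : E}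
    (hg : DifferentiableAt ℝ g x) (hV : DifferentiableAt ℝ V x) (hW : DifferentiableAt ℝ W x) :
    extDeriv g x ![V x, W x] = fderiv ℝ (fun y => g y ![W y]) x (V x) -
      fderiv ℝ (fun y => g y ![V y]) x (W x) - g x ![VectorField.lieBracket ℝ V W x] := by
  have h := extDeriv_apply_vectorField (V := ![V, W]) hg
    (by intro i; fin_cases i <;> simpa)
  have e0 : (fun i => (![V, W] : Fin 2 → E → E) i x) = ![V x, W x] := by
    funext i; fin_cases i <;> rfl
  rw [e0] at h
  rw [h, Fin.sum_univ_two]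
  have e1 : (fun y => g y ((0 : Fin 2).removeNth (fun i => (![V, W] : Fin 2 → E → E) i y))) =
      fun y => g y ![W y] := by
    funext y; congr 1; funext i; fin_cases i; rfl
  have e2 : (fun y => g y ((1 : Fin 2).removeNth (fun i => (![V, W] : Fin 2 → E → E) i y))) =
      fun y => g y ![V y] := by
    funext y; congr 1; funext i; fin_cases i; rfl
  rw [e1, e2]
  simp
  exact (sub_eq_add_neg _ _).symm

end Flat

end ExoticHori

namespace ExoticHori

open Filter Topology

/-! ### Differential forms on a manifold -/

section Manifold

variable {E : Type*} [NormedAddCommGroup E] [NormedSpace ℝ E] [FiniteDimensional ℝ E]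
  {M : Type*} [TopologicalSpace M] [ChartedSpace E M] [IsManifold 𝓘(ℝ, E) ∞ M]
  {E' : Type*} [NormedAddCommGroup E'] [NormedSpace ℝ E'] [FiniteDimensional ℝ E']
  {M' : Type*} [TopologicalSpace M'] [ChartedSpace E' M'] [IsManifold 𝓘(ℝ, E') ∞ M']
  {F : Type*} [NormedAddCommGroup F] [NormedSpace ℝ F] [FiniteDimensional ℝ F]

/-- The order of smoothness under which second derivatives are symmetric, as needed for pulling back
`extDeriv`. -/
theorem two_le_infty : minSmoothness ℝ 2 ≤ (∞ : WithTop ℕ∞) := by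
  rw [minSmoothness_of_isRCLikeNormedField]
  exact WithTop.coe_le_coe.2 (le_top : (2 : ℕ∞) ≤ ⊤)

theorem isManifold_one : IsManifold 𝓘(ℝ, E) 1 M :=
  IsManifold.of_le (n := ∞) (by exact_mod_cast le_top)

theorem mdiffAt_chart_symm {x₀ : M} {y : E} (hy : y ∈ (extChartAt 𝓘(ℝ, E) x₀).target) :
    MDifferentiableAt 𝓘(ℝ, E) 𝓘(ℝ, E) (extChartAt 𝓘(ℝ, E) x₀).symm y :=
  ((contMDiffOn_extChartAt_symm (I := 𝓘(ℝ, E)) (n := ∞) x₀).contMDiffAt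
    (extChartAt_target_mem_nhds' hy)).mdifferentiableAt (by simp)

theorem mdiffAt_chart {x₀ z : M} (hz : z ∈ (extChartAt 𝓘(ℝ, E) x₀).source) :
    MDifferentiableAt 𝓘(ℝ, E) 𝓘(ℝ, E) (extChartAt 𝓘(ℝ, E) x₀) z :=
  (contMDiffAt_extChartAt' (I := 𝓘(ℝ, E)) (n := ∞)
    (by simpa using hz)).mdifferentiableAt (by simp)

/-- All tangent spaces are definitionally the model space; ascribing values to `E` drops the base
point, so that vectors at points which are only propositionally equal can be compared. -/
theorem chart_symm_chart {x₀ z : M} (hz : z ∈ (extChartAt 𝓘(ℝ, E) x₀).source)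
    (u : Tan E M z) :
    (mfderiv 𝓘(ℝ, E) 𝓘(ℝ, E) (extChartAt 𝓘(ℝ, E) x₀).symm (extChartAt 𝓘(ℝ, E) x₀ z)
      (mfderiv 𝓘(ℝ, E) 𝓘(ℝ, E) (extChartAt 𝓘(ℝ, E) x₀) z u) : E) = u := by
  have : IsManifold 𝓘(ℝ, E) 1 M := isManifold_one
  have := mfderivWithin_extChartAt_symm_comp_mfderiv_extChartAt' (I := 𝓘(ℝ, E)) hz
  rw [𝓘(ℝ, E).range_eq_univ, mfderivWithin_univ] at this
  exact congrArg (fun L : E →L[ℝ] E => L u) this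

theorem chart_chart_symm {x₀ : M} {y : E} (hy : y ∈ (extChartAt 𝓘(ℝ, E) x₀).target) (u : E) :
    (mfderiv 𝓘(ℝ, E) 𝓘(ℝ, E) (extChartAt 𝓘(ℝ, E) x₀) ((extChartAt 𝓘(ℝ, E) x₀).symm y)
      (mfderiv 𝓘(ℝ, E) 𝓘(ℝ, E) (extChartAt 𝓘(ℝ, E) x₀).symm y u) : E) = u := by
  have : IsManifold 𝓘(ℝ, E) 1 M := isManifold_one
  have := mfderiv_extChartAt_comp_mfderivWithin_extChartAt_symm (I := 𝓘(ℝ, E)) hy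
  rw [𝓘(ℝ, E).range_eq_univ, mfderivWithin_univ] at this
  exact congrArg (fun L : E →L[ℝ] E => L u) this

theorem chart_symm_chart' {x₀ : M} {y : E} (hy : y ∈ (extChartAt 𝓘(ℝ, E) x₀).target)
    (u : Tan E M ((extChartAt 𝓘(ℝ, E) x₀).symm y)) :
    (mfderiv 𝓘(ℝ, E) 𝓘(ℝ, E) (extChartAt 𝓘(ℝ, E) x₀).symm y
      (mfderiv 𝓘(ℝ, E) 𝓘(ℝ, E) (extChartAt 𝓘(ℝ, E) x₀)
        ((extChartAt 𝓘(ℝ, E) x₀).symm y) u) : E) = u := by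
  have : IsManifold 𝓘(ℝ, E) 1 M := isManifold_one
  have := mfderivWithin_extChartAt_symm_comp_mfderiv_extChartAt (I := 𝓘(ℝ, E)) hy
  rw [𝓘(ℝ, E).range_eq_univ, mfderivWithin_univ] at this
  exact congrArg (fun L : E →L[ℝ] E => L u) this

variable (E E') in
/-- A map between manifolds in the preferred charts at `x₀` and `x₁`. -/
noncomputable def chartMap (f : M → M') (x₀ : M) (x₁ : M') (y : E) : E' :=
  extChartAt 𝓘(ℝ, E') x₁ (f ((extChartAt 𝓘(ℝ, E) x₀).symm y))

section ChartMap

variable {f : M → M'} {x₀ : M} {x₁ : M'} {y : E}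

theorem mdiffAt_chartMap (hy : y ∈ (extChartAt 𝓘(ℝ, E) x₀).target)
    (hf : MDifferentiableAt 𝓘(ℝ, E) 𝓘(ℝ, E') f ((extChartAt 𝓘(ℝ, E) x₀).symm y))
    (h1 : f ((extChartAt 𝓘(ℝ, E) x₀).symm y) ∈ (extChartAt 𝓘(ℝ, E') x₁).source) :
    MDifferentiableAt 𝓘(ℝ, E) 𝓘(ℝ, E') (chartMap E E' f x₀ x₁) y :=
  (mdiffAt_chart h1).comp y (hf.comp y (mdiffAt_chart_symm hy))

theorem fderiv_chartMap (hy : y ∈ (extChartAt 𝓘(ℝ, E) x₀).target)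
    (hf : MDifferentiableAt 𝓘(ℝ, E) 𝓘(ℝ, E') f ((extChartAt 𝓘(ℝ, E) x₀).symm y))
    (h1 : f ((extChartAt 𝓘(ℝ, E) x₀).symm y) ∈ (extChartAt 𝓘(ℝ, E') x₁).source) (u : E) :
    fderiv ℝ (chartMap E E' f x₀ x₁) y u =
      (mfderiv 𝓘(ℝ, E') 𝓘(ℝ, E') (extChartAt 𝓘(ℝ, E') x₁) (f ((extChartAt 𝓘(ℝ, E) x₀).symm y))
        (mfderiv 𝓘(ℝ, E) 𝓘(ℝ, E') f ((extChartAt 𝓘(ℝ, E) x₀).symm y)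
          (mfderiv 𝓘(ℝ, E) 𝓘(ℝ, E) (extChartAt 𝓘(ℝ, E) x₀).symm y u)) : E') := by
  have h2 := (mdiffAt_chart h1).hasMFDerivAt.comp y
    (hf.hasMFDerivAt.comp y (mdiffAt_chart_symm hy).hasMFDerivAt)
  have h3 : mfderiv 𝓘(ℝ, E) 𝓘(ℝ, E') (chartMap E E' f x₀ x₁) y = _ := h2.mfderiv
  rw [mfderiv_eq_fderiv] at h3
  exact congrArg (fun L : E →L[ℝ] E' => L u) h3

theorem symm_fderiv_chartMap (hy : y ∈ (extChartAt 𝓘(ℝ, E) x₀).target)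
    (hf : MDifferentiableAt 𝓘(ℝ, E) 𝓘(ℝ, E') f ((extChartAt 𝓘(ℝ, E) x₀).symm y))
    (h1 : f ((extChartAt 𝓘(ℝ, E) x₀).symm y) ∈ (extChartAt 𝓘(ℝ, E') x₁).source) (u : E) :
    (mfderiv 𝓘(ℝ, E') 𝓘(ℝ, E') (extChartAt 𝓘(ℝ, E') x₁).symm (chartMap E E' f x₀ x₁ y)
      (fderiv ℝ (chartMap E E' f x₀ x₁) y u) : E') =
      mfderiv 𝓘(ℝ, E) 𝓘(ℝ, E') f ((extChartAt 𝓘(ℝ, E) x₀).symm y)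
          (mfderiv 𝓘(ℝ, E) 𝓘(ℝ, E) (extChartAt 𝓘(ℝ, E) x₀).symm y u) := by
  have e := fderiv_chartMap hy hf h1 u
  exact (congrArg (fun w : E' => (mfderiv 𝓘(ℝ, E') 𝓘(ℝ, E') (extChartAt 𝓘(ℝ, E') x₁).symm
    (chartMap E E' f x₀ x₁ y) w : E')) e).trans (chart_symm_chart h1 _)

theorem form_congr {k : ℕ} (η : DForm E M k F) {a b : M} (h : a = b) :
    (η a : E [⋀^Fin k]→L[ℝ] F) = η b := by subst h; rfl

/-- The inverse chart differential on `M'` cancels the chart differential contained in the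
derivative of `chartMap`. Hence statements on pullbacks reduce to the vector space case. -/
theorem chartRep_pull {k : ℕ} (η : DForm E' M' k F) (hy : y ∈ (extChartAt 𝓘(ℝ, E) x₀).target)
    (hf : MDifferentiableAt 𝓘(ℝ, E) 𝓘(ℝ, E') f ((extChartAt 𝓘(ℝ, E) x₀).symm y))
    (h1 : f ((extChartAt 𝓘(ℝ, E) x₀).symm y) ∈ (extChartAt 𝓘(ℝ, E') x₁).source) :
    chartRep (pull f η) x₀ y = (chartRep η x₁ (chartMap E E' f x₀ x₁ y)).compContinuousLinearMap
      (fderiv ℝ (chartMap E E' f x₀ x₁) y) := by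
  have hz : (extChartAt 𝓘(ℝ, E') x₁).symm (chartMap E E' f x₀ x₁ y) =
      f ((extChartAt 𝓘(ℝ, E) x₀).symm y) := (extChartAt 𝓘(ℝ, E') x₁).left_inv h1
  ext u
  have h2 : (fun i => (mfderiv 𝓘(ℝ, E') 𝓘(ℝ, E') (extChartAt 𝓘(ℝ, E') x₁).symm
      (chartMap E E' f x₀ x₁ y) (fderiv ℝ (chartMap E E' f x₀ x₁) y (u i)) : E')) =
      fun i => mfderiv 𝓘(ℝ, E) 𝓘(ℝ, E') f ((extChartAt 𝓘(ℝ, E) x₀).symm y)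
          (mfderiv 𝓘(ℝ, E) 𝓘(ℝ, E) (extChartAt 𝓘(ℝ, E) x₀).symm y (u i)) :=
    funext fun i => symm_fderiv_chartMap hy hf h1 (u i)
  have h3 := form_congr η hz
  exact (congr (congrArg (fun (α : E' [⋀^Fin k]→L[ℝ] F) (w : Fin k → E') => α w) h3) h2).symm

end ChartMap

theorem chart_mem_target {x₀ x : M} (hx : x ∈ (extChartAt 𝓘(ℝ, E) x₀).source) :
    extChartAt 𝓘(ℝ, E) x₀ x ∈ (extChartAt 𝓘(ℝ, E) x₀).target :=
  (extChartAt 𝓘(ℝ, E) x₀).map_source hx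

/-- A property which holds near `x` holds near the image of `x` in a chart. -/
theorem eventually_chart {x₀ x : M} (hx : x ∈ (extChartAt 𝓘(ℝ, E) x₀).source) {p : M → Prop}
    (h : ∀ᶠ z in 𝓝 x, p z) : ∀ᶠ y in 𝓝 (extChartAt 𝓘(ℝ, E) x₀ x),
      y ∈ (extChartAt 𝓘(ℝ, E) x₀).target ∧ p ((extChartAt 𝓘(ℝ, E) x₀).symm y) := by
  have h1 : Tendsto (extChartAt 𝓘(ℝ, E) x₀).symm (𝓝 (extChartAt 𝓘(ℝ, E) x₀ x)) (𝓝 x) := by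
    have := (continuousAt_extChartAt_symm'' (I := 𝓘(ℝ, E)) (chart_mem_target hx)).tendsto
    rwa [(extChartAt 𝓘(ℝ, E) x₀).left_inv hx] at this
  filter_upwards [extChartAt_target_mem_nhds' (chart_mem_target hx), h1.eventually h]
    with y h2 h3 using ⟨h2, h3⟩

theorem contDiffAt_chartMap {f : M → M'} {x₀ x : M} {x₁ : M'}
    (hx : x ∈ (extChartAt 𝓘(ℝ, E) x₀).source)
    (hf : ContMDiffAt 𝓘(ℝ, E) 𝓘(ℝ, E') ∞ f x) (h1 : f x ∈ (extChartAt 𝓘(ℝ, E') x₁).source) :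
    ContDiffAt ℝ ∞ (chartMap E E' f x₀ x₁) (extChartAt 𝓘(ℝ, E) x₀ x) := by
  have hl := (extChartAt 𝓘(ℝ, E) x₀).left_inv hx
  have h2 : ContMDiffAt 𝓘(ℝ, E) 𝓘(ℝ, E) ∞ (extChartAt 𝓘(ℝ, E) x₀).symm
      (extChartAt 𝓘(ℝ, E) x₀ x) :=
    (contMDiffOn_extChartAt_symm (I := 𝓘(ℝ, E)) (n := ∞) x₀).contMDiffAt
      (extChartAt_target_mem_nhds' (chart_mem_target hx))
  have h3 : ContMDiffAt 𝓘(ℝ, E) 𝓘(ℝ, E') ∞ (f ∘ (extChartAt 𝓘(ℝ, E) x₀).symm)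
      (extChartAt 𝓘(ℝ, E) x₀ x) := ContMDiffAt.comp _ (by rwa [hl]) h2
  have h4 : ContMDiffAt 𝓘(ℝ, E) 𝓘(ℝ, E') ∞
      (extChartAt 𝓘(ℝ, E') x₁ ∘ (f ∘ (extChartAt 𝓘(ℝ, E) x₀).symm))
      (extChartAt 𝓘(ℝ, E) x₀ x) :=
    ContMDiffAt.comp _ (contMDiffAt_extChartAt' (by
      rw [Function.comp_apply, hl, ← extChartAt_source 𝓘(ℝ, E')]; exact h1)) h3
  exact contMDiffAt_iff_contDiffAt.mp h4

theorem eventually_mdiffAt {f : M → M'} {x : M} (hf : ContMDiffAt 𝓘(ℝ, E) 𝓘(ℝ, E') ∞ f x) :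
    ∀ᶠ z in 𝓝 x, MDifferentiableAt 𝓘(ℝ, E) 𝓘(ℝ, E') f z := by
  have : IsManifold 𝓘(ℝ, E) 1 M := isManifold_one
  have : IsManifold 𝓘(ℝ, E') 1 M' := isManifold_one
  have h1 : ContMDiffAt 𝓘(ℝ, E) 𝓘(ℝ, E') 1 f x := hf.of_le (by exact_mod_cast le_top)
  filter_upwards [(contMDiffAt_iff_contMDiffAt_nhds (by simp)).mp h1] with z hz using hz.mdifferentiableAt one_ne_zero

theorem chartRep_pull_eventually {f : M → M'} {k : ℕ} (η : DForm E' M' k F) {x₀ x : M} {x₁ : M'}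
    (hx : x ∈ (extChartAt 𝓘(ℝ, E) x₀).source)
    (hf : ContMDiffAt 𝓘(ℝ, E) 𝓘(ℝ, E') ∞ f x) (h1 : f x ∈ (extChartAt 𝓘(ℝ, E') x₁).source) :
    chartRep (pull f η) x₀ =ᶠ[𝓝 (extChartAt 𝓘(ℝ, E) x₀ x)] fun y =>
      (chartRep η x₁ (chartMap E E' f x₀ x₁ y)).compContinuousLinearMap
        (fderiv ℝ (chartMap E E' f x₀ x₁) y) := by
  filter_upwards [eventually_chart hx (eventually_mdiffAt hf), eventually_chart hx
    (hf.continuousAt.eventually (extChartAt_source_mem_nhds' (I := 𝓘(ℝ, E')) h1))] with y h2 h3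
    using chartRep_pull η h2.1 h2.2 h3.2

theorem chartMap_chart {f : M → M'} {x₀ x : M} {x₁ : M'}
    (hx : x ∈ (extChartAt 𝓘(ℝ, E) x₀).source) :
    chartMap E E' f x₀ x₁ (extChartAt 𝓘(ℝ, E) x₀ x) = extChartAt 𝓘(ℝ, E') x₁ (f x) := by
  rw [chartMap, (extChartAt 𝓘(ℝ, E) x₀).left_inv hx]

theorem contDiffAt_comp_fderiv_chartMap {f : M → M'} {k : ℕ} {g : E' → E' [⋀^Fin k]→L[ℝ] F}
    {x₀ x : M} {x₁ : M'} (hx : x ∈ (extChartAt 𝓘(ℝ, E) x₀).source)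
    (hf : ContMDiffAt 𝓘(ℝ, E) 𝓘(ℝ, E') ∞ f x) (h1 : f x ∈ (extChartAt 𝓘(ℝ, E') x₁).source)
    (hg : ContDiffAt ℝ ∞ g (extChartAt 𝓘(ℝ, E') x₁ (f x))) :
    ContDiffAt ℝ ∞ (fun y => (g (chartMap E E' f x₀ x₁ y)).compContinuousLinearMap
        (fderiv ℝ (chartMap E E' f x₀ x₁) y)) (extChartAt 𝓘(ℝ, E) x₀ x) := by
  have h2 := contDiffAt_chartMap hx hf h1
  refine contDiffAt_form_comp (f := fun y => g (chartMap E E' f x₀ x₁ y)) ?_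
    (h2.fderiv_right (by simp))
  exact ContDiffAt.comp _ (by rwa [chartMap_chart hx]) h2

theorem pull_id {k : ℕ} (η : DForm E M k F) : pull (fun y : M => y) η = η := by
  funext x
  ext u
  have : mfderiv 𝓘(ℝ, E) 𝓘(ℝ, E) (fun y : M => y) x = ContinuousLinearMap.id ℝ _ := mfderiv_id
  rw [pull, this]
  rfl

/-- Smoothness of a form may be tested in any chart. -/
theorem smoothFormAt_iff {k : ℕ} (η : DForm E M k F) {x₀ x : M}
    (hx : x ∈ (extChartAt 𝓘(ℝ, E) x₀).source) :
    SmoothFormAt η x ↔ ContDiffAt ℝ ∞ (chartRep η x₀) (extChartAt 𝓘(ℝ, E) x₀ x) := by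
  constructor
  · intro h
    -- The identity map read in two charts is the transition map, so the change of chart is a
    -- special case of the pullback formula.
    have := chartRep_pull_eventually (E := E) (E' := E) (f := fun y : M => y) η (x₁ := x) hx contMDiffAt_id
      (mem_extChartAt_source x)
    rw [pull_id] at this
    refine ContDiffAt.congr_of_eventuallyEq ?_ this
    exact contDiffAt_comp_fderiv_chartMap (f := fun y : M => y) (E := E) (E' := E) hx
      contMDiffAt_id (mem_extChartAt_source x) h
  · intro h
    have := chartRep_pull_eventually (E := E) (E' := E) (f := fun y : M => y) η (x₀ := x) (x₁ := x₀)
      (mem_extChartAt_source x) contMDiffAt_id hx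
    rw [pull_id] at this
    refine ContDiffAt.congr_of_eventuallyEq ?_ this
    exact contDiffAt_comp_fderiv_chartMap (f := fun y : M => y) (E := E) (E' := E)
      (mem_extChartAt_source x) contMDiffAt_id hx h

theorem SmoothFormAt.pull {f : M → M'} {k : ℕ} {η : DForm E' M' k F} {x : M}
    (hη : SmoothFormAt η (f x)) (hf : ContMDiffAt 𝓘(ℝ, E) 𝓘(ℝ, E') ∞ f x) :
    SmoothFormAt (ExoticHori.pull f η : DForm E M k F) x :=
  (contDiffAt_comp_fderiv_chartMap (mem_extChartAt_source x) hf (mem_extChartAt_source (f x))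
    hη).congr_of_eventuallyEq (chartRep_pull_eventually η (mem_extChartAt_source x) hf
      (mem_extChartAt_source (f x)))

theorem SmoothFormAt.differentiableAt {k : ℕ} {η : DForm E M k F} {x : M}
    (hη : SmoothFormAt η x) :
    DifferentiableAt ℝ (chartRep η x) (extChartAt 𝓘(ℝ, E) x x) :=
  ContDiffAt.differentiableAt hη (by simp)

/-- The exterior derivative commutes with pullbacks. -/
theorem extD_pull {f : M → M'} {k : ℕ} {η : DForm E' M' k F} {x : M}
    (hη : SmoothFormAt η (f x)) (hf : ContMDiffAt 𝓘(ℝ, E) 𝓘(ℝ, E') ∞ f x) :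
    extD (ExoticHori.pull f η : DForm E M k F) x = ExoticHori.pull f (extD η) x := by
  have hx := mem_extChartAt_source (I := 𝓘(ℝ, E)) x
  have h1 := mem_extChartAt_source (I := 𝓘(ℝ, E')) (f x)
  have h2 := chartRep_pull_eventually η hx hf h1
  rw [extD, h2.extDeriv_eq]
  have h3 : extDeriv (fun y => (chartRep η (f x) (chartMap E E' f x (f x) y)).compContinuousLinearMap
      (fderiv ℝ (chartMap E E' f x (f x)) y)) (extChartAt 𝓘(ℝ, E) x x) = _ :=
    extDeriv_pullback (r := ∞)
    (by rw [chartMap_chart hx]; exact hη.differentiableAt) (contDiffAt_chartMap hx hf h1)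
    two_le_infty
  rw [h3, chartMap_chart hx]
  ext u
  have hfm := hf.mdifferentiableAt (by simp)
  have hl := (extChartAt 𝓘(ℝ, E) x).left_inv hx
  -- Chain rule for the two sides of `chartMap` ∘ chart = chart ∘ f, valid near x.
  have h4 : ∀ w : Tan E M x, fderiv ℝ (chartMap E E' f x (f x)) (extChartAt 𝓘(ℝ, E) x x)
      (mfderiv 𝓘(ℝ, E) 𝓘(ℝ, E) (extChartAt 𝓘(ℝ, E) x) x w) =
      (mfderiv 𝓘(ℝ, E') 𝓘(ℝ, E') (extChartAt 𝓘(ℝ, E') (f x)) (f x)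
        (mfderiv 𝓘(ℝ, E) 𝓘(ℝ, E') f x w) : E') := by
    intro w
    have h5 : MDifferentiableAt 𝓘(ℝ, E) 𝓘(ℝ, E') (chartMap E E' f x (f x))
        (extChartAt 𝓘(ℝ, E) x x) :=
      mdiffAt_chartMap (chart_mem_target hx) (by rwa [hl]) (by rwa [hl])
    have h6 := h5.hasMFDerivAt.comp x (mdiffAt_chart hx).hasMFDerivAt
    have h7 := (mdiffAt_chart h1).hasMFDerivAt.comp x hfm.hasMFDerivAt
    have h8 : chartMap E E' f x (f x) ∘ extChartAt 𝓘(ℝ, E) x =ᶠ[𝓝 x]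
        extChartAt 𝓘(ℝ, E') (f x) ∘ f := by
      filter_upwards [extChartAt_source_mem_nhds (I := 𝓘(ℝ, E)) x] with z hz
      exact chartMap_chart hz
    have h9 := h6.mfderiv.symm.trans (h8.mfderiv_eq.trans h7.mfderiv)
    rw [mfderiv_eq_fderiv] at h9
    exact congrArg (fun L : E →L[ℝ] E' => L w) h9
  have h10 : (fun i => fderiv ℝ (chartMap E E' f x (f x)) (extChartAt 𝓘(ℝ, E) x x)
      (mfderiv 𝓘(ℝ, E) 𝓘(ℝ, E) (extChartAt 𝓘(ℝ, E) x) x (u i))) = _ := funext fun i => h4 (u i)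
  exact congrArg (extDeriv (chartRep η (f x)) (extChartAt 𝓘(ℝ, E') (f x) (f x))) h10

theorem chartRep_congr {k : ℕ} {η ζ : DForm E M k F} {x₀ x : M}
    (hx : x ∈ (extChartAt 𝓘(ℝ, E) x₀).source) (h : ∀ᶠ z in 𝓝 x, η z = ζ z) :
    chartRep η x₀ =ᶠ[𝓝 (extChartAt 𝓘(ℝ, E) x₀ x)] chartRep ζ x₀ := by
  filter_upwards [eventually_chart hx h] with y hy
  rw [chartRep, chartRep, hy.2]

theorem SmoothFormAt.congr {k : ℕ} {η ζ : DForm E M k F} {x : M} (hη : SmoothFormAt η x)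
    (h : ∀ᶠ z in 𝓝 x, ζ z = η z) : SmoothFormAt ζ x :=
  ContDiffAt.congr_of_eventuallyEq hη (chartRep_congr (mem_extChartAt_source x) h)

theorem extD_congr {k : ℕ} {η ζ : DForm E M k F} {x : M} (h : ∀ᶠ z in 𝓝 x, η z = ζ z) :
    extD η x = extD ζ x := by
  rw [extD, extD, (chartRep_congr (mem_extChartAt_source x) h).extDeriv_eq]

/-- The exterior derivative in an arbitrary chart. -/
theorem chartRep_extD {k : ℕ} {η : DForm E M k F} {x₀ : M} {y : E}
    (hy : y ∈ (extChartAt 𝓘(ℝ, E) x₀).target)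
    (hη : SmoothFormAt η ((extChartAt 𝓘(ℝ, E) x₀).symm y)) :
    chartRep (extD η) x₀ y = extDeriv (chartRep η x₀) y := by
  set x := (extChartAt 𝓘(ℝ, E) x₀).symm y with hxdef
  have hx : x ∈ (extChartAt 𝓘(ℝ, E) x₀).source := (extChartAt 𝓘(ℝ, E) x₀).map_target hy
  have hr : extChartAt 𝓘(ℝ, E) x₀ x = y := (extChartAt 𝓘(ℝ, E) x₀).right_inv hy
  -- `extD` is computed in the preferred chart of each point; the transition map to the chart at x₀
  -- is treated as a pullback by the identity.
  have h2 := chartRep_pull_eventually (E := E) (E' := E) (f := fun z : M => z) η (x₁ := x) hx contMDiffAt_id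
    (mem_extChartAt_source x)
  rw [pull_id, hr] at h2
  have hc : chartMap E E (fun z : M => z) x₀ x y = extChartAt 𝓘(ℝ, E) x x := rfl
  have h3 : extDeriv (fun y => (chartRep η x
      (chartMap E E (fun z : M => z) x₀ x y)).compContinuousLinearMap
      (fderiv ℝ (chartMap E E (fun z : M => z) x₀ x) y)) y = _ :=
    extDeriv_pullback (r := ∞)
    (by rw [hc]; exact hη.differentiableAt)
    (by
      have := contDiffAt_chartMap (f := fun z : M => z) hx contMDiffAt_id (mem_extChartAt_source x)
      rwa [hr] at this)
    two_le_infty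
  rw [h2.extDeriv_eq, h3, hc]
  ext u
  have h4 : (fun i => fderiv ℝ (chartMap E E (fun z : M => z) x₀ x) y (u i)) =
      fun i => mfderiv 𝓘(ℝ, E) 𝓘(ℝ, E) (extChartAt 𝓘(ℝ, E) x) x
        (mfderiv 𝓘(ℝ, E) 𝓘(ℝ, E) (extChartAt 𝓘(ℝ, E) x₀).symm y (u i)) := by
    funext i
    have := fderiv_chartMap (f := fun z : M => z) (x₁ := x) hy mdifferentiableAt_id
      (mem_extChartAt_source x) (u i)
    rw [this]
    have h5 : mfderiv 𝓘(ℝ, E) 𝓘(ℝ, E) (fun y : M => y) x = ContinuousLinearMap.id ℝ _ := mfderiv_id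
    rw [← hxdef, h5]
    rfl
  exact (congrArg (extDeriv (chartRep η x) (extChartAt 𝓘(ℝ, E) x x)) h4).symm

/-- Smoothness is required near x because the values of `extD` at nearby points refer to their own
preferred charts, and `chartRep_extD` compares these with the chart at x. -/
theorem SmoothFormAt.extD {k : ℕ} {η : DForm E M k F} {x : M}
    (hη : ∀ᶠ z in 𝓝 x, SmoothFormAt η z) : SmoothFormAt (extD η) x := by
  have h : ContDiffAt ℝ ∞ (extDeriv (chartRep η x)) (extChartAt 𝓘(ℝ, E) x x) := by
    have h1 : ContDiffAt ℝ ∞ (fderiv ℝ (chartRep η x)) (extChartAt 𝓘(ℝ, E) x x) :=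
      ContDiffAt.fderiv_right hη.self_of_nhds (by simp)
    exact (ContinuousAlternatingMap.alternatizeUncurryFinCLM ℝ E F).contDiff.contDiffAt.comp _ h1
  refine ContDiffAt.congr_of_eventuallyEq h ?_
  filter_upwards [eventually_chart (mem_extChartAt_source x) hη] with y hy
  exact chartRep_extD hy.1 hy.2

end Manifold

end ExoticHori

namespace ExoticHori

open Filter Topology

/-! ### Leibniz rules, contractions and Lie brackets on a manifold. -/

section Operations

variable {E : Type*} [NormedAddCommGroup E] [NormedSpace ℝ E] [FiniteDimensional ℝ E]
  {M : Type*} [TopologicalSpace M] [ChartedSpace E M] [IsManifold 𝓘(ℝ, E) ∞ M]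
  {F : Type*} [NormedAddCommGroup F] [NormedSpace ℝ F] [FiniteDimensional ℝ F]
  {k l m : ℕ} {x : M}

/-- The tangent space at x is identified with `E` through the preferred chart at x itself; so chart
differentials disappear from formulas evaluated at x. -/
theorem chart_self (x : M) :
    mfderiv 𝓘(ℝ, E) 𝓘(ℝ, E) (extChartAt 𝓘(ℝ, E) x) x = ContinuousLinearMap.id ℝ E := by
  have : IsManifold 𝓘(ℝ, E) 1 M := isManifold_one
  exact mfderiv_extChartAt_self

theorem extD_eq (η : DForm E M k F) (x : M) :
    (extD η x : E [⋀^Fin (k + 1)]→L[ℝ] F) =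
      extDeriv (chartRep η x) (extChartAt 𝓘(ℝ, E) x x) := by
  rw [extD, chart_self]
  rfl

theorem chartRep_self (η : DForm E M k F) (x : M) :
    chartRep η x (extChartAt 𝓘(ℝ, E) x x) = η x := by
  have h := (extChartAt 𝓘(ℝ, E) x).left_inv (mem_extChartAt_source (I := 𝓘(ℝ, E)) x)
  ext u
  have h1 : (fun i => (mfderiv 𝓘(ℝ, E) 𝓘(ℝ, E) (extChartAt 𝓘(ℝ, E) x).symm
      (extChartAt 𝓘(ℝ, E) x x) (u i) : E)) = u := by
    funext i
    have := chart_symm_chart (E := E) (mem_extChartAt_source (I := 𝓘(ℝ, E)) x) (u i)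
    rw [chart_self] at this
    exact this
  have h2 := form_congr η h
  exact (congrArg (fun w : Fin k → E => (η ((extChartAt 𝓘(ℝ, E) x).symm
    (extChartAt 𝓘(ℝ, E) x x)) : E [⋀^Fin k]→L[ℝ] F) w) h1).trans
    (congrArg (fun α : E [⋀^Fin k]→L[ℝ] F => α u) h2)

theorem chartRep_fwedge (h : k + l = m) (α : DForm E M k ℝ) (β : DForm E M l F) (x₀ : M) :
    chartRep (fwedge h α β) x₀ = fun y => wedge h (chartRep α x₀ y) (chartRep β x₀ y) := by
  funext y
  exact wedge_comp h _ _ _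

theorem SmoothFormAt.add {η ζ : DForm E M k F} (h1 : SmoothFormAt η x) (h2 : SmoothFormAt ζ x) :
    SmoothFormAt (η + ζ) x := ContDiffAt.add h1 h2

theorem SmoothFormAt.neg {η : DForm E M k F} (h1 : SmoothFormAt η x) :
    SmoothFormAt (-η) x := ContDiffAt.neg h1

theorem SmoothFormAt.sub {η ζ : DForm E M k F} (h1 : SmoothFormAt η x) (h2 : SmoothFormAt ζ x) :
    SmoothFormAt (η - ζ) x := ContDiffAt.sub h1 h2

theorem smoothFormAt_zero : SmoothFormAt (0 : DForm E M k F) x :=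
  contDiffAt_const (c := (0 : E [⋀^Fin k]→L[ℝ] F))

theorem SmoothFormAt.fwedge {α : DForm E M k ℝ} {β : DForm E M l F} (h : k + l = m)
    (h1 : SmoothFormAt α x) (h2 : SmoothFormAt β x) : SmoothFormAt (fwedge h α β) x := by
  rw [SmoothFormAt, chartRep_fwedge]
  exact contDiffAt_wedge h h1 h2

theorem extD_add {η ζ : DForm E M k F} (h1 : SmoothFormAt η x) (h2 : SmoothFormAt ζ x) :
    extD (η + ζ) x = extD η x + extD ζ x := by
  have := extDeriv_fun_add h1.differentiableAt h2.differentiableAt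
  have h := extD_eq (η + ζ) x
  exact (h.trans this).trans (congr (congrArg (· + ·) (extD_eq η x)) (extD_eq ζ x)).symm

theorem extD_const_smul (c : ℝ) (η : DForm E M k F) (x : M) : extD (c • η) x = c • extD η x := by
  have := extDeriv_const_smul c (chartRep η x) (extChartAt 𝓘(ℝ, E) x x)
  exact ((extD_eq (c • η) x).trans this).trans (congrArg (c • ·) (extD_eq η x)).symm

theorem extD_neg (η : DForm E M k F) (x : M) : extD (-η) x = -extD η x := by
  have := extD_const_smul (-1) η x
  simpa only [neg_smul, one_smul] using this

theorem extD_fwedge {α : DForm E M k ℝ} {β : DForm E M l F} (h : k + l = m)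
    (h1 : k + 1 + l = m + 1) (h2 : k + (l + 1) = m + 1)
    (hα : SmoothFormAt α x) (hβ : SmoothFormAt β x) :
    extD (fwedge h α β) x =
      wedge h1 (extD α x) (β x) + (-1 : ℝ) ^ k • wedge h2 (α x) (extD β x) := by
  have e := extD_eq (fwedge h α β) x
  rw [chartRep_fwedge] at e
  have e2 := extDeriv_wedge h h1 h2 hα.differentiableAt hβ.differentiableAt
  rw [chartRep_self, chartRep_self] at e2
  have e3 := extD_eq α x
  have e4 := extD_eq β x
  rw [← e3, ← e4] at e2
  exact e.trans e2

theorem contDiffAt_chart_of_contMDiffAt {f : M → F} (hf : ContMDiffAt 𝓘(ℝ, E) 𝓘(ℝ, F) ∞ f x) :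
    ContDiffAt ℝ ∞ (fun y => f ((extChartAt 𝓘(ℝ, E) x).symm y)) (extChartAt 𝓘(ℝ, E) x x) :=
  contDiffAt_chartMap (x₁ := f x) (mem_extChartAt_source x) hf (mem_extChartAt_source (f x))

theorem fderiv_chart {f : M → F} (hf : MDifferentiableAt 𝓘(ℝ, E) 𝓘(ℝ, F) f x) (u : E) :
    fderiv ℝ (fun y => f ((extChartAt 𝓘(ℝ, E) x).symm y)) (extChartAt 𝓘(ℝ, E) x x) u =
      mfderiv 𝓘(ℝ, E) 𝓘(ℝ, F) f x u := by
  have hx := mem_extChartAt_source (I := 𝓘(ℝ, E)) x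
  have hl := (extChartAt 𝓘(ℝ, E) x).left_inv hx
  have h1 : MDifferentiableAt 𝓘(ℝ, E) 𝓘(ℝ, F) (fun y => f ((extChartAt 𝓘(ℝ, E) x).symm y))
      (extChartAt 𝓘(ℝ, E) x x) :=
    MDifferentiableAt.comp _ (by rwa [hl]) (mdiffAt_chart_symm (chart_mem_target hx))
  have h2 := h1.hasMFDerivAt.comp x (mdiffAt_chart hx).hasMFDerivAt
  have h3 : (fun y => f ((extChartAt 𝓘(ℝ, E) x).symm y)) ∘ extChartAt 𝓘(ℝ, E) x =ᶠ[𝓝 x] f := by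
    filter_upwards [extChartAt_source_mem_nhds (I := 𝓘(ℝ, E)) x] with z hz
    exact congrArg f ((extChartAt 𝓘(ℝ, E) x).left_inv hz)
  have h4 := h2.mfderiv.symm.trans h3.mfderiv_eq
  rw [mfderiv_eq_fderiv, chart_self] at h4
  exact congrArg (fun L : E →L[ℝ] F => L u) h4

theorem SmoothFormAt.smul_fun {f : M → ℂ} {η : DForm E M k ℂ}
    (hf : ContMDiffAt 𝓘(ℝ, E) 𝓘(ℝ, ℂ) ∞ f x) (hη : SmoothFormAt η x) :
    SmoothFormAt (fun z => f z • η z) x :=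
  contDiffAt_form fun u => by
    have := contDiffAt_form_apply (w := fun i _ => u i) hη fun _ => contDiffAt_const
    exact (contDiffAt_chart_of_contMDiffAt hf).smul this

/-- The exterior derivative of `f η` for a function `f` with `df = c f τ`. -/
theorem extD_complex_smul {c : ℂ} {f : M → ℂ} {τ : Tan E M x [⋀^Fin 1]→L[ℝ] ℝ}
    (hf : MDifferentiableAt 𝓘(ℝ, E) 𝓘(ℝ, ℂ) f x)
    (hτ : ∀ u : Tan E M x, (mfderiv 𝓘(ℝ, E) 𝓘(ℝ, ℂ) f x u : ℂ) = f x * (c * ((τ ![u] : ℝ) : ℂ)))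
    (h : 1 + k = k + 1) {η : DForm E M k ℂ} (hη : SmoothFormAt η x) :
    extD (fun z => f z • η z) x = f x • (extD η x + c • wedge h τ (η x)) := by
  have hl := (extChartAt 𝓘(ℝ, E) x).left_inv (mem_extChartAt_source (I := 𝓘(ℝ, E)) x)
  have h1 : DifferentiableAt ℝ (fun y => f ((extChartAt 𝓘(ℝ, E) x).symm y))
      (extChartAt 𝓘(ℝ, E) x x) := by
    have h1 : MDifferentiableAt 𝓘(ℝ, E) 𝓘(ℝ, ℂ) (fun y => f ((extChartAt 𝓘(ℝ, E) x).symm y))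
        (extChartAt 𝓘(ℝ, E) x x) :=
      MDifferentiableAt.comp _ (by rwa [hl]) (mdiffAt_chart_symm
        (chart_mem_target (mem_extChartAt_source (I := 𝓘(ℝ, E)) x)))
    exact mdifferentiableAt_iff_differentiableAt.mp h1
  have h3 : ∀ u : E, fderiv ℝ (fun y => f ((extChartAt 𝓘(ℝ, E) x).symm y))
      (extChartAt 𝓘(ℝ, E) x x) u = f ((extChartAt 𝓘(ℝ, E) x).symm (extChartAt 𝓘(ℝ, E) x x)) *
        (c * ((τ : E [⋀^Fin 1]→L[ℝ] ℝ) ![u] : ℝ)) := fun u => by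
    rw [hl]
    exact (fderiv_chart hf u).trans (hτ u)
  have h2 := extDeriv_complex_smul (E := E) h1 h3 h hη.differentiableAt
  have e := extD_eq (fun z => f z • η z) x
  have e4 := extD_eq η x
  rw [chartRep_self, ← e4, hl] at h2
  exact e.trans h2

/-! ### Vector fields in charts -/

/-- A vector field in the preferred chart at `x₀`. -/
noncomputable def vecRep (V : VField E M) (x₀ : M) (y : E) : E :=
  mfderiv 𝓘(ℝ, E) 𝓘(ℝ, E) (extChartAt 𝓘(ℝ, E) x₀) ((extChartAt 𝓘(ℝ, E) x₀).symm y)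
    (V ((extChartAt 𝓘(ℝ, E) x₀).symm y))

theorem vecRep_self (V : VField E M) (x : M) :
    vecRep V x (extChartAt 𝓘(ℝ, E) x x) = V x := by
  have hl := (extChartAt 𝓘(ℝ, E) x).left_inv (mem_extChartAt_source (I := 𝓘(ℝ, E)) x)
  rw [vecRep, hl, chart_self]
  rfl

/-- The trivialization of the tangent bundle at x is given by the differential of the chart at x. -/
theorem contMDiffAt_section_iff_vecRep (V : VField E M) (x : M) :
    ContMDiffAt 𝓘(ℝ, E) 𝓘(ℝ, E).tangent ∞ (fun x => (⟨x, V x⟩ : TangentBundle 𝓘(ℝ, E) M)) x ↔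
      ContDiffAt ℝ ∞ (vecRep V x) (extChartAt 𝓘(ℝ, E) x x) := by
  have : IsManifold 𝓘(ℝ, E) 1 M := isManifold_one
  have h1 := Bundle.contMDiffAt_section (IB := 𝓘(ℝ, E)) (n := ∞) (F := E)
    (E := fun x : M => TangentSpace 𝓘(ℝ, E) x) (s := V) x
  refine h1.trans ?_
  have h2 : (fun z => ((trivializationAt E (TangentSpace 𝓘(ℝ, E)) x) ⟨z, V z⟩).2) =ᶠ[𝓝 x]
      fun z => (mfderiv 𝓘(ℝ, E) 𝓘(ℝ, E) (extChartAt 𝓘(ℝ, E) x) z (V z) : E) := by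
    filter_upwards [(chartAt E x).open_source.mem_nhds (mem_chart_source E x)] with z hz
    have := TangentBundle.continuousLinearMapAt_trivializationAt (I := 𝓘(ℝ, E)) hz
    have h3 : (trivializationAt E (TangentSpace 𝓘(ℝ, E)) x).continuousLinearMapAt ℝ z (V z) =
        ((trivializationAt E (TangentSpace 𝓘(ℝ, E)) x) ⟨z, V z⟩).2 := by
      rw [Bundle.Trivialization.continuousLinearMapAt_apply,
        Bundle.Trivialization.linearMapAt_apply, if_pos]
      simpa using hz
    exact h3.symm.trans (congrArg (fun L : E →L[ℝ] E => L (V z)) this)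
  rw [h2.contMDiffAt_iff]
  constructor
  · intro h
    exact contDiffAt_chart_of_contMDiffAt h
  · intro h
    have h3 : ContMDiffAt 𝓘(ℝ, E) 𝓘(ℝ, E) ∞ (vecRep V x ∘ extChartAt 𝓘(ℝ, E) x) x :=
      (contMDiffAt_iff_contDiffAt.mpr h).comp x contMDiffAt_extChartAt
    refine h3.congr_of_eventuallyEq ?_
    filter_upwards [extChartAt_source_mem_nhds (I := 𝓘(ℝ, E)) x] with z hz
    rw [Function.comp_apply, vecRep, (extChartAt 𝓘(ℝ, E) x).left_inv hz]

theorem chartRep_inter {k : ℕ} (V : VField E M) (β : DForm E M (k + 1) F) {x₀ : M} {y : E}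
    (hy : y ∈ (extChartAt 𝓘(ℝ, E) x₀).target) :
    chartRep (inter V β) x₀ y = contract (vecRep V x₀ y) (chartRep β x₀ y) := by
  have h := contract_comp (V := E) (W := E) (F := F)
    (show E →L[ℝ] E from mfderiv 𝓘(ℝ, E) 𝓘(ℝ, E) (extChartAt 𝓘(ℝ, E) x₀).symm y)
    (vecRep V x₀ y) (β ((extChartAt 𝓘(ℝ, E) x₀).symm y))
  refine Eq.trans ?_ h.symm
  have h1 : (mfderiv 𝓘(ℝ, E) 𝓘(ℝ, E) (extChartAt 𝓘(ℝ, E) x₀).symm y (vecRep (E := E) V x₀ y) : E) =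
    V ((extChartAt 𝓘(ℝ, E) x₀).symm y) := chart_symm_chart' hy _
  exact congrArg (fun w : E => (contract w (β ((extChartAt 𝓘(ℝ, E) x₀).symm y) :
    E [⋀^Fin (k + 1)]→L[ℝ] F)).compContinuousLinearMap
    (show E →L[ℝ] E from mfderiv 𝓘(ℝ, E) 𝓘(ℝ, E) (extChartAt 𝓘(ℝ, E) x₀).symm y)) h1.symm

theorem chartRep_inter_eventually (V : VField E M) (β : DForm E M (k + 1) F) (x : M) :
    chartRep (inter V β) x =ᶠ[𝓝 (extChartAt 𝓘(ℝ, E) x x)]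
      fun y => contract (vecRep V x y) (chartRep β x y) := by
  filter_upwards [extChartAt_target_mem_nhds (I := 𝓘(ℝ, E)) x] with y hy
  exact chartRep_inter V β hy

theorem SmoothFormAt.inter {V : VField E M} {β : DForm E M (k + 1) F}
    (hV : ContDiffAt ℝ ∞ (vecRep V x) (extChartAt 𝓘(ℝ, E) x x)) (hβ : SmoothFormAt β x) :
    SmoothFormAt (inter V β) x :=
  (contDiffAt_contract hV hβ).congr_of_eventuallyEq (chartRep_inter_eventually V β x)

/-- The bracket is defined by pulling the fields back to the chart and transporting the result by
the inverse of the chart differential, which is the identity at x. -/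
theorem mlieBracket_eq (V W : VField E M) (x : M) :
    VectorField.mlieBracket 𝓘(ℝ, E) V W x =
      VectorField.lieBracket ℝ (vecRep V x) (vecRep W x) (extChartAt 𝓘(ℝ, E) x x) := by
  have e : ∀ V : VField E M, VectorField.mpullbackWithin 𝓘(ℝ, E) 𝓘(ℝ, E)
      (extChartAt 𝓘(ℝ, E) x).symm V Set.univ =ᶠ[𝓝 (extChartAt 𝓘(ℝ, E) x x)] vecRep V x := by
    intro V
    filter_upwards [extChartAt_target_mem_nhds (I := 𝓘(ℝ, E)) x] with y hy
    rw [VectorField.mpullbackWithin_apply, mfderivWithin_univ, vecRep]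
    congr 1
    refine ContinuousLinearMap.inverse_eq ?_ ?_
    · ext u; exact chart_symm_chart' hy u
    · ext u; exact chart_chart_symm hy u
  have h0 := VectorField.mlieBracketWithin_apply (I := 𝓘(ℝ, E)) (V := V) (W := W) (s := Set.univ)
    (x₀ := x)
  rw [𝓘(ℝ, E).range_eq_univ, Set.preimage_univ, Set.univ_inter] at h0
  have h2 := (e V).lieBracket_vectorField_eq (𝕜 := ℝ) (e W)
  have h3 := congrFun (VectorField.lieBracketWithin_univ (𝕜 := ℝ)
    (V := VectorField.mpullbackWithin 𝓘(ℝ, E) 𝓘(ℝ, E) (extChartAt 𝓘(ℝ, E) x).symm V Set.univ)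
    (W := VectorField.mpullbackWithin 𝓘(ℝ, E) 𝓘(ℝ, E) (extChartAt 𝓘(ℝ, E) x).symm W Set.univ))
    (extChartAt 𝓘(ℝ, E) x x)
  have h1 : ContinuousLinearMap.inverse (R := ℝ) (M := E) (M₂ := E)
      (show E →L[ℝ] E from mfderiv 𝓘(ℝ, E) 𝓘(ℝ, E) (extChartAt 𝓘(ℝ, E) x) x) = ContinuousLinearMap.id ℝ E := by
    have := chart_self (E := E) x
    exact (congrArg (fun L : E →L[ℝ] E => L.inverse) this).trans ContinuousLinearMap.inverse_id
  exact (h0.trans (congrArg (fun L : E →L[ℝ] E => L _) h1)).trans (h3.trans h2)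

theorem extD_zero_apply (f : DForm E M 0 F) (u : E) :
    (extD f x : E [⋀^Fin 1]→L[ℝ] F) ![u] =
      fderiv ℝ (chartRep f x) (extChartAt 𝓘(ℝ, E) x x) u ![] := by
  have h1 := contract_extDeriv_zero (g := chartRep f x) (x := extChartAt 𝓘(ℝ, E) x x) u
  rw [← extD_eq] at h1
  rw [← h1]
  rfl

/-- The formula `dβ(V, W) = V β(W) - W β(V) - β([V, W])`. -/
theorem extD_one_form {β : DForm E M 1 F} {V W : VField E M} (hβ : SmoothFormAt β x)
    (hV : ContDiffAt ℝ ∞ (vecRep V x) (extChartAt 𝓘(ℝ, E) x x))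
    (hW : ContDiffAt ℝ ∞ (vecRep W x) (extChartAt 𝓘(ℝ, E) x x)) :
    extD β x ![V x, W x] = extD (inter W β) x ![V x] - extD (inter V β) x ![W x] -
      β x ![VectorField.mlieBracket 𝓘(ℝ, E) V W x] := by
  have hV' := hV.differentiableAt (by simp)
  have hW' := hW.differentiableAt (by simp)
  have h := extDeriv_one_form hβ.differentiableAt hV' hW'
  rw [vecRep_self, vecRep_self, chartRep_self, ← mlieBracket_eq, ← extD_eq] at h
  have key : ∀ V : VField E M, ContDiffAt ℝ ∞ (vecRep V x) (extChartAt 𝓘(ℝ, E) x x) → ∀ u : E,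
      (extD (inter V β) x : E [⋀^Fin 1]→L[ℝ] F) ![u] =
      fderiv ℝ (fun y => chartRep β x y ![vecRep V x y]) (extChartAt 𝓘(ℝ, E) x x) u := by
    intro V hV u
    rw [extD_zero_apply, (chartRep_inter_eventually V β x).fderiv_eq]
    have hd : DifferentiableAt ℝ (fun y => contract (vecRep V x y) (chartRep β x y))
        (extChartAt 𝓘(ℝ, E) x x) := (contDiffAt_contract hV hβ).differentiableAt (by simp)
    have h2 := ((ContinuousAlternatingMap.apply ℝ E F (![] : Fin 0 → E)).hasFDerivAt.comp _
      hd.hasFDerivAt).fderiv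
    exact (congrArg (fun L : E →L[ℝ] F => L u) h2).symm
  exact h.trans (congrArg₂ (fun a b : F => a - b - (β x : E [⋀^Fin 1]→L[ℝ] F)
    ![VectorField.mlieBracket 𝓘(ℝ, E) V W x]) (key W hW _).symm (key V hV _).symm)

end Operations

end ExoticHori

namespace ExoticHori

open Filter Topology

/-! ### The differential of a map, with the tangent spaces identified with the model spaces -/

section Dmap

variable {E : Type*} [NormedAddCommGroup E] [NormedSpace ℝ E]
  {M : Type*} [TopologicalSpace M] [ChartedSpace E M]
  {E' : Type*} [NormedAddCommGroup E'] [NormedSpace ℝ E']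
  {M' : Type*} [TopologicalSpace M'] [ChartedSpace E' M']
  {E'' : Type*} [NormedAddCommGroup E''] [NormedSpace ℝ E'']
  {M'' : Type*} [TopologicalSpace M''] [ChartedSpace E'' M'']

variable (E E') in
/-- The differential of a map between manifolds. -/
noncomputable def dmap (f : M → M') (x : M) : E →L[ℝ] E' := mfderiv 𝓘(ℝ, E) 𝓘(ℝ, E') f x

theorem dmap_comp {g : M' → M''} {f : M → M'} (x : M)
    (hg : MDifferentiableAt 𝓘(ℝ, E') 𝓘(ℝ, E'') g (f x))
    (hf : MDifferentiableAt 𝓘(ℝ, E) 𝓘(ℝ, E') f x) :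
    dmap E E'' (fun y => g (f y)) x = (dmap E' E'' g (f x)).comp (dmap E E' f x) :=
  mfderiv_comp x hg hf

theorem dmap_congr {f g : M → M'} {x : M} (h : f =ᶠ[𝓝 x] g) : dmap E E' f x = dmap E E' g x :=
  h.mfderiv_eq

theorem dmap_id (x : M) : dmap E E (fun y : M => y) x = ContinuousLinearMap.id ℝ E := mfderiv_id

theorem dmap_const (y : M') (x : M) : dmap E E' (fun _ : M => y) x = 0 := mfderiv_const

end Dmap

/-! ### Rotations -/

theorem rot_zero : rot 0 = 1 := by simp [rot]

theorem rot_add (s t : ℝ) : rot (s + t) = rot s * rot t := by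
  rw [rot, rot, rot, mul_add, Circle.exp_add]

theorem exists_rot (c : Circle) : ∃ t, rot t = c := by
  refine ⟨Complex.arg c / (2 * Real.pi), ?_⟩
  rw [rot, mul_div_cancel₀ _ (by positivity), Circle.exp_arg]

theorem rot_coe (t : ℝ) : (rot t : ℂ) = Complex.exp (2 * Real.pi * t * Complex.I) := by
  rw [rot, Circle.coe_exp]
  push_cast
  rfl

theorem rot_zpow (t : ℝ) (n : ℤ) :
    (rot t : ℂ) ^ n = Complex.exp (2 * Real.pi * Complex.I * n * t) := by
  rw [rot_coe, ← Complex.exp_int_mul]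
  congr 1
  ring

theorem contMDiff_rot : ContMDiff 𝓘(ℝ, ℝ) (𝓡 1) ∞ rot :=
  contMDiff_circleExp.comp (contDiff_const.mul contDiff_id).contMDiff

theorem contMDiff_circle_coe : ContMDiff (𝓡 1) 𝓘(ℝ, ℂ) ∞ (fun c : Circle => (c : ℂ)) :=
  have : Fact (Module.finrank ℝ ℂ = 1 + 1) := finrank_real_complex_fact'
  contMDiff_coe_sphere

section Angle

variable {E : Type*} [NormedAddCommGroup E] [NormedSpace ℝ E]
  {M : Type*} [TopologicalSpace M] [ChartedSpace E M]

/-- A smooth circle-valued function has a smooth logarithm near each point. -/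
theorem exists_angle {h : M → Circle} {x : M} (hh : ∀ᶠ y in 𝓝 x, ContMDiffAt 𝓘(ℝ, E) (𝓡 1) ∞ h y) :
    ∃ θ : M → ℝ, (∀ᶠ y in 𝓝 x, ContMDiffAt 𝓘(ℝ, E) 𝓘(ℝ, ℝ) ∞ θ y) ∧ θ x = 0 ∧
      ∀ y, rot (θ y) * h x = h y := by
  -- The quotient h y / h x is 1 at x, so near x it stays in the slit plane, where the logarithm is
  -- smooth. The equation itself holds for every y, smooth or not.
  refine ⟨fun y => Complex.arg (h y * (h x)⁻¹ : Circle) / (2 * Real.pi), ?_, ?_, ?_⟩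
  · have h0 : ∀ᶠ y in 𝓝 x, ((h y * (h x)⁻¹ : Circle) : ℂ) ∈ Complex.slitPlane := by
      have hc : ContinuousAt (fun y => ((h y * (h x)⁻¹ : Circle) : ℂ)) x :=
        (Continuous.continuousAt (f := fun c : Circle => (c : ℂ)) (by fun_prop)).comp
          (hh.self_of_nhds.continuousAt.mul continuousAt_const)
      refine hc.eventually (Complex.isOpen_slitPlane.mem_nhds ?_)
      simp [Complex.one_mem_slitPlane]
    filter_upwards [hh, h0] with y h1 h2
    have h3 : ContMDiffAt 𝓘(ℝ, E) 𝓘(ℝ, ℂ) ∞ (fun y => ((h y * (h x)⁻¹ : Circle) : ℂ)) y :=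
      contMDiff_circle_coe.contMDiffAt.comp y (h1.mul contMDiffAt_const)
    have h4 : ContDiffAt ℝ ∞ (fun w : ℂ => Complex.arg w / (2 * Real.pi))
        ((h y * (h x)⁻¹ : Circle) : ℂ) := by
      have h5 : ContDiffAt ℝ ∞ (fun w : ℂ => (Complex.log w).im)
          ((h y * (h x)⁻¹ : Circle) : ℂ) :=
        Complex.imCLM.contDiff.contDiffAt.comp _
          ((Complex.contDiffAt_log h2).restrict_scalars ℝ)
      simp only [Complex.log_im] at h5
      exact h5.div_const _
    exact h4.contMDiffAt.comp y h3
  · simp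
  · intro y
    rw [rot, mul_div_cancel₀ _ (by positivity), Circle.exp_arg]
    simp

end Angle

/-! ### The geometry of a circle bundle -/

namespace CircleBundle

variable {EX : Type*} [NormedAddCommGroup EX] [NormedSpace ℝ EX] [FiniteDimensional ℝ EX]
  {X : Type*} [TopologicalSpace X] [ChartedSpace EX X] [IsManifold 𝓘(ℝ, EX) ∞ X]
  {EP : Type*} [NormedAddCommGroup EP] [NormedSpace ℝ EP] [FiniteDimensional ℝ EP]
  {P : Type*} [TopologicalSpace P] [ChartedSpace EP P] [IsManifold 𝓘(ℝ, EP) ∞ P]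
  [MulAction Circle P]
  (p : CircleBundle EX X EP P)

/-- The connection form at `z`. -/
def A (z : P) : EP [⋀^Fin 1]→L[ℝ] ℝ := p.conn z

variable (EP) in
/-- The generator of the circle action at `z`. -/
noncomputable def vv (z : P) : EP := vert EP z

/-- The differential of the projection at `z`. -/
noncomputable def dp (z : P) : EP →L[ℝ] EX := dmap EP EX p.proj z

/-- The horizontal lift at `z`. -/
noncomputable def hr (z : P) : EX →L[ℝ] EP := p.hor z

variable (EP) in
/-- The differential at `z` of the action of `c`. -/
noncomputable def dact (c : Circle) (z : P) : EP →L[ℝ] EP := dmap EP EP (fun y : P => c • y) z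

theorem contMDiff_smul (p : CircleBundle EX X EP P) (c : Circle) : ContMDiff 𝓘(ℝ, EP) 𝓘(ℝ, EP) ∞ (fun y : P => c • y) :=
  p.smooth_action.comp (contMDiff_const.prodMk contMDiff_id)

theorem mdiff_smul (p : CircleBundle EX X EP P) (c : Circle) (z : P) :
   
    MDifferentiableAt 𝓘(ℝ, EP) 𝓘(ℝ, EP) (fun y : P => c • y) z :=
  (p.contMDiff_smul c).mdifferentiableAt (by simp)

theorem mdiff_proj (z : P) : MDifferentiableAt 𝓘(ℝ, EP) 𝓘(ℝ, EX) p.proj z :=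
  p.smooth_proj.mdifferentiableAt (by simp)

theorem dp_dact (c : Circle) (z : P) : (p.dp (c • z)).comp (dact EP c z) = p.dp z := by
  have h := dmap_comp (g := p.proj) z (p.mdiff_proj (c • z)) (p.mdiff_smul c z)
  simp only [p.proj_smul] at h
  exact h.symm

theorem dact_mul (p : CircleBundle EX X EP P) (c d : Circle) (z : P) :
    dact EP (c * d) z = (dact EP c (d • z)).comp (dact EP d z) := by
  have h := dmap_comp (g := fun y : P => c • y) z (p.mdiff_smul c (d • z)) (p.mdiff_smul d z)
  simp only [smul_smul] at h
  exact h

theorem dact_one (z : P) : dact EP 1 z = ContinuousLinearMap.id ℝ EP := by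
  have := dmap_id (E := EP) z
  unfold dact
  simp only [one_smul]
  exact this

/-- The circle is abelian, so the action of c maps orbit curves to orbit curves with the same
parameter. -/
theorem dact_vv (p : CircleBundle EX X EP P) (c : Circle) (z : P) : dact EP c z (vv EP z) = vv EP (c • z) := by
  have h0 : rot 0 • z = z := by simp [rot]
  have h := dmap_comp (g := fun y : P => c • y) (f := fun t : ℝ => rot t • z) (0 : ℝ)
    (p.mdiff_smul c (rot 0 • z)) ((p.smooth_rot z).mdifferentiableAt (by simp))
  have h1 : (fun t : ℝ => c • rot t • z) = fun t => rot t • c • z := by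
    funext t; rw [smul_smul, smul_smul, mul_comm]
  rw [h1, h0] at h
  exact (congrArg (fun L : ℝ →L[ℝ] EP => L 1) h).symm

theorem A_dact (c : Circle) (z : P) : (p.A (c • z)).compContinuousLinearMap (dact EP c z) = p.A z :=
  congrFun (p.conn_inv c) z

theorem dp_vv (z : P) : p.dp z (vv EP z) = 0 := p.dproj_vert z

theorem A_vv (z : P) : p.A z ![vv EP z] = 1 := p.conn_vert z

/-- A local section through `z`, and the angle relative to it. -/
theorem exists_section (z : P) : ∃ U : Set X, IsOpen U ∧ p.proj z ∈ U ∧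
    ContMDiffOn 𝓘(ℝ, EX) 𝓘(ℝ, EP) ∞ (p.secThrough z) U ∧ (∀ x ∈ U, p.proj (p.secThrough z x) = x) ∧
    p.secThrough z (p.proj z) = z ∧
    ∃ θ : P → ℝ, (∀ᶠ y in 𝓝 z, ContMDiffAt 𝓘(ℝ, EP) 𝓘(ℝ, ℝ) ∞ θ y) ∧ θ z = 0 ∧
      ∀ y, p.proj y ∈ U → rot (θ y) • p.secThrough z (p.proj y) = y := by
  let U := (p.exists_localTriv (p.proj z)).choose
  let s := (p.exists_localTriv (p.proj z)).choose_spec.choose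
  let h := (p.exists_localTriv (p.proj z)).choose_spec.choose_spec.choose
  obtain ⟨hz, t⟩ := (p.exists_localTriv (p.proj z)).choose_spec.choose_spec.choose_spec
  have hs : p.secThrough z = fun x => h z • s x := rfl
  rw [hs]
  refine ⟨U, t.isOpen, hz, ?_, ?_, ?_, ?_⟩
  · intro x hx
    exact (p.contMDiff_smul (h z)).contMDiffAt.comp_contMDiffWithinAt x (t.smooth_section x hx)
  · intro x hx
    rw [p.proj_smul, t.proj_section x hx]
  · exact t.angle_smul_section z hz
  · have ho : IsOpen (p.proj ⁻¹' U) := t.isOpen.preimage p.smooth_proj.continuous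
    obtain ⟨θ, h1, h2, h3⟩ := exists_angle (E := EP) (h := h) (x := z) (by
      filter_upwards [ho.mem_nhds hz] with y hy
      exact t.smooth_angle.contMDiffAt (ho.mem_nhds hy))
    refine ⟨θ, h1, h2, fun y hy => ?_⟩
    rw [smul_smul, h3]
    exact t.angle_smul_section y hy

theorem smul_of_proj_eq {z z' : P} (h : p.proj z = p.proj z') : ∃ c : Circle, z' = c • z := by
  obtain ⟨U, -, hz, -, -, hg, θ, -, -, h3⟩ := p.exists_section z
  refine ⟨rot (θ z'), ?_⟩
  have := h3 z' (h ▸ hz)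
  rw [← h, hg] at this
  exact this.symm

/-- Differentiate y = rot (θ y) • g (proj y) at z, where θ z = 0 and g (proj z) = z. The partial
derivative in the angle gives the multiple of the generator, the other one the tangent of the
section. -/
theorem decomp_section {z : P} {g : X → P} {θ : P → ℝ}
    (hg : MDifferentiableAt 𝓘(ℝ, EX) 𝓘(ℝ, EP) g (p.proj z))
    (hθ : MDifferentiableAt 𝓘(ℝ, EP) 𝓘(ℝ, ℝ) θ z) (hz : g (p.proj z) = z) (h0 : θ z = 0)
    (h : ∀ᶠ y in 𝓝 z, rot (θ y) • g (p.proj y) = y) (u : EP) :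
    u = dmap EX EP g (p.proj z) (p.dp z u) + dmap EP ℝ θ z u • vv EP z := by
  have hG : ContMDiff (𝓘(ℝ, ℝ).prod 𝓘(ℝ, EP)) 𝓘(ℝ, EP) ∞ (fun q : ℝ × P => rot q.1 • q.2) :=
    p.smooth_action.comp ((contMDiff_rot.comp contMDiff_fst).prodMk contMDiff_snd)
  have hk : MDifferentiableAt 𝓘(ℝ, EP) (𝓘(ℝ, ℝ).prod 𝓘(ℝ, EP)) (fun y => (θ y, g (p.proj y))) z :=
    hθ.prodMk (MDifferentiableAt.comp z hg (p.mdiff_proj z))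
  have hGd : MDifferentiableAt (𝓘(ℝ, ℝ).prod 𝓘(ℝ, EP)) 𝓘(ℝ, EP) (fun q : ℝ × P => rot q.1 • q.2)
      (θ z, g (p.proj z)) := hG.mdifferentiableAt (by simp)
  have h1 := mfderiv_comp z hGd hk
  have h2 : ((fun q : ℝ × P => rot q.1 • q.2) ∘ fun y => (θ y, g (p.proj y))) =ᶠ[𝓝 z] fun y => y :=
    h
  have h3 : mfderiv 𝓘(ℝ, EP) 𝓘(ℝ, EP) (fun y : P => y) z = ContinuousLinearMap.id ℝ _ := mfderiv_id
  rw [h2.mfderiv_eq, h3] at h1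
  have h4 := congrArg (fun L : EP →L[ℝ] EP => L u) h1
  have h5 := mfderiv_prod_eq_add_apply (v := mfderiv 𝓘(ℝ, EP) (𝓘(ℝ, ℝ).prod 𝓘(ℝ, EP))
    (fun y => (θ y, g (p.proj y))) z u) hGd
  have h6 : mfderiv 𝓘(ℝ, EP) (𝓘(ℝ, ℝ).prod 𝓘(ℝ, EP)) (fun y => (θ y, g (p.proj y))) z =
      (mfderiv 𝓘(ℝ, EP) 𝓘(ℝ, ℝ) θ z).prod (mfderiv 𝓘(ℝ, EP) 𝓘(ℝ, EP) (fun y => g (p.proj y)) z) :=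
    hθ.mfderiv_prod (MDifferentiableAt.comp z hg (p.mdiff_proj z))
  have h7 := dmap_comp (g := g) z hg (p.mdiff_proj z)
  have h8 : dmap EP EP (fun y : P => rot (θ z) • y) (g (p.proj z)) = ContinuousLinearMap.id ℝ EP := by
    rw [hz, h0, rot_zero]
    exact dact_one z
  have h9 : dmap ℝ EP (fun t : ℝ => rot t • g (p.proj z)) (θ z) = dmap ℝ EP (fun t => rot t • z) 0 := by
    rw [hz, h0]
  have e0 := congrArg (fun L : EP →L[ℝ] ℝ × EP => L u) h6
  have e1 : dmap EP EP (fun y : P => rot (θ z) • y) (g (p.proj z))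
      (dmap EP EP (fun y => g (p.proj y)) z u) = dmap EX EP g (p.proj z) (p.dp z u) := by
    rw [h8, h7]
    rfl
  have e2 : dmap ℝ EP (fun t : ℝ => rot t • g (p.proj z)) (θ z) (dmap EP ℝ θ z u) =
      dmap EP ℝ θ z u • vv EP z := by
    have := (dmap ℝ EP (fun t : ℝ => rot t • z) 0).map_smul (dmap EP ℝ θ z u) 1
    rw [smul_eq_mul, mul_one] at this
    rw [h9]
    exact this
  refine (h4.trans h5).trans (Eq.trans ?_ ((congrArg₂ (fun a b : EP => a + b) e2 e1).trans
    (add_comm _ _)))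
  exact congrArg (fun w : ℝ × EP => dmap ℝ EP (fun t : ℝ => rot t • g (p.proj z)) (θ z) w.1 +
    dmap EP EP (fun y : P => rot (θ z) • y) (g (p.proj z)) w.2) e0

/-- The splitting of the tangent space at a point determined by the connection. -/
theorem exists_splitting (z : P) : ∃ L : EX →L[ℝ] EP, IsSplitting (p.dp z) (p.A z) (vv EP z) L := by
  obtain ⟨U, hU, hz, hg, hpg, hgz, θ, hθ, h0, h⟩ := p.exists_section z
  have hUn := hU.mem_nhds hz
  have hgs : ContMDiffAt 𝓘(ℝ, EX) 𝓘(ℝ, EP) ∞ (p.secThrough z) (p.proj z) := hg.contMDiffAt hUn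
  have hgd := hgs.mdifferentiableAt (by simp)
  have hd := p.decomp_section hgd (hθ.self_of_nhds.mdifferentiableAt (by simp)) hgz h0 (by
    filter_upwards [p.smooth_proj.continuous.continuousAt.preimage_mem_nhds hUn] with y hy
      using h y hy)
  have hp : ∀ u : EX, p.dp z (dmap EX EP (p.secThrough z) (p.proj z) u) = u := by
    intro u
    have h1 := dmap_comp (g := p.proj) (p.proj z) (p.mdiff_proj _) hgd
    have h2 : dmap EX EX (fun x => p.proj (p.secThrough z x)) (p.proj z) =
        ContinuousLinearMap.id ℝ EX := by
      rw [← dmap_id (p.proj z)]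
      refine dmap_congr ?_
      filter_upwards [hUn] with x hx using hpg x hx
    rw [h2, hgz] at h1
    exact (congrArg (fun L : EX →L[ℝ] EX => L u) h1).symm
  set G := dmap EX EP (p.secThrough z) (p.proj z)
  let a : EP →L[ℝ] ℝ := LinearMap.toContinuousLinearMap
    { toFun := fun u => p.A z ![u]
      map_add' := fun u w => (p.A z).vecCons_add ![] u w
      map_smul' := fun c u => (p.A z).vecCons_smul ![] c u }
  have ha : ∀ u, p.A z ![u] = a u := fun _ => rfl
  have hv : a (vv EP z) = 1 := p.A_vv z
  -- The differential G of a section is a right inverse of the projection; subtracting its vertical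
  -- component A ∘ G makes it horizontal.
  refine ⟨G - (a.comp G).smulRight (vv EP z), p.dp_vv z, p.A_vv z, fun b => ?_, fun b => ?_,
    fun u => ?_⟩
  · simp [hp, p.dp_vv]
  · rw [ha]
    simp [hv]
  · have h1 := hd u
    have h2 : dmap EP ℝ θ z u = a u - a (G (p.dp z u)) := by
      have := congrArg a h1
      rw [map_add, map_smul, hv, smul_eq_mul, mul_one] at this
      linarith
    rw [ha]
    nth_rewrite 1 [h1]
    rw [h2]
    simp only [sub_apply, ContinuousLinearMap.smulRight_apply,
      ContinuousLinearMap.comp_apply, sub_smul]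
    abel

/-- `hor` is chosen by its two properties, and the decomposition of tangent vectors shows that these
determine it. -/
theorem isSplitting (z : P) : IsSplitting (p.dp z) (p.A z) (vv EP z) (p.hr z) := by
  obtain ⟨L, hL⟩ := p.exists_splitting z
  have h : ∃ L : EX →L[ℝ] Tan EP P z, ∀ u, p.dproj z (L u) = u ∧ p.conn z ![L u] = 0 :=
    ⟨L, fun u => ⟨hL.proj_lift u, hL.conn_lift u⟩⟩
  have h1 : p.hor z = h.choose := by
    unfold hor
    rw [dif_pos h]
  have h2 : p.hr z = L := by
    ext u
    have h3 := h.choose_spec u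
    rw [← h1] at h3
    have h4 := hL.decomp (p.hr z u)
    have h5 : p.dp z (p.hr z u) = u := h3.1
    have h6 : p.A z ![p.hr z u] = 0 := h3.2
    rw [h5, h6, zero_smul, add_zero] at h4
    exact h4
  rw [h2]
  exact hL

/-- A tangent vector is determined by its projection and the value of the connection form. -/
theorem tangent_ext {z : P} {u w : EP} (h1 : p.dp z u = p.dp z w) (h2 : p.A z ![u] = p.A z ![w]) :
    u = w := by
  rw [(p.isSplitting z).decomp u, (p.isSplitting z).decomp w, h1, h2]

/-- Projection and connection form are invariant, and together they determine a tangent vector. -/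
theorem dact_hr (c : Circle) (z : P) : (dact EP c z).comp (p.hr z) = p.hr (c • z) := by
  ext u
  refine p.tangent_ext (z := c • z) ?_ ?_
  · have := congrArg (fun L : EP →L[ℝ] EX => L (p.hr z u)) (p.dp_dact c z)
    refine Eq.trans this ?_
    rw [(p.isSplitting z).proj_lift, (p.isSplitting (c • z)).proj_lift]
  · rw [(p.isSplitting (c • z)).conn_lift, ContinuousLinearMap.comp_apply]
    have h1 := congrArg (fun α : EP [⋀^Fin 1]→L[ℝ] ℝ => α ![p.hr z u]) (p.A_dact c z)
    have h2 := one_form_comp_apply (p.A (c • z)) (dact EP c z) (p.hr z u)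
    exact h2.symm.trans (h1.trans ((p.isSplitting z).conn_lift u))

/-- The connection form in terms of the angle relative to a local section. -/
theorem dangle {z : P} {g : X → P} {θ : P → ℝ}
    (hg : MDifferentiableAt 𝓘(ℝ, EX) 𝓘(ℝ, EP) g (p.proj z))
    (hθ : MDifferentiableAt 𝓘(ℝ, EP) 𝓘(ℝ, ℝ) θ z) (hz : g (p.proj z) = z) (h0 : θ z = 0)
    (h : ∀ᶠ y in 𝓝 z, rot (θ y) • g (p.proj y) = y) (u : EP) :
    dmap EP ℝ θ z u = p.A z ![u] - p.A z ![dmap EX EP g (p.proj z) (p.dp z u)] := by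
  have h1 := congrArg (fun w => p.A z ![w]) (p.decomp_section hg hθ hz h0 h u)
  have h2 : p.A z ![dmap EX EP g (p.proj z) (p.dp z u) + dmap EP ℝ θ z u • vv EP z] =
      p.A z ![dmap EX EP g (p.proj z) (p.dp z u)] + p.A z ![dmap EP ℝ θ z u • vv EP z] :=
    (p.A z).vecCons_add ![] _ _
  have h3 : p.A z ![dmap EP ℝ θ z u • vv EP z] = dmap EP ℝ θ z u • p.A z ![vv EP z] :=
    (p.A z).vecCons_smul ![] _ _
  rw [p.A_vv, smul_eq_mul, mul_one] at h3
  simp only [h2, h3] at h1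
  linarith

/-- The generator of the action is smooth. -/
theorem contDiffAt_vert (p : CircleBundle EX X EP P) (z : P) :
    ContDiffAt ℝ ∞ (vecRep (E := EP) (vert EP) z) (extChartAt 𝓘(ℝ, EP) z z) := by
  have hz := mem_extChartAt_source (I := 𝓘(ℝ, EP)) z
  have hl := (extChartAt 𝓘(ℝ, EP) z).left_inv hz
  have hG : ContMDiff (𝓘(ℝ, ℝ).prod 𝓘(ℝ, EP)) 𝓘(ℝ, EP) ∞ (fun q : ℝ × P => rot q.1 • q.2) :=
    p.smooth_action.comp ((contMDiff_rot.comp contMDiff_fst).prodMk contMDiff_snd)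
  -- The action in the chart at z. The generator in this chart is the derivative of Φ in its first
  -- variable at t = 0, which is smooth in y.
  let Φ : ℝ × EP → EP := fun q =>
    extChartAt 𝓘(ℝ, EP) z (rot q.1 • (extChartAt 𝓘(ℝ, EP) z).symm q.2)
  have h0 : rot 0 • z = z := by simp [rot]
  have hΦ : ContDiffAt ℝ ∞ Φ (0, extChartAt 𝓘(ℝ, EP) z z) := by
    have h1 : ContMDiffAt 𝓘(ℝ, ℝ × EP) 𝓘(ℝ, EP) ∞
        (fun q : ℝ × EP => (extChartAt 𝓘(ℝ, EP) z).symm q.2) (0, extChartAt 𝓘(ℝ, EP) z z) :=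
      ContMDiffAt.comp (g := (extChartAt 𝓘(ℝ, EP) z).symm) _
        ((contMDiffOn_extChartAt_symm (I := 𝓘(ℝ, EP)) (n := ∞) z).contMDiffAt
          (extChartAt_target_mem_nhds' (chart_mem_target hz))) contDiff_snd.contMDiff.contMDiffAt
    have h2 : ContMDiffAt 𝓘(ℝ, ℝ × EP) 𝓘(ℝ, EP) ∞
        (fun q : ℝ × EP => rot q.1 • (extChartAt 𝓘(ℝ, EP) z).symm q.2)
        (0, extChartAt 𝓘(ℝ, EP) z z) :=
      hG.contMDiffAt.comp (f := fun q : ℝ × EP => (q.1, (extChartAt 𝓘(ℝ, EP) z).symm q.2)) _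
        (contDiff_fst.contMDiff.contMDiffAt.prodMk h1)
    have h3 : ContMDiffAt 𝓘(ℝ, ℝ × EP) 𝓘(ℝ, EP) ∞ Φ (0, extChartAt 𝓘(ℝ, EP) z z) :=
      ContMDiffAt.comp (g := extChartAt 𝓘(ℝ, EP) z) _ (by
        refine contMDiffAt_extChartAt' ?_
        simp only [hl, h0]
        exact mem_chart_source EP z) h2
    exact contMDiffAt_iff_contDiffAt.mp h3
  have h4 : ContDiffAt ℝ ∞ (fun y => fderiv ℝ Φ (0, y) (1, 0)) (extChartAt 𝓘(ℝ, EP) z z) := by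
    have h5 : ContDiffAt ℝ ∞ (fderiv ℝ Φ) (0, extChartAt 𝓘(ℝ, EP) z z) := hΦ.fderiv_right (by simp)
    exact (h5.comp (extChartAt 𝓘(ℝ, EP) z z)
      (contDiff_const.prodMk contDiff_id).contDiffAt).clm_apply contDiffAt_const
  refine h4.congr_of_eventuallyEq ?_
  have hd : ∀ᶠ y in 𝓝 (extChartAt 𝓘(ℝ, EP) z z), DifferentiableAt ℝ Φ (0, y) := by
    have h1 : ∀ᶠ q in 𝓝 ((0 : ℝ), extChartAt 𝓘(ℝ, EP) z z), DifferentiableAt ℝ Φ q := by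
      have h6 : ContDiffAt ℝ 1 Φ (0, extChartAt 𝓘(ℝ, EP) z z) := hΦ.of_le (by exact_mod_cast le_top)
      filter_upwards [h6.eventually (by simp)] with q hq using hq.differentiableAt one_ne_zero
    exact (Continuous.prodMk continuous_const continuous_id).continuousAt.eventually h1
  filter_upwards [hd, extChartAt_target_mem_nhds (I := 𝓘(ℝ, EP)) z] with y h1 h2
  have hs : (extChartAt 𝓘(ℝ, EP) z).symm y ∈ (extChartAt 𝓘(ℝ, EP) z).source :=
    (extChartAt 𝓘(ℝ, EP) z).map_target h2
  set w := (extChartAt 𝓘(ℝ, EP) z).symm y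
  have hw : rot 0 • w = w := by simp [rot]
  have h5 : fderiv ℝ Φ (0, y) (1, 0) = fderiv ℝ (fun t : ℝ => Φ (t, y)) 0 1 := by
    have h6 := HasFDerivAt.comp (f := fun t : ℝ => (t, y)) (0 : ℝ) h1.hasFDerivAt ((hasFDerivAt_id (0 : ℝ)).prodMk (hasFDerivAt_const y _))
    have h7 := h6.fderiv
    exact (congrArg (fun L : ℝ →L[ℝ] EP => L 1) h7).symm
  rw [h5]
  have h6 := dmap_comp (g := extChartAt 𝓘(ℝ, EP) z) (f := fun t : ℝ => rot t • w) (0 : ℝ)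
    (mdiffAt_chart (by rw [hw]; exact hs)) ((p.smooth_rot w).mdifferentiableAt (by simp))
  rw [hw] at h6
  have h7 : dmap ℝ EP (fun t : ℝ => extChartAt 𝓘(ℝ, EP) z (rot t • w)) 0 =
      fderiv ℝ (fun t : ℝ => Φ (t, y)) 0 := mfderiv_eq_fderiv
  rw [← h7, h6]
  rfl

end CircleBundle

end ExoticHori

namespace ExoticHori

open Filter Topology

/-! ### Weights, horizontal and vertical parts, and fibre integration as evaluation. -/

section FormAt

variable {E : Type*} [NormedAddCommGroup E] [NormedSpace ℝ E]
  {M : Type*} [TopologicalSpace M] [ChartedSpace E M]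
  {F : Type*} [AddCommGroup F] [Module ℝ F] [TopologicalSpace F]

/-- The value of a form of mixed degree at a point. -/
def formAt (η : GForm E M F) (z : M) : GAlt E F := fun k => η k z

theorem gform_ext {η ζ : GForm E M F} (h : ∀ z, formAt η z = formAt ζ z) : η = ζ := by
  funext k z
  exact congrFun (h z) k

end FormAt

namespace CircleBundle

section One

variable {EX : Type*} [NormedAddCommGroup EX] [NormedSpace ℝ EX] [FiniteDimensional ℝ EX]
  {X : Type*} [TopologicalSpace X] [ChartedSpace EX X] [IsManifold 𝓘(ℝ, EX) ∞ X]
  {EP : Type*} [NormedAddCommGroup EP] [NormedSpace ℝ EP] [FiniteDimensional ℝ EP]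
  {P : Type*} [TopologicalSpace P] [ChartedSpace EP P] [IsManifold 𝓘(ℝ, EP) ∞ P]
  [MulAction Circle P]
  (p : CircleBundle EX X EP P)

variable (EP) in
/-- The form `η` scales with the power `n` under the action of the circle. -/
def IsWeight (n : ℤ) (η : GForm EP P ℂ) : Prop :=
  ∀ (c : Circle) (z : P), gcomp (dact EP c z) (formAt η (c • z)) = (c : ℂ) ^ n • formAt η z

theorem hasDerivAt_exp_mul (a : ℂ) (t : ℝ) :
    HasDerivAt (fun t : ℝ => Complex.exp (a * t)) (a * Complex.exp (a * t)) t := by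
  have h1 : HasDerivAt (fun t : ℝ => a * (t : ℂ)) a t := by
    simpa using (Complex.ofRealCLM.hasDerivAt (x := t)).const_mul a
  simpa [mul_comm] using h1.cexp

theorem eq_exp_mul_of_hasDerivAt {a : ℂ} {f : ℝ → ℂ} (h : ∀ t, HasDerivAt f (a * f t) t) (t : ℝ) :
    f t = Complex.exp (a * t) * f 0 := by
  have h1 : ∀ s : ℝ, HasDerivAt (fun s : ℝ => Complex.exp (-a * s) * f s) 0 s := fun s => by
    have := (hasDerivAt_exp_mul (-a) s).mul (h s)
    refine this.congr_deriv ?_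
    ring
  have h2 := is_const_of_deriv_eq_zero (fun s => (h1 s).differentiableAt)
    (fun s => (h1 s).deriv) t 0
  simp only [Complex.ofReal_zero, mul_zero, Complex.exp_zero, one_mul] at h2
  rw [← h2, ← mul_assoc, ← Complex.exp_add]
  simp

/-- The condition at t = 0, imposed at all points of an orbit, becomes by the group law the
differential equation f' = 2πi n f along the orbit. Its solutions are exponentials, and every
element of the circle is some `rot t`. -/
theorem mem_weightForms_iff (p : CircleBundle EX X EP P) (n : ℤ) (η : GForm EP P ℂ) :
    η ∈ weightForms EP P n ↔ (∀ k x, SmoothFormAt (η k) x) ∧ IsWeight EP n η := by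
  refine and_congr_right fun _ => ⟨fun h => ?_, fun h => ?_⟩
  · intro c z
    obtain ⟨t, rfl⟩ := exists_rot c
    funext k
    ext u
    have key : ∀ t : ℝ, HasDerivAt (fun t : ℝ => pull (fun y : P => rot t • y) (η k) z u)
        (2 * Real.pi * Complex.I * n * pull (fun y : P => rot t • y) (η k) z u) t := by
      intro t
      have h1 := h k (rot t • z) (fun i => dact EP (rot t) z (u i))
      -- Pulling back by `rot s` at z is pulling back by `rot (s - t)` at `rot t • z`, which moves
      -- the derivative from time t to time 0.
      have h2 : (fun s : ℝ => pull (fun y : P => rot s • y) (η k) z u) = fun s : ℝ =>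
          pull (fun y : P => rot (s - t) • y) (η k) (rot t • z)
            (fun i => dact EP (rot t) z (u i)) := by
        funext s
        have h3 : rot s = rot (s - t) * rot t := by rw [← rot_add, sub_add_cancel]
        have h4 := p.dact_mul (rot (s - t)) (rot t) z
        have h5 : rot s • z = rot (s - t) • rot t • z := by rw [h3, mul_smul]
        have h6 := form_congr (η k) h5
        rw [← h3] at h4
        have h7 : (fun i => dact EP (rot s) z (u i)) =
            fun i => dact EP (rot (s - t)) (rot t • z) (dact EP (rot t) z (u i)) := by
          rw [h4]; rfl
        exact (congrArg (fun α : EP [⋀^Fin k]→L[ℝ] ℂ => α (fun i => dact EP (rot s) z (u i)))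
          h6).trans (congrArg (fun w : Fin k → EP =>
            (η k (rot (s - t) • rot t • z) : EP [⋀^Fin k]→L[ℝ] ℂ) w) h7)
      have h1' : HasDerivAt (fun t_1 : ℝ => pull (fun y : P => rot t_1 • y) (η k) (rot t • z)
          (fun i => dact EP (rot t) z (u i)))
          (2 * Real.pi * Complex.I * n * η k (rot t • z) (fun i => dact EP (rot t) z (u i)))
          (t - t) := by
        rw [sub_self]; exact h1
      rw [h2]
      exact (h1'.comp_sub_const t t).congr_deriv rfl
    have h1 := eq_exp_mul_of_hasDerivAt key t
    refine Eq.trans h1 ?_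
    rw [rot_zero, ← rot_zpow]
    have h2 : pull (fun y : P => (1 : Circle) • y) (η k) = η k := by
      simp only [one_smul]
      exact pull_id (η k)
    rw [h2]
    rfl
  · intro k z u
    have h1 : (fun t : ℝ => pull (fun y : P => rot t • y) (η k) z u) =
        fun t : ℝ => Complex.exp (2 * Real.pi * Complex.I * n * t) * η k z u := by
      funext t
      have := congrArg (fun α : GAlt EP ℂ => α k u) (h (rot t) z)
      refine Eq.trans this ?_
      rw [rot_zpow]
      rfl
    rw [h1]
    refine ((hasDerivAt_exp_mul _ 0).mul_const _).congr_deriv ?_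
    simp

/-- The horizontal part of a form. -/
noncomputable def hpart {F : Type*} [AddCommGroup F] [Module ℝ F] [TopologicalSpace F]
    (z : P) (η : GAlt EP F) : GAlt EX F := gcomp (p.hr z) η

/-- The contraction of a form with the generator of the action, as a form on the base. -/
noncomputable def vpart {F : Type*} [AddCommGroup F] [Module ℝ F] [TopologicalSpace F]
    (z : P) (η : GAlt EP F) : GAlt EX F := gcomp (p.hr z) (gcontract (vv EP z) η)

/-- Horizontal lifts are equivariant, so the components, being forms on the base, can be compared
along a fibre. -/
theorem hpart_dact (c : Circle) (z : P) (η : GAlt EP ℂ) :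
    p.hpart z (gcomp (dact EP c z) η) = p.hpart (c • z) η := by
  rw [hpart, hpart, gcomp_gcomp, dact_hr]

theorem vpart_dact (c : Circle) (z : P) (η : GAlt EP ℂ) :
    p.vpart z (gcomp (dact EP c z) η) = p.vpart (c • z) η := by
  rw [vpart, vpart, gcontract_gcomp, gcomp_gcomp, dact_hr, p.dact_vv]

theorem hpart_smul (c : ℂ) (z : P) (η : GAlt EP ℂ) : p.hpart z (c • η) = c • p.hpart z η := rfl

theorem vpart_smul (c : ℂ) (z : P) (η : GAlt EP ℂ) : p.vpart z (c • η) = c • p.vpart z η := rfl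

/-- The form `p^* a + A ∧ p^* b` at `z`. -/
noncomputable def asm (z : P) (a b : GAlt EX ℂ) : GAlt EP ℂ := assemble (p.dp z) (p.A z) a b

theorem hpart_asm (z : P) (a b : GAlt EX ℂ) : p.hpart z (p.asm z a b) = a :=
  (p.isSplitting z).hpart_assemble a b

theorem vpart_asm (z : P) (a b : GAlt EX ℂ) : p.vpart z (p.asm z a b) = b :=
  (p.isSplitting z).vpart_assemble a b

theorem asm_parts (z : P) (η : GAlt EP ℂ) : p.asm z (p.hpart z η) (p.vpart z η) = η :=
  (p.isSplitting z).assemble_parts η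

theorem asm_smul (c : ℂ) (z : P) (a b : GAlt EX ℂ) :
    p.asm z (c • a) (c • b) = c • p.asm z a b := assemble_smul _ _ c a b

theorem asm_smul_neg (c : ℂ) (z : P) (a b : GAlt EX ℂ) :
    p.asm z (c • a) (-(c • b)) = c • p.asm z a (-b) := by
  have h : -(c • b) = c • -b := by
    funext k
    ext u
    exact (smul_neg c (b k u)).symm
  rw [h, asm_smul]

theorem asm_dact (c : Circle) (z : P) (a b : GAlt EX ℂ) :
    gcomp (dact EP c z) (p.asm (c • z) a b) = p.asm z a b := by
  rw [← p.asm_parts z (gcomp (dact EP c z) (p.asm (c • z) a b)), hpart_dact, vpart_dact, hpart_asm,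
    vpart_asm]

end One

section Two

variable {EX : Type*} [NormedAddCommGroup EX] [NormedSpace ℝ EX] [FiniteDimensional ℝ EX]
  {X : Type*} [TopologicalSpace X] [ChartedSpace EX X] [IsManifold 𝓘(ℝ, EX) ∞ X]
  {EP : Type*} [NormedAddCommGroup EP] [NormedSpace ℝ EP] [FiniteDimensional ℝ EP]
  {P : Type*} [TopologicalSpace P] [ChartedSpace EP P] [IsManifold 𝓘(ℝ, EP) ∞ P]
  [MulAction Circle P]
  {EQ : Type*} [NormedAddCommGroup EQ] [NormedSpace ℝ EQ] [FiniteDimensional ℝ EQ]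
  {Q : Type*} [TopologicalSpace Q] [ChartedSpace EQ Q] [IsManifold 𝓘(ℝ, EQ) ∞ Q]
  [MulAction Circle Q]
  (p : CircleBundle EX X EP P) (q : CircleBundle EX X EQ Q)

theorem exists_corrLift (a : Corr p q) :
    ∃ L : Tan EQ Q a.1.2 →L[ℝ] corrTan p q a, ∀ u, dsnd p q a (L u) = u := by
  -- The lift of u is (horizontal lift of the projection of u, u).
  refine ⟨ContinuousLinearMap.codRestrict
    (((p.hor a.1.1).comp (q.dproj a.1.2)).prod (ContinuousLinearMap.id ℝ _)) (corrTan p q a)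
    (fun u => ?_), fun u => rfl⟩
  have h : p.dproj a.1.1 (p.hor a.1.1 (q.dproj a.1.2 u)) = q.dproj a.1.2 u :=
    (p.isSplitting a.1.1).proj_lift _
  exact LinearMap.mem_ker.mpr (sub_eq_zero.mpr h)

theorem dsnd_corrLift (a : Corr p q) (u : Tan EQ Q a.1.2) :
    dsnd p q a (corrLift p q a u) = u := by
  have h := exists_corrLift p q a
  rw [corrLift, dif_pos h]
  exact h.choose_spec u

/-- The family ζ may depend on both points of the pair: τ_n uses a form on `P` only, but for σ̂_n
the coefficient depends on the other point too. -/
theorem fibIntegrand_formula (a : Corr p q) (ζ : Corr p q → GAlt EP ℂ) :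
    fibIntegrand p q (fun a => expWedge (-connWedge p q a)
        (fun k => ((ζ a k : EP [⋀^Fin k]→L[ℝ] ℂ) :
          Tan EP P a.1.1 [⋀^Fin k]→L[ℝ] ℂ).compContinuousLinearMap (dfst p q a))) a =
      q.asm a.1.2 (p.vpart a.1.1 (ζ a)) (-p.hpart a.1.1 (ζ a)) :=
  IsSplitting.gcomp_gcontract_expWedge (p.isSplitting a.1.1) (π' := q.dp a.1.2) (q.A a.1.2)
    (P₁ := dfst p q a) (P₂ := dsnd p q a) (c := corrVert p q a)
    (fun u => sub_eq_zero.mp (LinearMap.mem_ker.mp u.2)) rfl rfl (L := corrLift p q a)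
    (dsnd_corrLift p q a) rfl (ζ a)

/-- Weight -n of ζ along the fibre is cancelled by the factor (rot t)^n. The integrand is therefore
constant, and the fibre has length 1. -/
theorem fibInt_formula (n : ℤ) (a : Corr p q) (ζ : Corr p q → GAlt EP ℂ)
    (hζ : ∀ c : Circle, gcomp (dact EP c a.1.1)
      (ζ ⟨(c • a.1.1, a.1.2), (p.proj_smul _ _).trans a.2⟩) = (c : ℂ) ^ (-n) • ζ a) :
    fibInt p q n (fun a => expWedge (-connWedge p q a)
        (fun k => ((ζ a k : EP [⋀^Fin k]→L[ℝ] ℂ) :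
          Tan EP P a.1.1 [⋀^Fin k]→L[ℝ] ℂ).compContinuousLinearMap (dfst p q a))) a =
      q.asm a.1.2 (p.vpart a.1.1 (ζ a)) (-p.hpart a.1.1 (ζ a)) := by
  funext k
  have key : ∀ t : ℝ, ((rot t : ℂ) ^ n • fibIntegrand p q (fun a => expWedge (-connWedge p q a)
        (fun k => ((ζ a k : EP [⋀^Fin k]→L[ℝ] ℂ) :
          Tan EP P a.1.1 [⋀^Fin k]→L[ℝ] ℂ).compContinuousLinearMap (dfst p q a)))
        ⟨(rot t • a.1.1, a.1.2), (p.proj_smul _ _).trans a.2⟩ k : EQ [⋀^Fin k]→L[ℝ] ℂ) =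
      q.asm a.1.2 (p.vpart a.1.1 (ζ a)) (-p.hpart a.1.1 (ζ a)) k := by
    intro t
    have h1 := fibIntegrand_formula p q
      ⟨(rot t • a.1.1, a.1.2), (p.proj_smul _ _).trans a.2⟩ ζ
    refine Eq.trans (congrArg (fun α : GAlt EQ ℂ => (rot t : ℂ) ^ n • α k) h1) ?_
    have h2 := hζ (rot t)
    have h3 := p.vpart_dact (rot t) a.1.1
      (ζ ⟨(rot t • a.1.1, a.1.2), (p.proj_smul _ _).trans a.2⟩)
    have h4 := p.hpart_dact (rot t) a.1.1
      (ζ ⟨(rot t • a.1.1, a.1.2), (p.proj_smul _ _).trans a.2⟩)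
    rw [h2, vpart_smul] at h3
    rw [h2, hpart_smul] at h4
    simp only
    rw [← h3, ← h4]
    have h5 : (rot t : ℂ) ^ n * (rot t : ℂ) ^ (-n) = 1 := by
      rw [← zpow_add₀ (Circle.coe_ne_zero _)]; simp
    have h6 := q.asm_smul_neg ((rot t : ℂ) ^ (-n)) a.1.2 (p.vpart a.1.1 (ζ a)) (p.hpart a.1.1 (ζ a))
    refine (congrArg (fun α : GAlt EQ ℂ => (rot t : ℂ) ^ n • α k) h6).trans ?_
    change (rot t : ℂ) ^ n • (rot t : ℂ) ^ (-n) • (_ : EQ [⋀^Fin k]→L[ℝ] ℂ) = _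
    rw [smul_smul, h5, one_smul]
  have h6 : (∫ _t in (0 : ℝ)..1, (q.asm a.1.2 (p.vpart a.1.1 (ζ a)) (-p.hpart a.1.1 (ζ a)) k)) =
      q.asm a.1.2 (p.vpart a.1.1 (ζ a)) (-p.hpart a.1.1 (ζ a)) k := by
    rw [intervalIntegral.integral_const]
    simp
  refine Eq.trans ?_ h6
  rw [fibInt]
  exact congrArg (fun g : ℝ → EQ [⋀^Fin k]→L[ℝ] ℂ => ∫ t in (0 : ℝ)..1, g t) (funext key)

/-- The coefficient at `w` of a form with values in the pullback of the line bundle, with respect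
to the basis vector given by `z`. -/
noncomputable def coeffAt (ψ : GForm EQ Q (P → ℂ)) (w : Q) (z : P) : GAlt EQ ℂ := fun k =>
  (ContinuousLinearMap.proj (R := ℝ) (φ := fun _ : P => ℂ)
    z).compContinuousAlternatingMap (ψ k w)

theorem coeffAt_ext {ψ χ : GForm EQ Q (P → ℂ)} (h : ∀ w z, coeffAt ψ w z = coeffAt χ w z) :
    ψ = χ := by
  funext k w
  ext u z
  exact congrArg (fun α : GAlt EQ ℂ => α k u) (h w z)

/-- The quarter turn (a, b) ↦ (b, -a) in coordinates. From here on the integral defining τ_n is no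
longer used. -/
theorem coeffAt_tau {n : ℤ} {η : GForm EP P ℂ} (hη : IsWeight EP (-n) η) {z : P} {w : Q}
    (h : p.proj z = q.proj w) :
    coeffAt (tau p q n η) w z =
      q.asm w (p.vpart z (formAt η z)) (-p.hpart z (formAt η z)) := by
  rw [← fibInt_formula p q n ⟨(z, w), h⟩ (fun a => formAt η a.1.1) (fun c => hη c z)]
  funext k
  ext u
  exact congrArg (fun α : EQ [⋀^Fin k]→L[ℝ] ℂ => α u) (dif_pos h)

theorem coeffAt_tau_of_ne {n : ℤ} (η : GForm EP P ℂ) {z : P} {w : Q}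
    (h : p.proj z ≠ q.proj w) : coeffAt (tau p q n η) w z = 0 := by
  funext k
  ext u
  exact congrArg (fun α : EQ [⋀^Fin k]→L[ℝ] ℂ => α u) (dif_neg h)

/-- The second quarter turn, with n = 0 in the integral since a fixed coefficient is invariant under
the circle acting on `Q`. By this invariance any point w of the fibre may replace the chosen one. -/
theorem formAt_sigmaInv {ψ : GForm EQ Q (P → ℂ)}
    (hψ : ∀ (c : Circle) (k : ℕ), pull (fun y : Q => c • y) (ψ k) = ψ k) {z : P} {w : Q}
    (h : p.proj z = q.proj w) :
    formAt (sigmaInv p q ψ) z =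
      p.asm z (q.vpart w (coeffAt ψ w z)) (-q.hpart w (coeffAt ψ w z)) := by
  have h1 : ∀ (c : Circle) (w : Q), gcomp (dact EQ c w) (coeffAt ψ (c • w) z) = coeffAt ψ w z := by
    intro c w
    funext k
    ext u
    exact congrArg (fun α : DForm EQ Q k (P → ℂ) => (α w : EQ [⋀^Fin k]→L[ℝ] (P → ℂ)) u z) (hψ c k)
  have h0 : q.proj (q.pt (p.proj z)) = p.proj z := Function.surjInv_eq _ _
  obtain ⟨c, rfl⟩ := q.smul_of_proj_eq (h0.trans h)
  rw [← q.vpart_dact, ← q.hpart_dact, h1]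
  have h2 := fibInt_formula q p 0 ⟨(q.pt (p.proj z), z), h0⟩ (fun a => coeffAt ψ a.1.1 a.1.2)
    (fun c => by simpa using h1 c _)
  exact h2

end Two

end CircleBundle

end ExoticHori

namespace ExoticHori

open Filter Topology

/-! ### Smooth families: coordinates of forms along local sections. -/

section PostComp

variable {V : Type*} [AddCommGroup V] [Module ℝ V] [TopologicalSpace V]
  {F : Type*} [AddCommGroup F] [Module ℝ F] [TopologicalSpace F] [IsTopologicalAddGroup F]
  [ContinuousSMul ℝ F]
  {F' : Type*} [AddCommGroup F'] [Module ℝ F'] [TopologicalSpace F'] [IsTopologicalAddGroup F']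
  [ContinuousSMul ℝ F']

/-- Apply a linear map to the values of a form of mixed degree. -/
def gpost (L : F →L[ℝ] F') (η : GAlt V F) : GAlt V F' := fun k =>
  L.compContinuousAlternatingMap (η k)

theorem wedge_post {k l m : ℕ} (h : k + l = m) (L : F →L[ℝ] F') (α : V [⋀^Fin k]→L[ℝ] ℝ)
    (β : V [⋀^Fin l]→L[ℝ] F) :
    L.compContinuousAlternatingMap (wedge h α β) =
      wedge h α (L.compContinuousAlternatingMap β) := by
  ext u
  simp only [wedge_apply, ContinuousLinearMap.compContinuousAlternatingMap_coe,
    Function.comp_apply, map_smul, map_sum]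
  simp

/-- Used with evaluation at a point of `P`, which turns operations on line bundle valued forms into
operations on their coefficients. -/
theorem gpost_gwedge (L : F →L[ℝ] F') {r : ℕ} (α : V [⋀^Fin r]→L[ℝ] ℝ) (η : GAlt V F) :
    gpost L (gwedge α η) = gwedge α (gpost L η) := by
  funext m
  rcases lt_or_ge m r with h | h
  · rw [gpost, gwedge_of_lt h, gwedge_of_lt h]
    ext u
    simp
  · rw [gpost, gwedge_eq (Nat.add_sub_of_le h), gwedge_eq (Nat.add_sub_of_le h), wedge_post]
    rfl

end PostComp

section Forms

variable {E : Type*} [NormedAddCommGroup E] [NormedSpace ℝ E] [FiniteDimensional ℝ E]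
  {M : Type*} [TopologicalSpace M] [ChartedSpace E M] [IsManifold 𝓘(ℝ, E) ∞ M]
  {E' : Type*} [NormedAddCommGroup E'] [NormedSpace ℝ E'] [FiniteDimensional ℝ E']
  {M' : Type*} [TopologicalSpace M'] [ChartedSpace E' M'] [IsManifold 𝓘(ℝ, E') ∞ M']
  {F : Type*} [NormedAddCommGroup F] [NormedSpace ℝ F] [FiniteDimensional ℝ F]

/-- The pullback of a form of mixed degree. -/
noncomputable def gpull (f : M → M') (η : GForm E' M' F) : GForm E M F := fun k => pull f (η k)

theorem smoothFormAt_gfwedge {r : ℕ} {α : DForm E M r ℝ} {η : GForm E M F} {x : M}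
    (hα : SmoothFormAt α x) (hη : ∀ k, SmoothFormAt (η k) x) (m : ℕ) :
    SmoothFormAt (gfwedge α η m) x := by
  rcases lt_or_ge m r with h | h
  · have : gfwedge α η m = 0 := by
      funext y
      exact gwedge_of_lt h _ _
    rw [this]
    exact smoothFormAt_zero
  · have : gfwedge α η m = fwedge (Nat.add_sub_of_le h) α (η (m - r)) := by
      funext y
      exact gwedge_eq (Nat.add_sub_of_le h) _ _
    rw [this]
    exact hα.fwedge _ (hη _)

end Forms

namespace CircleBundle

section One

variable {EX : Type*} [NormedAddCommGroup EX] [NormedSpace ℝ EX] [FiniteDimensional ℝ EX]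
  {X : Type*} [TopologicalSpace X] [ChartedSpace EX X] [IsManifold 𝓘(ℝ, EX) ∞ X]
  {EP : Type*} [NormedAddCommGroup EP] [NormedSpace ℝ EP] [FiniteDimensional ℝ EP]
  {P : Type*} [TopologicalSpace P] [ChartedSpace EP P] [IsManifold 𝓘(ℝ, EP) ∞ P]
  [MulAction Circle P]
  (p : CircleBundle EX X EP P)

/-- The form `p^* a + A ∧ p^* b`. -/
noncomputable def fasm (a b : GForm EX X ℂ) : GForm EP P ℂ :=
  gpull p.proj a + gfwedge p.conn (gpull p.proj b)

theorem formAt_fasm (a b : GForm EX X ℂ) (z : P) :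
    formAt (p.fasm a b) z = p.asm z (formAt a (p.proj z)) (formAt b (p.proj z)) := rfl

theorem smoothFormAt_fasm {a b : GForm EX X ℂ} {z : P} (ha : ∀ k, SmoothFormAt (a k) (p.proj z))
    (hb : ∀ k, SmoothFormAt (b k) (p.proj z)) (k : ℕ) : SmoothFormAt (p.fasm a b k) z :=
  ((ha k).pull p.smooth_proj.contMDiffAt).add
    (smoothFormAt_gfwedge (p.conn_smooth z) (fun k => (hb k).pull p.smooth_proj.contMDiffAt) k)

/-- The horizontal part of a form along a local section, as a form on the base. -/
noncomputable def secH (s : X → P) (η : GForm EP P ℂ) : GForm EX X ℂ :=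
  gpull s (η - gfwedge p.conn (ginter (vert EP) η))

/-- The contraction of a form with the generator of the action along a local section. -/
noncomputable def secV (s : X → P) (η : GForm EP P ℂ) : GForm EX X ℂ :=
  gpull s (ginter (vert EP) η)

/-- A smooth local section near `x`. -/
structure IsLocalSection (s : X → P) (x : X) : Prop where
  smooth : ContMDiffAt 𝓘(ℝ, EX) 𝓘(ℝ, EP) ∞ s x
  proj_eq : ∀ᶠ y in 𝓝 x, p.proj (s y) = y

variable {p}

theorem IsLocalSection.dp_comp {s : X → P} {x : X} (hs : p.IsLocalSection s x) :
    (p.dp (s x)).comp (dmap EX EP s x) = ContinuousLinearMap.id ℝ EX := by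
  have h := dmap_comp (g := p.proj) x (p.mdiff_proj _) (hs.smooth.mdifferentiableAt (by simp))
  rw [dp, ← h, ← dmap_id x]
  exact dmap_congr hs.proj_eq

/-- The differential of a section and the horizontal lift differ by vertical vectors, which such a
form does not see. So the pointwise coordinates along s are pullbacks by s of smooth forms, and
smoothness of the chosen `hor` is never needed. -/
theorem IsLocalSection.gcomp_horizontal {s : X → P} {x : X} (hs : p.IsLocalSection s x)
    {ζ : GAlt EP ℂ} (hζ : gcontract (vv EP (s x)) ζ = 0) :
    gcomp (dmap EX EP s x) ζ = p.hpart (s x) ζ := by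
  rw [← (p.isSplitting (s x)).gcomp_eq_of_horizontal hζ, gcomp_gcomp, hs.dp_comp, gcomp_id,
    hpart, (p.isSplitting (s x)).gcomp_lift_proj]

theorem IsLocalSection.formAt_secV {s : X → P} {x : X} (hs : p.IsLocalSection s x)
    (η : GForm EP P ℂ) : formAt (E := EX) (secV s η) x = p.vpart (s x) (formAt η (s x)) := by
  have e : formAt (E := EX) (secV s η) x =
    gcomp (dmap EX EP s x) (gcontract (vv EP (s x)) (formAt η (s x))) := rfl
  rw [e, hs.gcomp_horizontal (gcontract_self _ _)]
  rfl

theorem IsLocalSection.formAt_secH {s : X → P} {x : X} (hs : p.IsLocalSection s x)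
    (η : GForm EP P ℂ) : formAt (p.secH s η) x = p.hpart (s x) (formAt η (s x)) := by
  have h0 := p.A_vv (s x)
  have e : formAt (p.secH s η) x = gcomp (dmap EX EP s x) (formAt η (s x) -
    gwedge (p.A (s x)) (gcontract (vv EP (s x)) (formAt η (s x)))) := rfl
  rw [e, hs.gcomp_horizontal, hpart, hpart, gcomp_sub, gwedge_comp,
    (p.isSplitting (s x)).conn_comp_lift, gwedge_zero_left, sub_zero]
  rw [gcontract_sub, gcontract_gwedge_one, h0, gcontract_self, gwedge_zero]
  simp

theorem smoothFormAt_ginter_vert (p : CircleBundle EX X EP P) {η : GForm EP P ℂ} {z : P}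
    (hη : ∀ k, SmoothFormAt (η k) z) (k : ℕ) : SmoothFormAt (ginter (vert EP) η k) z :=
  (hη (k + 1)).inter (p.contDiffAt_vert z)

theorem smoothFormAt_secV {s : X → P} {x : X}
    (hs : ContMDiffAt 𝓘(ℝ, EX) 𝓘(ℝ, EP) ∞ s x) (p : CircleBundle EX X EP P) {η : GForm EP P ℂ}
    (hη : ∀ k, SmoothFormAt (η k) (s x)) (k : ℕ) :
    SmoothFormAt (secV s η k : DForm EX X k ℂ) x :=
  SmoothFormAt.pull (f := s) (η := ginter (vert EP) η k) (p.smoothFormAt_ginter_vert hη k) hs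

theorem smoothFormAt_secH {s : X → P} {x : X}
    (hs : ContMDiffAt 𝓘(ℝ, EX) 𝓘(ℝ, EP) ∞ s x) {η : GForm EP P ℂ}
    (hη : ∀ k, SmoothFormAt (η k) (s x)) (k : ℕ) : SmoothFormAt (p.secH s η k) x :=
  SmoothFormAt.pull ((hη k).sub (smoothFormAt_gfwedge (p.conn_smooth (s x))
    (p.smoothFormAt_ginter_vert hη) k)) hs

variable (p)

theorem isLocalSection_of_isOpen {U : Set X} {s : X → P} (hU : IsOpen U)
    (hs : ContMDiffOn 𝓘(ℝ, EX) 𝓘(ℝ, EP) ∞ s U) (hps : ∀ x ∈ U, p.proj (s x) = x) {x : X}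
    (hx : x ∈ U) : p.IsLocalSection s x :=
  ⟨hs.contMDiffAt (hU.mem_nhds hx), by filter_upwards [hU.mem_nhds hx] using hps⟩

theorem IsWeight.add {n : ℤ} {η ζ : GForm EP P ℂ} (h1 : IsWeight EP n η) (h2 : IsWeight EP n ζ) :
    IsWeight EP n (η + ζ) := fun c z => by
  have e : ∀ z, formAt (η + ζ) z = formAt η z + formAt ζ z := fun _ => rfl
  rw [e, e, gcomp_add, h1, h2, smul_add]

theorem IsWeight.smul {n : ℤ} {η : GForm EP P ℂ} (h1 : IsWeight EP n η) (a : ℂ) :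
    IsWeight EP n (a • η) := fun c z => by
  have e : ∀ z, formAt (a • η) z = a • formAt η z := fun _ => rfl
  rw [e, e, gcomp_smul, h1, smul_comm]

/-- A form of weight `n` near a point. -/
theorem IsWeight.formAt_smul {n : ℤ} {η : GForm EP P ℂ} (h : IsWeight EP n η) (c : Circle) (z : P) :
    formAt η (c • z) = (c : ℂ) ^ n •
      p.asm (c • z) (p.hpart z (formAt η z)) (p.vpart z (formAt η z)) := by
  rw [← p.asm_parts (c • z) (formAt η (c • z)), ← p.hpart_dact, ← p.vpart_dact, h c z, hpart_smul,
    vpart_smul, asm_smul]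

end One

end CircleBundle

end ExoticHori

namespace ExoticHori

open Filter Topology

/-! ### The bijections τ_n and σ̂_n. -/

namespace CircleBundle

variable {EX : Type*} [NormedAddCommGroup EX] [NormedSpace ℝ EX] [FiniteDimensional ℝ EX]
  {X : Type*} [TopologicalSpace X] [ChartedSpace EX X] [IsManifold 𝓘(ℝ, EX) ∞ X]
  {EP : Type*} [NormedAddCommGroup EP] [NormedSpace ℝ EP] [FiniteDimensional ℝ EP]
  {P : Type*} [TopologicalSpace P] [ChartedSpace EP P] [IsManifold 𝓘(ℝ, EP) ∞ P]
  [MulAction Circle P]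
  {EQ : Type*} [NormedAddCommGroup EQ] [NormedSpace ℝ EQ] [FiniteDimensional ℝ EQ]
  {Q : Type*} [TopologicalSpace Q] [ChartedSpace EQ Q] [IsManifold 𝓘(ℝ, EQ) ∞ Q]
  [MulAction Circle Q]
  (p : CircleBundle EX X EP P) (q : CircleBundle EX X EQ Q)

theorem formAt_coeff (s : X → P) (ψ : GForm EQ Q (P → ℂ)) (w : Q) :
    formAt (E := EQ) (fun k => coeff q s (ψ k)) w = coeffAt ψ w (s (q.proj w)) := rfl

variable {p q} in
theorem coeffAt_smul {n : ℤ} {ψ : GForm EQ Q (P → ℂ)}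
    (hψ : ∀ k w u, ψ k w u ∈ p.line n (q.proj w)) (c : Circle) (w : Q) (z : P) :
    coeffAt ψ w (c • z) = (c : ℂ) ^ (-n) • coeffAt ψ w z := by
  funext k
  ext u
  exact (hψ k w u).2 c z

variable {p q} in
theorem coeffAt_of_ne {n : ℤ} {ψ : GForm EQ Q (P → ℂ)}
    (hψ : ∀ k w u, ψ k w u ∈ p.line n (q.proj w)) {w : Q} {z : P} (h : p.proj z ≠ q.proj w) :
    coeffAt ψ w z = 0 := by
  funext k
  ext u
  exact (hψ k w u).1 z h

variable {p q} in
/-- Membership in `twistedForms` in terms of coefficients. -/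
theorem mem_twistedForms {n : ℤ} {ψ : GForm EQ Q (P → ℂ)}
    (h1 : ∀ w z, p.proj z ≠ q.proj w → coeffAt ψ w z = 0)
    (h2 : ∀ (c : Circle) w z, p.proj z = q.proj w →
      coeffAt ψ w (c • z) = (c : ℂ) ^ (-n) • coeffAt ψ w z)
    (h3 : ∀ (U : Set X) (s : X → P), IsOpen U → ContMDiffOn 𝓘(ℝ, EX) 𝓘(ℝ, EP) ∞ s U →
      (∀ x ∈ U, p.proj (s x) = x) →
      ∀ k, ∀ w ∈ q.proj ⁻¹' U, SmoothFormAt (coeff q s (ψ k)) w)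
    (h4 : ∀ (c : Circle) w z, p.proj z = q.proj w →
      gcomp (dact EQ c w) (coeffAt ψ (c • w) z) = coeffAt ψ w z) :
    ψ ∈ twistedForms p q n := by
  refine ⟨fun k w u => ⟨fun z hz => ?_, fun c z => ?_⟩, h3, fun c k => ?_⟩
  · exact congrArg (fun α : GAlt EQ ℂ => α k u) (h1 w z hz)
  · by_cases h : p.proj z = q.proj w
    · exact congrArg (fun α : GAlt EQ ℂ => α k u) (h2 c w z h)
    · have e1 := congrArg (fun α : GAlt EQ ℂ => α k u) (h1 w z h)
      have e2 := congrArg (fun α : GAlt EQ ℂ => α k u) (h1 w (c • z) (by rwa [p.proj_smul]))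
      refine Eq.trans e2 ?_
      refine Eq.trans ?_ (congrArg (fun a : ℂ => (c : ℂ) ^ (-n) * a) e1).symm
      exact (mul_zero _).symm
  · funext w
    ext u z
    by_cases h : p.proj z = q.proj w
    · exact congrArg (fun α : GAlt EQ ℂ => α k u) (h4 c w z h)
    · have e1 := congrArg (fun α : GAlt EQ ℂ => α k u) (h1 w z h)
      have e2 := congrArg (fun α : GAlt EQ ℂ => α k (fun i => dact EQ c w (u i)))
        (h1 (c • w) z (by rwa [q.proj_smul]))
      exact Eq.trans e2 e1.symm

variable {p} in
theorem IsWeight.vpart_smul {n : ℤ} {η : GForm EP P ℂ} (h : IsWeight EP n η) (c : Circle) (z : P) :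
    p.vpart (c • z) (formAt η (c • z)) = (c : ℂ) ^ n • p.vpart z (formAt η z) := by
  rw [← p.vpart_dact, h, CircleBundle.vpart_smul]

variable {p} in
theorem IsWeight.hpart_smul {n : ℤ} {η : GForm EP P ℂ} (h : IsWeight EP n η) (c : Circle) (z : P) :
    p.hpart (c • z) (formAt η (c • z)) = (c : ℂ) ^ n • p.hpart z (formAt η z) := by
  rw [← p.hpart_dact, h, CircleBundle.hpart_smul]

/-- The coefficients of `τ_n η` with respect to a local section. -/
theorem coeff_tau_eventually {n : ℤ} {η : GForm EP P ℂ} (hη : IsWeight EP (-n) η) {s : X → P}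
    {w : Q} (hs : ∀ᶠ x in 𝓝 (q.proj w), p.IsLocalSection s x) (k : ℕ) :
    ∀ᶠ y in 𝓝 w, coeff q s (tau p q n η k) y =
      q.fasm (secV s η) (-p.secH s η) k y := by
  have h1 := q.smooth_proj.continuous.continuousAt.eventually hs
  filter_upwards [h1] with y hy
  have h2 := coeffAt_tau p q hη (z := s (q.proj y)) (w := y) hy.proj_eq.self_of_nhds
  rw [← hy.formAt_secV, ← hy.formAt_secH] at h2
  exact congrFun h2 k

/-- The weight of η gives the equivariance in z, the local formula `coeff_tau_eventually` gives
smoothness, and invariance holds because w enters only through the invariant data of `q`. -/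
theorem tau_mem {n : ℤ} {η : GForm EP P ℂ} (hη : η ∈ weightForms EP P (-n)) :
    tau p q n η ∈ twistedForms p q n := by
  obtain ⟨hs, hw⟩ := (mem_weightForms_iff p (-n) η).mp hη
  refine mem_twistedForms (fun w z h => coeffAt_tau_of_ne p q η h) (fun c w z h => ?_)
    (fun U s hU hsU hps k w hwU => ?_) (fun c w z h => ?_)
  · rw [coeffAt_tau p q hw h, coeffAt_tau p q hw ((p.proj_smul c z).trans h), hw.vpart_smul,
      hw.hpart_smul, asm_smul_neg]
  · have h1 : ∀ᶠ x in 𝓝 (q.proj w), p.IsLocalSection s x := by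
      filter_upwards [hU.mem_nhds hwU] with x hx using p.isLocalSection_of_isOpen hU hsU hps hx
    refine SmoothFormAt.congr ?_ (coeff_tau_eventually p q hw h1 k)
    refine smoothFormAt_fasm q (smoothFormAt_secV h1.self_of_nhds.smooth p fun k => hs k _)
      (fun k => (smoothFormAt_secH h1.self_of_nhds.smooth (fun k => hs k _) k).neg) k
  · rw [coeffAt_tau p q hw h, coeffAt_tau p q hw (h.trans (q.proj_smul c w).symm), asm_dact]

/-- The restriction of `σ̂_n ψ` to a neighbourhood of a point, in terms of local sections. -/
theorem formAt_sigmaInv_section {n : ℤ} {ψ : GForm EQ Q (P → ℂ)} (hψ : ψ ∈ twistedForms p q n)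
    {z : P} {c : Circle} {s : X → P} {r : X → Q} (hr : q.IsLocalSection r (p.proj z))
    (hz : c • s (p.proj z) = z) :
    formAt (sigmaInv p q ψ) z = (c : ℂ) ^ (-n) • formAt
      (p.fasm (secV r fun k => coeff q s (ψ k)) (-q.secH r fun k => coeff q s (ψ k))) z := by
  have h1 : q.proj (r (p.proj z)) = p.proj z := hr.proj_eq.self_of_nhds
  rw [formAt_sigmaInv p q hψ.2.2 h1.symm]
  have h2 := hr.formAt_secV (fun k => coeff q s (ψ k))
  have h3 := hr.formAt_secH (fun k => coeff q s (ψ k))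
  have h4 := coeffAt_smul hψ.1 c (r (p.proj z)) (s (p.proj z))
  rw [formAt_coeff, h1] at h2 h3
  rw [hz] at h4
  rw [h4, CircleBundle.vpart_smul, CircleBundle.hpart_smul, asm_smul_neg, ← h2,
    ← h3]
  rfl

/-- The point `q.pt` chosen in each fibre need not vary smoothly; invariance of ψ allows it to be
replaced by a smooth local section r. The coefficient with respect to y is (rot (θ y))^{-n} times
that with respect to a local section of `P`, which leaves a product of smooth factors. -/
theorem sigmaInv_mem {n : ℤ} {ψ : GForm EQ Q (P → ℂ)} (hψ : ψ ∈ twistedForms p q n) :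
    sigmaInv p q ψ ∈ weightForms EP P (-n) := by
  refine (mem_weightForms_iff p (-n) _).mpr ⟨fun k z => ?_, fun c z => ?_⟩
  · obtain ⟨U, hU, hz, hs, hps, hsz, θ, hθ, h0, hr⟩ := p.exists_section z
    obtain ⟨U', hU', hz', hs', hps', -, -⟩ := q.exists_section (q.pt (p.proj z))
    have hpt : q.proj (q.pt (p.proj z)) = p.proj z := Function.surjInv_eq _ _
    rw [hpt] at hz'
    set s := p.secThrough z
    set r := q.secThrough (q.pt (p.proj z))
    have hsm : ∀ k, ∀ w ∈ q.proj ⁻¹' U, SmoothFormAt (coeff q s (ψ k)) w := hψ.2.1 U s hU hs hps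
    have hrz := q.isLocalSection_of_isOpen hU' hs' hps' hz'
    have hrw : r (p.proj z) ∈ q.proj ⁻¹' U := by
      rw [Set.mem_preimage, hps' _ hz']; exact hz
    have h1 : ∀ k, SmoothFormAt (p.fasm (secV r fun k => coeff q s (ψ k))
        (-q.secH r fun k => coeff q s (ψ k)) k) z :=
      smoothFormAt_fasm p (smoothFormAt_secV hrz.smooth q fun k => hsm k _ hrw)
        (fun k => (smoothFormAt_secH hrz.smooth (fun k => hsm k _ hrw) k).neg)
    have h2 : ContMDiffAt 𝓘(ℝ, EP) 𝓘(ℝ, ℂ) ∞ (fun y => (rot (θ y) : ℂ) ^ (-n)) z := by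
      have e : (fun y => (rot (θ y) : ℂ) ^ (-n)) =
          fun y => (fun t : ℝ => Complex.exp (2 * Real.pi * Complex.I * (-n : ℤ) * t)) (θ y) :=
        funext fun y => rot_zpow _ _
      have h3 : ContDiff ℝ ∞
          (fun t : ℝ => Complex.exp (2 * Real.pi * Complex.I * (-n : ℤ) * t)) :=
        (contDiff_const.mul Complex.ofRealCLM.contDiff).cexp
      rw [e]
      exact h3.contMDiff.contMDiffAt.comp z hθ.self_of_nhds
    refine SmoothFormAt.congr (SmoothFormAt.smul_fun h2 (h1 k)) ?_
    have hcont := p.smooth_proj.continuous.continuousAt (x := z)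
    filter_upwards [hcont.preimage_mem_nhds (hU.mem_nhds hz),
      hcont.preimage_mem_nhds (hU'.mem_nhds hz')] with y hy hy'
    exact congrFun (formAt_sigmaInv_section p q hψ (q.isLocalSection_of_isOpen hU' hs' hps' hy')
      (hr y hy)) k
  · have hpt : q.proj (q.pt (p.proj z)) = p.proj z := Function.surjInv_eq _ _
    rw [formAt_sigmaInv p q hψ.2.2 hpt.symm,
      formAt_sigmaInv p q hψ.2.2 ((p.proj_smul c z).trans hpt.symm), asm_dact, coeffAt_smul hψ.1,
      CircleBundle.vpart_smul, CircleBundle.hpart_smul, asm_smul_neg]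

theorem asm_neg (z : P) (a b : GAlt EX ℂ) : p.asm z (-a) (-b) = -p.asm z a b := assemble_neg _ _ a b

/-- Two quarter turns: (a, b) ↦ (b, -a) ↦ (-a, -b). -/
theorem sigmaInv_tau {n : ℤ} {η : GForm EP P ℂ} (hη : η ∈ weightForms EP P (-n)) :
    sigmaInv p q (tau p q n η) = -η := by
  have hw := ((mem_weightForms_iff p (-n) η).mp hη).2
  refine gform_ext fun z => ?_
  have hpt : q.proj (q.pt (p.proj z)) = p.proj z := Function.surjInv_eq _ _
  rw [formAt_sigmaInv p q (tau_mem p q hη).2.2 hpt.symm, coeffAt_tau p q hw hpt.symm, vpart_asm,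
    hpart_asm, asm_neg, asm_parts]
  rfl

theorem tau_sigmaInv {n : ℤ} {ψ : GForm EQ Q (P → ℂ)} (hψ : ψ ∈ twistedForms p q n) :
    tau p q n (sigmaInv p q ψ) = -ψ := by
  have hw := ((mem_weightForms_iff p (-n) _).mp (sigmaInv_mem p q hψ)).2
  refine coeffAt_ext fun w z => ?_
  have e : coeffAt (-ψ) w z = -coeffAt ψ w z := rfl
  by_cases h : p.proj z = q.proj w
  · rw [coeffAt_tau p q hw h, formAt_sigmaInv p q hψ.2.2 h, vpart_asm, hpart_asm, asm_neg,
      asm_parts, e]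
  · rw [coeffAt_tau_of_ne p q _ h, e, coeffAt_of_ne hψ.1 h, neg_zero]

theorem neg_mem_weightForms {n : ℤ} {η : GForm EP P ℂ} (hη : η ∈ weightForms EP P n) :
    -η ∈ weightForms EP P n := by
  refine ⟨fun k z => (hη.1 k z).neg, fun k z u => ?_⟩
  have := (hη.2 k z u).neg
  refine this.congr_deriv ?_
  exact (mul_neg _ _).symm

variable {p q} in
theorem neg_mem_twistedForms {n : ℤ} {ψ : GForm EQ Q (P → ℂ)} (hψ : ψ ∈ twistedForms p q n) :
    -ψ ∈ twistedForms p q n := by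
  refine ⟨fun k w u => (p.line n (q.proj w)).neg_mem (hψ.1 k w u), fun U s hU hs hps k w hw =>
    (hψ.2.1 U s hU hs hps k w hw).neg, fun c k => ?_⟩
  have := hψ.2.2 c k
  exact congrArg (fun α : DForm EQ Q k (P → ℂ) => -α) this

theorem bijOn_tau (n : ℤ) :
    Set.BijOn (tau p q n) (weightForms EP P (-n)) (twistedForms p q n) := by
  refine ⟨fun η hη => tau_mem p q hη, fun η hη ζ hζ h => ?_, fun ψ hψ => ?_⟩
  · have h1 := congrArg (sigmaInv p q) h
    rw [sigmaInv_tau p q hη, sigmaInv_tau p q hζ] at h1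
    exact neg_injective h1
  · refine ⟨sigmaInv p q (-ψ), sigmaInv_mem p q (neg_mem_twistedForms hψ), ?_⟩
    rw [tau_sigmaInv p q (neg_mem_twistedForms hψ), neg_neg]

theorem bijOn_sigmaInv (n : ℤ) :
    Set.BijOn (sigmaInv p q) (twistedForms p q n) (weightForms EP P (-n)) := by
  refine ⟨fun η hη => sigmaInv_mem p q hη, fun ψ hψ χ hχ h => ?_, fun η hη => ?_⟩
  · have h1 := congrArg (tau p q n) h
    rw [tau_sigmaInv p q hψ, tau_sigmaInv p q hχ] at h1
    exact neg_injective h1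
  · refine ⟨tau p q n (-η), tau_mem p q (neg_mem_weightForms hη), ?_⟩
    rw [sigmaInv_tau p q (neg_mem_weightForms hη), neg_neg]

theorem asm_add (z : P) (a b a' b' : GAlt EX ℂ) :
    p.asm z (a + a') (b + b') = p.asm z a b + p.asm z a' b' := assemble_add _ _ a b a' b'

/-- Read off from the coordinate formula instead of the integral, so that no integrability enters;
this is where the weight is used. -/
theorem tau_linear {n : ℤ} (a b : ℂ) {η ζ : GForm EP P ℂ} (hη : η ∈ weightForms EP P (-n))
    (hζ : ζ ∈ weightForms EP P (-n)) :
    tau p q n (a • η + b • ζ) = a • tau p q n η + b • tau p q n ζ := by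
  have h1 := ((mem_weightForms_iff p (-n) η).mp hη).2
  have h2 := ((mem_weightForms_iff p (-n) ζ).mp hζ).2
  refine coeffAt_ext fun w z => ?_
  have e : coeffAt (a • tau p q n η + b • tau p q n ζ) w z =
    a • coeffAt (tau p q n η) w z + b • coeffAt (tau p q n ζ) w z := rfl
  by_cases h : p.proj z = q.proj w
  · rw [coeffAt_tau p q ((h1.smul a).add (h2.smul b)) h, e, coeffAt_tau p q h1 h,
      coeffAt_tau p q h2 h, ← asm_smul_neg, ← asm_smul_neg, ← asm_add, ← neg_add]
    rfl
  · rw [coeffAt_tau_of_ne p q _ h, e, coeffAt_tau_of_ne p q _ h, coeffAt_tau_of_ne p q _ h]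
    funext k
    ext u
    change (0 : ℂ) = a * 0 + b * 0
    rw [mul_zero, mul_zero, add_zero]

theorem sigmaInv_linear {n : ℤ} (a b : ℂ) {ψ χ : GForm EQ Q (P → ℂ)} (hψ : ψ ∈ twistedForms p q n)
    (hχ : χ ∈ twistedForms p q n) :
    sigmaInv p q (a • ψ + b • χ) = a • sigmaInv p q ψ + b • sigmaInv p q χ := by
  refine gform_ext fun z => ?_
  have hpt : q.proj (q.pt (p.proj z)) = p.proj z := Function.surjInv_eq _ _
  have e : formAt (a • sigmaInv p q ψ + b • sigmaInv p q χ) z =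
    a • formAt (sigmaInv p q ψ) z + b • formAt (sigmaInv p q χ) z := rfl
  have h : ∀ (c : Circle) (k : ℕ), pull (fun y : Q => c • y) ((a • ψ + b • χ) k) =
      (a • ψ + b • χ) k := fun c k =>
    congrArg₂ (fun α β : DForm EQ Q k (P → ℂ) => a • α + b • β) (hψ.2.2 c k) (hχ.2.2 c k)
  rw [formAt_sigmaInv p q h hpt.symm, e, formAt_sigmaInv p q hψ.2.2 hpt.symm,
    formAt_sigmaInv p q hχ.2.2 hpt.symm, ← asm_smul_neg, ← asm_smul_neg, ← asm_add, ← neg_add]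
  rfl

end CircleBundle

end ExoticHori

namespace ExoticHori

open Filter Topology

/-! ### The map φ on fibres, and its compatibility with τ_n. -/

section GTan

variable {E : Type*} [NormedAddCommGroup E] [NormedSpace ℝ E]
  {M : Type*} [TopologicalSpace M] [ChartedSpace E M] {x : M}

/-- The vector part of a generalized tangent vector. -/
def gvec (U : GTan E M x) : E := U.1

/-- The form part of a generalized tangent vector. -/
def gfrm (U : GTan E M x) : E [⋀^Fin 1]→L[ℝ] ℝ := U.2

theorem gvec_add (U W : GTan E M x) : gvec (U + W) = gvec U + gvec W := rfl

theorem gvec_smul (c : ℝ) (U : GTan E M x) : gvec (c • U) = c • gvec U := rfl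

theorem gfrm_add (U W : GTan E M x) : gfrm (U + W) = gfrm U + gfrm W := rfl

theorem gfrm_smul (c : ℝ) (U : GTan E M x) : gfrm (c • U) = c • gfrm U := rfl

theorem one_form_add {V : Type*} [AddCommGroup V] [Module ℝ V] [TopologicalSpace V] {F : Type*}
    [AddCommGroup F] [Module ℝ F] [TopologicalSpace F] (α : V [⋀^Fin 1]→L[ℝ] F) (u w : V) :
    α ![u + w] = α ![u] + α ![w] := α.vecCons_add ![] u w

theorem one_form_smul {V : Type*} [AddCommGroup V] [Module ℝ V] [TopologicalSpace V] {F : Type*}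
    [AddCommGroup F] [Module ℝ F] [TopologicalSpace F] (α : V [⋀^Fin 1]→L[ℝ] F) (c : ℝ) (u : V) :
    α ![c • u] = c • α ![u] := α.vecCons_smul ![] c u

theorem pairing_eq (U W : GTan E M x) :
    pairing x U W = (1 / 2 : ℝ) * (gfrm W ![gvec U] + gfrm U ![gvec W]) := rfl

end GTan

namespace CircleBundle

section One

variable {EX : Type*} [NormedAddCommGroup EX] [NormedSpace ℝ EX] [FiniteDimensional ℝ EX]
  {X : Type*} [TopologicalSpace X] [ChartedSpace EX X] [IsManifold 𝓘(ℝ, EX) ∞ X]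
  {EP : Type*} [NormedAddCommGroup EP] [NormedSpace ℝ EP] [FiniteDimensional ℝ EP]
  {P : Type*} [TopologicalSpace P] [ChartedSpace EP P] [IsManifold 𝓘(ℝ, EP) ∞ P]
  [MulAction Circle P]
  (p : CircleBundle EX X EP P)

-- The components x, f, g, θ determine (x + f v) + (θ + g A). Identities about φ are checked on
-- these four.
variable {p} in
theorem gtan_ext {z : P} {U W : GTan EP P z} (h1 : p.dp z (gvec U) = p.dp z (gvec W))
    (h2 : p.A z ![gvec U] = p.A z ![gvec W]) (h3 : gfrm U ![vv EP z] = gfrm W ![vv EP z])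
    (h4 : (gfrm U).compContinuousLinearMap (p.hr z) = (gfrm W).compContinuousLinearMap (p.hr z)) :
    U = W := by
  have e1 : gvec U = gvec W := p.tangent_ext h1 h2
  have e2 : gfrm U = gfrm W := by
    rw [(p.isSplitting z).one_form_decomp (gfrm U), (p.isSplitting z).one_form_decomp (gfrm W), h3,
      h4]
  exact Prod.ext e1 e2

theorem one_form_eval (z : P) (α : EP [⋀^Fin 1]→L[ℝ] ℝ) (u : EP) :
    α ![u] = α.compContinuousLinearMap (p.hr z) ![p.dp z u] + α ![vv EP z] * p.A z ![u] := by
  have h := (p.isSplitting z).decomp u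
  conv_lhs => rw [h]
  rw [one_form_add, one_form_smul, one_form_comp_apply, smul_eq_mul, mul_comm]

theorem inv_gvec {U : GSec EP P} (hU : IsInvSection U) (c : Circle) (z : P) :
    dact EP c z (gvec (U z)) = gvec (U (c • z)) := hU.inv_vec c z

theorem inv_gfrm {U : GSec EP P} (hU : IsInvSection U) (c : Circle) (z : P) :
    (gfrm (U (c • z))).compContinuousLinearMap (dact EP c z) = gfrm (U z) :=
  congrFun (hU.inv_form c) z

theorem inv_dp {U : GSec EP P} (hU : IsInvSection U) (c : Circle) (z : P) :
    p.dp (c • z) (gvec (U (c • z))) = p.dp z (gvec (U z)) := by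
  rw [← inv_gvec hU, ← p.dp_dact c z]
  rfl

theorem inv_A {U : GSec EP P} (hU : IsInvSection U) (c : Circle) (z : P) :
    p.A (c • z) ![gvec (U (c • z))] = p.A z ![gvec (U z)] := by
  rw [← inv_gvec hU, ← p.A_dact c z, one_form_comp_apply]

theorem inv_vv {U : GSec EP P} (hU : IsInvSection U) (c : Circle) (z : P)
    (p : CircleBundle EX X EP P) :
    gfrm (U (c • z)) ![vv EP (c • z)] = gfrm (U z) ![vv EP z] := by
  rw [← inv_gfrm hU c z, one_form_comp_apply, p.dact_vv]

theorem inv_hr {U : GSec EP P} (hU : IsInvSection U) (c : Circle) (z : P) :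
    (gfrm (U (c • z))).compContinuousLinearMap (p.hr (c • z)) =
    (gfrm (U z)).compContinuousLinearMap (p.hr z) := by
  rw [← inv_gfrm hU c z, ← p.dact_hr]
  rfl

end One

section Two

variable {EX : Type*} [NormedAddCommGroup EX] [NormedSpace ℝ EX] [FiniteDimensional ℝ EX]
  {X : Type*} [TopologicalSpace X] [ChartedSpace EX X] [IsManifold 𝓘(ℝ, EX) ∞ X]
  {EP : Type*} [NormedAddCommGroup EP] [NormedSpace ℝ EP] [FiniteDimensional ℝ EP]
  {P : Type*} [TopologicalSpace P] [ChartedSpace EP P] [IsManifold 𝓘(ℝ, EP) ∞ P]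
  [MulAction Circle P]
  {EQ : Type*} [NormedAddCommGroup EQ] [NormedSpace ℝ EQ] [FiniteDimensional ℝ EQ]
  {Q : Type*} [TopologicalSpace Q] [ChartedSpace EQ Q] [IsManifold 𝓘(ℝ, EQ) ∞ Q]
  [MulAction Circle Q]
  (p : CircleBundle EX X EP P) (q : CircleBundle EX X EQ Q)

section PhiAt

variable (z : P) (w : Q) (U W : GTan EP P z)

theorem gvec_phiAt : gvec (phiAt p q z w U) =
    q.hr w (p.dp z (gvec U)) + gfrm U ![vv EP z] • vv EQ w := rfl

theorem gfrm_phiAt : gfrm (phiAt p q z w U) =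
    ((gfrm U).compContinuousLinearMap (p.hr z)).compContinuousLinearMap (q.dp w) +
      p.A z ![gvec U] • q.A w := rfl

/-- This and the next three formulas say that φ keeps x and θ and exchanges f and g; the proofs
about φ below mostly use only them. -/
theorem dp_phiAt : q.dp w (gvec (phiAt p q z w U)) = p.dp z (gvec U) := by
  rw [gvec_phiAt, map_add, map_smul, (q.isSplitting w).proj_lift, q.dp_vv, smul_zero, add_zero]

theorem A_phiAt : q.A w ![gvec (phiAt p q z w U)] = gfrm U ![vv EP z] := by
  rw [gvec_phiAt, one_form_add, one_form_smul, (q.isSplitting w).conn_lift, q.A_vv, smul_eq_mul,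
    mul_one, zero_add]

theorem vv_phiAt : gfrm (phiAt p q z w U) ![vv EQ w] = p.A z ![gvec U] := by
  have h : ∀ α : EX [⋀^Fin 1]→L[ℝ] ℝ, α ![0] = 0 := fun α => by
    simpa using one_form_smul α 0 0
  rw [gfrm_phiAt, ContinuousAlternatingMap.add_apply, one_form_comp_apply, q.dp_vv, h, zero_add,
    ContinuousAlternatingMap.smul_apply, q.A_vv, smul_eq_mul, mul_one]

theorem hr_phiAt : (gfrm (phiAt p q z w U)).compContinuousLinearMap (q.hr w) =
    (gfrm U).compContinuousLinearMap (p.hr z) := by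
  refine form_ext_one fun b => ?_
  rw [one_form_comp_apply, gfrm_phiAt, ContinuousAlternatingMap.add_apply, one_form_comp_apply,
    (q.isSplitting w).proj_lift, ContinuousAlternatingMap.smul_apply, (q.isSplitting w).conn_lift,
    smul_zero, add_zero]

theorem phiAt_phiAt : phiAt q p w z (phiAt p q z w U) = U := by
  refine gtan_ext (p := p) ?_ ?_ ?_ ?_
  · rw [dp_phiAt, dp_phiAt]
  · rw [A_phiAt, vv_phiAt]
  · rw [vv_phiAt, A_phiAt]
  · rw [hr_phiAt, hr_phiAt]

theorem phiAt_add : phiAt p q z w (U + W) = phiAt p q z w U + phiAt p q z w W := by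
  refine gtan_ext (p := q) ?_ ?_ ?_ ?_
  · rw [gvec_add, map_add, dp_phiAt, dp_phiAt, dp_phiAt, gvec_add, map_add]
  · rw [gvec_add, one_form_add, A_phiAt, A_phiAt, A_phiAt, gfrm_add]
    rfl
  · rw [gfrm_add, ContinuousAlternatingMap.add_apply, vv_phiAt, vv_phiAt, vv_phiAt, gvec_add,
      one_form_add]
  · have e : ∀ (α β : EQ [⋀^Fin 1]→L[ℝ] ℝ) (L : EX →L[ℝ] EQ), (α + β).compContinuousLinearMap L =
      α.compContinuousLinearMap L + β.compContinuousLinearMap L := fun _ _ _ => rfl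
    rw [gfrm_add, e, hr_phiAt, hr_phiAt, hr_phiAt, gfrm_add]
    rfl

theorem phiAt_smul (c : ℝ) : phiAt p q z w (c • U) = c • phiAt p q z w U := by
  refine gtan_ext (p := q) ?_ ?_ ?_ ?_
  · rw [gvec_smul, map_smul, dp_phiAt, dp_phiAt, gvec_smul, map_smul]
  · rw [gvec_smul, one_form_smul, A_phiAt, A_phiAt, gfrm_smul]
    rfl
  · rw [gfrm_smul, ContinuousAlternatingMap.smul_apply, vv_phiAt, vv_phiAt, gvec_smul,
      one_form_smul]
  · have e : ∀ (α : EQ [⋀^Fin 1]→L[ℝ] ℝ) (L : EX →L[ℝ] EQ), (c • α).compContinuousLinearMap L =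
      c • α.compContinuousLinearMap L := fun _ _ => rfl
    rw [gfrm_smul, e, hr_phiAt, hr_phiAt, gfrm_smul]
    rfl

/-- Twice the pairing is θ(x') + θ'(x) + f g' + f' g, which is unchanged when f, f' are exchanged
with g, g'. -/
theorem pairing_phiAt : pairing w (phiAt p q z w U) (phiAt p q z w W) = pairing z U W := by
  rw [pairing_eq, pairing_eq, q.one_form_eval w (gfrm (phiAt p q z w W)),
    q.one_form_eval w (gfrm (phiAt p q z w U)), p.one_form_eval z (gfrm W),
    p.one_form_eval z (gfrm U)]
  simp only [dp_phiAt, A_phiAt, vv_phiAt, hr_phiAt]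
  ring

/-- The map `φ` on fibres is a linear isometry. -/
noncomputable def phiIsometry :
    (pairingQ (E := EP) z).IsometryEquiv (pairingQ (E := EQ) w) where
  toFun := phiAt p q z w
  map_add' := phiAt_add p q z w
  map_smul' c U := phiAt_smul p q z w U c
  invFun := phiAt q p w z
  left_inv := phiAt_phiAt p q z w
  right_inv := phiAt_phiAt q p w z
  map_app' U := pairing_phiAt p q z w U U

end PhiAt

variable {p q} in
theorem phi_eq {U : GSec EP P} (hU : IsInvSection U) {z : P} {w : Q} (h : p.proj z = q.proj w) :
    phi p q U w = phiAt p q z w (U z) := by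
  have hpt : p.proj (p.pt (q.proj w)) = q.proj w := Function.surjInv_eq _ _
  obtain ⟨c, hc⟩ := p.smul_of_proj_eq (h.trans hpt.symm)
  rw [phi, hc]
  refine gtan_ext (p := q) ?_ ?_ ?_ ?_
  · rw [dp_phiAt, dp_phiAt, p.inv_dp hU]
  · rw [A_phiAt, A_phiAt, inv_vv hU c z p]
  · rw [vv_phiAt, vv_phiAt, p.inv_A hU]
  · rw [hr_phiAt, hr_phiAt, p.inv_hr hU]

theorem phi_phi {U : GSec EP P} (hU : IsInvSection U) : phi q p (phi p q U) = U := by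
  funext z
  have hpt : q.proj (q.pt (p.proj z)) = p.proj z := Function.surjInv_eq _ _
  rw [phi, phi_eq hU hpt.symm, phiAt_phiAt]

/-! ### The Clifford action -/

theorem cliff_asm (z : P) (u : EP) (α : EP [⋀^Fin 1]→L[ℝ] ℝ) (a b : GAlt EX ℂ) :
    gcontract u (p.asm z a b) + gwedge α (p.asm z a b) = p.asm z
        (gcontract (p.dp z u) a + p.A z ![u] • b +
          gwedge (α.compContinuousLinearMap (p.hr z)) a)
        (-gcontract (p.dp z u) b + α ![vv EP z] • a -
          gwedge (α.compContinuousLinearMap (p.hr z)) b) :=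
  (p.isSplitting z).cliff_assemble u α a b

theorem formAt_cliff_asm (U : GSec EP P) (η : GForm EP P ℂ) (z : P) :
    formAt (cliff U η) z = p.asm z
        (gcontract (p.dp z (gvec (U z))) (p.hpart z (formAt η z)) +
          p.A z ![gvec (U z)] • p.vpart z (formAt η z) +
          gwedge ((gfrm (U z)).compContinuousLinearMap (p.hr z)) (p.hpart z (formAt η z)))
        (-gcontract (p.dp z (gvec (U z))) (p.vpart z (formAt η z)) +
          gfrm (U z) ![vv EP z] • p.hpart z (formAt η z) -
          gwedge ((gfrm (U z)).compContinuousLinearMap (p.hr z)) (p.vpart z (formAt η z))) := by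
  rw [← cliff_asm, p.asm_parts]
  rfl

theorem isWeight_cliff {n : ℤ} {U : GSec EP P} (hU : IsInvSection U)
    {η : GForm EP P ℂ} (hη : IsWeight EP n η) : IsWeight EP n (cliff U η) := by
  intro c z
  have e1 : ∀ z, formAt (cliff U η) z =
    gcontract (gvec (U z)) (formAt η z) + gwedge (gfrm (U z)) (formAt η z) := fun _ => rfl
  rw [e1, e1, gcomp_add, gwedge_comp, inv_gfrm hU, hη, ← inv_gvec hU c z, ← gcontract_gcomp, hη,
    gwedge_smul, gcontract_smul, smul_add]

theorem coeffAt_cliff (V : GSec EQ Q) (ψ : GForm EQ Q (P → ℂ)) (w : Q) (z : P) :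
    coeffAt (cliff V ψ) w z =
      gcontract (gvec (V w)) (coeffAt ψ w z) + gwedge (gfrm (V w)) (coeffAt ψ w z) := by
  have h := gpost_gwedge (V := EQ) (ContinuousLinearMap.proj (R := ℝ) (φ := fun _ : P => ℂ) z)
    (gfrm (V w)) (formAt ψ w)
  have h1 : coeffAt ψ w z =
    gpost (ContinuousLinearMap.proj (R := ℝ) (φ := fun _ : P => ℂ) z) (formAt ψ w) := rfl
  rw [h1, ← h]
  rfl

/-- Applying the quarter turn after γ_U gives (-ι_x b + g a - θ ∧ b, -ι_x a - f b - θ ∧ a). This is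
minus the action of x, θ with f and g exchanged on (b, -a). -/
theorem tau_cliff {n : ℤ} {U : GSec EP P} (hU : IsInvSection U) {η : GForm EP P ℂ}
    (hη : IsWeight EP (-n) η) :
    tau p q n (cliff U η) = -cliff (phi p q U) (tau p q n η) := by
  refine coeffAt_ext fun w z => ?_
  have e : coeffAt (-cliff (phi p q U) (tau p q n η)) w z =
    -coeffAt (cliff (phi p q U) (tau p q n η)) w z := rfl
  rw [e, coeffAt_cliff]
  by_cases h : p.proj z = q.proj w
  · rw [coeffAt_tau p q (isWeight_cliff hU hη) h, coeffAt_tau p q hη h, formAt_cliff_asm p, hpart_asm,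
      vpart_asm, phi_eq hU h, cliff_asm q, dp_phiAt, A_phiAt, vv_phiAt, hr_phiAt, ← asm_neg]
    congr 1
    · simp only [smul_neg]
      abel
    · simp only [gcontract_neg, gwedge_neg]
      abel
  · rw [coeffAt_tau_of_ne p q _ h, coeffAt_tau_of_ne p q _ h, gwedge_zero]
    have : gcontract (gvec (phi p q U w)) (0 : GAlt EQ ℂ) = 0 := rfl
    rw [this]
    simp

end Two

end CircleBundle

end ExoticHori

namespace ExoticHori

open Filter Topology

/-! ### Vector-valued coframes and smoothness of vector fields. -/

section Coframe

variable {EX : Type*} [NormedAddCommGroup EX] [NormedSpace ℝ EX] [FiniteDimensional ℝ EX]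
  {X : Type*} [TopologicalSpace X] [ChartedSpace EX X] [IsManifold 𝓘(ℝ, EX) ∞ X]

/-- The differential of the preferred chart at `x₀`, as a vector-valued 1-form. -/
noncomputable def chartForm (x₀ : X) : DForm EX X 1 EX := fun x =>
  (ContinuousAlternatingMap.ofSubsingleton ℝ EX EX (0 : Fin 1)
    (dmap EX EX (extChartAt 𝓘(ℝ, EX) x₀) x) : EX [⋀^Fin 1]→L[ℝ] EX)

theorem chartForm_self (x₀ : X) (u : EX) : (chartForm x₀ x₀ : EX [⋀^Fin 1]→L[ℝ] EX) ![u] = u :=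
  congrArg (fun L : EX →L[ℝ] EX => L u) (chart_self x₀)

theorem chartRep_chartForm {x₀ : X} {y : EX} (hy : y ∈ (extChartAt 𝓘(ℝ, EX) x₀).target) :
    chartRep (chartForm x₀) x₀ y =
      ContinuousAlternatingMap.ofSubsingleton ℝ EX EX (0 : Fin 1) (ContinuousLinearMap.id ℝ EX) := by
  refine form_ext_one fun u => ?_
  exact chart_chart_symm hy u

theorem smoothFormAt_chartForm {x₀ x : X} (hx : x ∈ (extChartAt 𝓘(ℝ, EX) x₀).source) :
    SmoothFormAt (chartForm (EX := EX) x₀) x := by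
  rw [smoothFormAt_iff _ hx]
  refine (contDiffAt_const (c := ContinuousAlternatingMap.ofSubsingleton ℝ EX EX (0 : Fin 1)
    (ContinuousLinearMap.id ℝ EX))).congr_of_eventuallyEq ?_
  filter_upwards [extChartAt_target_mem_nhds' (chart_mem_target hx)] with y hy
    using chartRep_chartForm hy

/-- In its own chart the form is constant. Its pullback will detect the projection of a Lie bracket.
-/
theorem extD_chartForm (x₀ : X) : extD (chartForm (EX := EX) x₀) x₀ = 0 := by
  have h : chartRep (chartForm (EX := EX) x₀) x₀ =ᶠ[𝓝 (extChartAt 𝓘(ℝ, EX) x₀ x₀)] fun _ =>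
      ContinuousAlternatingMap.ofSubsingleton ℝ EX EX (0 : Fin 1) (ContinuousLinearMap.id ℝ EX) := by
    filter_upwards [extChartAt_target_mem_nhds (I := 𝓘(ℝ, EX)) x₀] with y hy
      using chartRep_chartForm hy
  refine (extD_eq _ _).trans ?_
  rw [h.extDeriv_eq]
  rw [extDeriv, fderiv_fun_const]
  exact (ContinuousAlternatingMap.alternatizeUncurryFinCLM ℝ EX EX).map_zero

end Coframe

namespace CircleBundle

section One

variable {EX : Type*} [NormedAddCommGroup EX] [NormedSpace ℝ EX] [FiniteDimensional ℝ EX]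
  {X : Type*} [TopologicalSpace X] [ChartedSpace EX X] [IsManifold 𝓘(ℝ, EX) ∞ X]
  {EP : Type*} [NormedAddCommGroup EP] [NormedSpace ℝ EP] [FiniteDimensional ℝ EP]
  {P : Type*} [TopologicalSpace P] [ChartedSpace EP P] [IsManifold 𝓘(ℝ, EP) ∞ P]
  [MulAction Circle P]
  (p : CircleBundle EX X EP P)

/-- The differential of the projection in the preferred chart at `x₀`, as a 1-form. -/
noncomputable def projForm (x₀ : X) : DForm EP P 1 EX := pull p.proj (chartForm x₀)

theorem projForm_apply (x₀ : X) (z : P) (u : EP) :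
    (p.projForm x₀ z : EP [⋀^Fin 1]→L[ℝ] EX) ![u] =
      (chartForm x₀ (p.proj z) : EX [⋀^Fin 1]→L[ℝ] EX) ![p.dp z u] :=
  one_form_comp_apply _ _ _

theorem smoothFormAt_projForm {x₀ : X} {z : P}
    (h : p.proj z ∈ (extChartAt 𝓘(ℝ, EX) x₀).source) : SmoothFormAt (p.projForm x₀) z :=
  (smoothFormAt_chartForm h).pull p.smooth_proj.contMDiffAt

theorem ofSubsingleton_symm_apply {E F : Type*} [NormedAddCommGroup E] [NormedSpace ℝ E]
    [NormedAddCommGroup F] [NormedSpace ℝ F] (α : E [⋀^Fin 1]→L[ℝ] F) (u : E) :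
    (ContinuousAlternatingMap.ofSubsingleton ℝ E F (0 : Fin 1)).symm α u = α ![u] := by
  have h : (fun _ : Fin 1 => u) = ![u] := funext fun i => by rw [Subsingleton.elim i 0]; rfl
  exact congrArg α h

theorem contDiffAt_one_form_clm {E G F : Type*} [NormedAddCommGroup E] [NormedSpace ℝ E]
    [FiniteDimensional ℝ E] [NormedAddCommGroup G] [NormedSpace ℝ G] [NormedAddCommGroup F]
    [NormedSpace ℝ F] [FiniteDimensional ℝ F] {f : G → E [⋀^Fin 1]→L[ℝ] F} {x : G}
    (hf : ContDiffAt ℝ ∞ f x) :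
    ContDiffAt ℝ ∞ (fun y => (ContinuousAlternatingMap.ofSubsingleton ℝ E F (0 : Fin 1)).symm (f y))
      x := by
  let Φ : (E [⋀^Fin 1]→L[ℝ] F) →ₗ[ℝ] (E →L[ℝ] F) :=
    { toFun := fun α => (ContinuousAlternatingMap.ofSubsingleton ℝ E F (0 : Fin 1)).symm α
      map_add' := fun _ _ => rfl
      map_smul' := fun _ _ => rfl }
  exact (LinearMap.toContinuousLinearMap Φ).contDiff.contDiffAt.comp x hf

/-- A vector field is smooth if its image under the projection and its contraction with the
connection form are. -/
theorem contDiffAt_vecRep {V : VField EP P} {z : P}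
    (h1 : SmoothFormAt (inter V (p.projForm (p.proj z))) z) (h2 : SmoothFormAt (inter V p.conn) z) :
    ContDiffAt ℝ ∞ (vecRep (E := EP) V z) (extChartAt 𝓘(ℝ, EP) z z) := by
  set y₀ := extChartAt 𝓘(ℝ, EP) z z
  let T := ContinuousAlternatingMap.ofSubsingleton ℝ EP EX (0 : Fin 1)
  let T' := ContinuousAlternatingMap.ofSubsingleton ℝ EP ℝ (0 : Fin 1)
  -- L combines dπ and A in the chart. At y₀ the splitting inverts it by (b, t) ↦ hr b + t v, hence
  -- it is invertible near y₀, and V is the smooth inverse of L applied to the two contractions.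
  let L : EP → EP →L[ℝ] EX × ℝ := fun y =>
    (T.symm (chartRep (p.projForm (p.proj z)) z y)).prod (T'.symm (chartRep p.conn z y))
  have hL : ContDiffAt ℝ ∞ L y₀ := by
    let Ψ : (EP →L[ℝ] EX) × (EP →L[ℝ] ℝ) →ₗ[ℝ] (EP →L[ℝ] EX × ℝ) :=
      { toFun := fun q => q.1.prod q.2
        map_add' := fun _ _ => rfl
        map_smul' := fun _ _ => rfl }
    exact (LinearMap.toContinuousLinearMap Ψ).contDiff.contDiffAt.comp y₀
      ((contDiffAt_one_form_clm
        (p.smoothFormAt_projForm (mem_extChartAt_source (I := 𝓘(ℝ, EX)) (p.proj z)))).prodMk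
        (contDiffAt_one_form_clm (p.conn_smooth z)))
  have h0 : ∀ u, L y₀ u = (p.dp z u, p.A z ![u]) := by
    intro u
    refine Prod.ext ?_ ?_
    · have h := chartRep_self (p.projForm (p.proj z)) z
      refine ((ofSubsingleton_symm_apply _ u).trans
        (congrArg (fun α : EP [⋀^Fin 1]→L[ℝ] EX => α ![u]) h)).trans ?_
      exact (p.projForm_apply _ _ _).trans (chartForm_self _ _)
    · have h := chartRep_self p.conn z
      exact (ofSubsingleton_symm_apply _ u).trans
        (congrArg (fun α : EP [⋀^Fin 1]→L[ℝ] ℝ => α ![u]) h)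
  let R : EX × ℝ →L[ℝ] EP := ((p.hr z).comp (ContinuousLinearMap.fst ℝ EX ℝ)) +
    (ContinuousLinearMap.snd ℝ EX ℝ).smulRight (vv EP z)
  have hR : ∀ b, R b = p.hr z b.1 + b.2 • vv EP z := fun _ => rfl
  let e : EP ≃L[ℝ] EX × ℝ := ContinuousLinearEquiv.equivOfInverse (L y₀) R
    (fun u => by
      rw [h0, hR]
      exact ((p.isSplitting z).decomp u).symm)
    (fun b => by
      rw [h0, hR, map_add, map_smul, (p.isSplitting z).proj_lift, p.dp_vv, one_form_add,
        one_form_smul, (p.isSplitting z).conn_lift, p.A_vv]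
      simp)
  have he : (e : EP →L[ℝ] EX × ℝ) = L y₀ := rfl
  have h3 : ContDiffAt ℝ ∞ (fun y => ContinuousLinearMap.inverse (L y)) y₀ := by
    refine ContDiffAt.comp (g := ContinuousLinearMap.inverse) y₀ ?_ hL
    rw [← he]
    exact contDiffAt_map_inverse e
  have h4 : ContDiffAt ℝ ∞ (fun y => (chartRep (inter V (p.projForm (p.proj z))) z y ![],
      chartRep (inter V p.conn) z y ![])) y₀ := by
    refine ContDiffAt.prodMk ?_ ?_
    · have := contDiffAt_form_apply (w := fun (i : Fin 0) (_ : EP) => (![] : Fin 0 → EP) i) h1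
        fun _ => contDiffAt_const
      exact this
    · have := contDiffAt_form_apply (w := fun (i : Fin 0) (_ : EP) => (![] : Fin 0 → EP) i) h2
        fun _ => contDiffAt_const
      exact this
  refine (h3.clm_apply h4).congr_of_eventuallyEq ?_
  have h5 : ∀ᶠ y in 𝓝 y₀, (L y).IsInvertible := by
    have := hL.continuousAt.eventually (he ▸ e.nhds)
    filter_upwards [this] with y hy
    obtain ⟨e', he'⟩ := hy
    exact ⟨e', he'⟩
  filter_upwards [h5, extChartAt_target_mem_nhds (I := 𝓘(ℝ, EP)) z] with y h6 h7
  rw [chartRep_inter V _ h7, chartRep_inter V _ h7]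
  symm
  rw [h6.inverse_apply_eq]
  exact Prod.ext
    (ofSubsingleton_symm_apply (E := EP) (F := EX) (chartRep (p.projForm (p.proj z)) z y)
      (vecRep (E := EP) V z y)).symm
    (ofSubsingleton_symm_apply (E := EP) (F := ℝ) (chartRep p.conn z y)
      (vecRep (E := EP) V z y)).symm

end One

end CircleBundle

end ExoticHori

namespace ExoticHori

open Filter Topology

/-! ### Invariant sections as data on the base, and φ on sections. -/

section ZeroForms

variable {V W : Type*} [AddCommGroup V] [Module ℝ V] [TopologicalSpace V]
  [AddCommGroup W] [Module ℝ W] [TopologicalSpace W]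
  {F : Type*} [AddCommGroup F] [Module ℝ F] [TopologicalSpace F]

theorem zero_form_comp_apply (α : V [⋀^Fin 0]→L[ℝ] F) (L : W →L[ℝ] V) :
    α.compContinuousLinearMap L ![] = α ![] := by
  rw [ContinuousAlternatingMap.compContinuousLinearMap_apply]
  congr 1
  exact Subsingleton.elim _ _

variable (V) in
/-- A number, as a form of degree zero. -/
noncomputable def zeroForm (c : ℝ) : V [⋀^Fin 0]→L[ℝ] ℝ :=
  ContinuousAlternatingMap.constOfIsEmpty ℝ V (Fin 0) c

end ZeroForms

section VecRep

variable {EX : Type*} [NormedAddCommGroup EX] [NormedSpace ℝ EX] [FiniteDimensional ℝ EX]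
  {X : Type*} [TopologicalSpace X] [ChartedSpace EX X] [IsManifold 𝓘(ℝ, EX) ∞ X]

theorem contDiffAt_vecRep_of_chartForm {V : VField EX X} {x : X}
    (h : SmoothFormAt (inter V (chartForm x)) x) :
    ContDiffAt ℝ ∞ (vecRep (E := EX) V x) (extChartAt 𝓘(ℝ, EX) x x) := by
  have h1 := contDiffAt_form_apply (w := fun (i : Fin 0) (_ : EX) => (![] : Fin 0 → EX) i) h
    fun _ => contDiffAt_const
  refine h1.congr_of_eventuallyEq ?_
  filter_upwards [extChartAt_target_mem_nhds (I := 𝓘(ℝ, EX)) x] with y hy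
  rw [chartRep_inter V _ hy, chartRep_chartForm hy]
  rfl

end VecRep

namespace CircleBundle

section One

variable {EX : Type*} [NormedAddCommGroup EX] [NormedSpace ℝ EX] [FiniteDimensional ℝ EX]
  {X : Type*} [TopologicalSpace X] [ChartedSpace EX X] [IsManifold 𝓘(ℝ, EX) ∞ X]
  {EP : Type*} [NormedAddCommGroup EP] [NormedSpace ℝ EP] [FiniteDimensional ℝ EP]
  {P : Type*} [TopologicalSpace P] [ChartedSpace EP P] [IsManifold 𝓘(ℝ, EP) ∞ P]
  [MulAction Circle P]
  (p : CircleBundle EX X EP P)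

/-- The section `U` is `(x + f v) + (θ + g A)` with smooth `x`, `f`, `g` and `θ` on the base. -/
structure HasBase (U : GSec EP P) (x : VField EX X) (f g : DForm EX X 0 ℝ) (θ : DForm EX X 1 ℝ) :
    Prop where
  vec : ∀ z, p.dp z (gvec (U z)) = x (p.proj z)
  conn : ∀ z, p.A z ![gvec (U z)] = f (p.proj z) ![]
  vert : ∀ z, gfrm (U z) ![vv EP z] = g (p.proj z) ![]
  hor : ∀ z, (gfrm (U z)).compContinuousLinearMap (p.hr z) = θ (p.proj z)
  smooth_vec : ∀ y, ContDiffAt ℝ ∞ (vecRep (E := EX) x y) (extChartAt 𝓘(ℝ, EX) y y)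
  smooth_conn : ∀ y, SmoothFormAt f y
  smooth_vert : ∀ y, SmoothFormAt g y
  smooth_hor : ∀ y, SmoothFormAt θ y

theorem exists_isLocalSection (x : X) : ∃ s, ∀ᶠ y in 𝓝 x, p.IsLocalSection s y := by
  obtain ⟨U, hU, hz, hs, hps, -⟩ := p.exists_section (p.pt x)
  have hpt : p.proj (p.pt x) = x := Function.surjInv_eq _ _
  rw [hpt] at hz
  exact ⟨_, by filter_upwards [hU.mem_nhds hz] with y hy using p.isLocalSection_of_isOpen hU hs hps hy⟩

/-- The components at the chosen points of the fibres represent all points by invariance. Their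
smoothness is seen by pulling smooth forms on `P` back along a smooth local section, not along the
chosen points. -/
theorem exists_hasBase {U : GSec EP P} (hU : IsInvSection U) : ∃ x f g θ, p.HasBase U x f g θ := by
  have hpt : ∀ z, p.proj (p.pt (p.proj z)) = p.proj z := fun z => Function.surjInv_eq _ _
  have hV : ∀ z, ContDiffAt ℝ ∞ (vecRep (E := EP) (fun z => (U z).1) z)
      (extChartAt 𝓘(ℝ, EP) z z) := fun z =>
    (contMDiffAt_section_iff_vecRep (fun z => (U z).1) z).mp (hU.smooth_vec z)
  let x : VField EX X := fun x => (p.dp (p.pt x) (gvec (U (p.pt x))) : EX)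
  let f : DForm EX X 0 ℝ := fun x => zeroForm EX (p.A (p.pt x) ![gvec (U (p.pt x))])
  let g : DForm EX X 0 ℝ := fun x => zeroForm EX (gfrm (U (p.pt x)) ![vv EP (p.pt x)])
  let θ : DForm EX X 1 ℝ := fun x =>
    ((gfrm (U (p.pt x))).compContinuousLinearMap (p.hr (p.pt x)) : EX [⋀^Fin 1]→L[ℝ] ℝ)
  have h1 : ∀ z, p.dp z (gvec (U z)) = x (p.proj z) := fun z => by
    obtain ⟨c, hc⟩ := p.smul_of_proj_eq (hpt z)
    rw [hc, p.inv_dp hU c, p.proj_smul, hpt]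
  have h2 : ∀ z, p.A z ![gvec (U z)] = f (p.proj z) ![] := fun z => by
    obtain ⟨c, hc⟩ := p.smul_of_proj_eq (hpt z)
    rw [hc, p.inv_A hU c, p.proj_smul, hpt]
    rfl
  have h3 : ∀ z, gfrm (U z) ![vv EP z] = g (p.proj z) ![] := fun z => by
    obtain ⟨c, hc⟩ := p.smul_of_proj_eq (hpt z)
    rw [hc, inv_vv hU c _ p, p.proj_smul, hpt]
    rfl
  have h4 : ∀ z, (gfrm (U z)).compContinuousLinearMap (p.hr z) = θ (p.proj z) := fun z => by
    obtain ⟨c, hc⟩ := p.smul_of_proj_eq (hpt z)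
    rw [hc, p.inv_hr hU c, p.proj_smul, hpt]
  refine ⟨x, f, g, θ, h1, h2, h3, h4, fun y => ?_, fun y => ?_, fun y => ?_, fun y => ?_⟩ <;>
    obtain ⟨s, hs⟩ := p.exists_isLocalSection y <;>
    have hsy := hs.self_of_nhds <;>
    have hsm := hsy.smooth
  · refine contDiffAt_vecRep_of_chartForm ?_
    have e : p.proj (s y) ∈ (extChartAt 𝓘(ℝ, EX) y).source := by
      rw [hsy.proj_eq.self_of_nhds]
      exact mem_extChartAt_source y
    refine SmoothFormAt.congr (SmoothFormAt.pull (f := s)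
      ((p.smoothFormAt_projForm e).inter (hV (s y))) hsm) ?_
    filter_upwards [hs] with a ha
    have ha' := ha.proj_eq.self_of_nhds
    refine form_ext_zero ?_
    have e1 := p.projForm_apply y (s a) (gvec (U (s a)))
    rw [ha', h1, ha'] at e1
    refine Eq.trans e1.symm ?_
    exact (zero_form_comp_apply (contract (gvec (U (s a))) (p.projForm y (s a) :
      EP [⋀^Fin 1]→L[ℝ] EX)) (dmap EX EP s a)).symm
  · refine SmoothFormAt.congr (SmoothFormAt.pull (f := s)
      ((p.conn_smooth (s y)).inter (hV (s y))) hsm) ?_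
    filter_upwards [hs] with a ha
    have ha' := ha.proj_eq.self_of_nhds
    refine form_ext_zero ?_
    have e1 := h2 (s a)
    rw [ha'] at e1
    refine Eq.trans e1.symm ?_
    exact (zero_form_comp_apply (contract (gvec (U (s a))) (p.A (s a))) (dmap EX EP s a)).symm
  · refine SmoothFormAt.congr (SmoothFormAt.pull (f := s)
      ((hU.smooth_form (s y)).inter (p.contDiffAt_vert (s y))) hsm) ?_
    filter_upwards [hs] with a ha
    have ha' := ha.proj_eq.self_of_nhds
    refine form_ext_zero ?_
    have e1 := h3 (s a)
    rw [ha'] at e1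
    refine Eq.trans e1.symm ?_
    exact (zero_form_comp_apply (contract (vv EP (s a)) (gfrm (U (s a)))) (dmap EX EP s a)).symm
  · refine SmoothFormAt.congr (SmoothFormAt.pull (f := s) ((hU.smooth_form (s y)).sub
      (((hU.smooth_form (s y)).inter (p.contDiffAt_vert (s y))).fwedge (zero_add 1)
        (p.conn_smooth (s y)))) hsm) ?_
    filter_upwards [hs] with a ha
    have ha' := ha.proj_eq.self_of_nhds
    have e1 := h4 (s a)
    rw [ha'] at e1
    refine e1.symm.trans ?_
    -- Removing g A from the form part leaves a form pulled back from the base; its pullback by a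
    -- section is θ.
    have e2 : gfrm (U (s a)) - wedge (zero_add 1) (contract (vv EP (s a)) (gfrm (U (s a))))
        (p.A (s a)) =
        ((gfrm (U (s a))).compContinuousLinearMap (p.hr (s a))).compContinuousLinearMap
          (p.dp (s a)) := by
      rw [wedge_deg_zero, contract_apply, sub_eq_iff_eq_add]
      exact (p.isSplitting (s a)).one_form_decomp _
    have e3 : ∀ α : EX [⋀^Fin 1]→L[ℝ] ℝ, (α.compContinuousLinearMap
        (p.dp (s a))).compContinuousLinearMap (dmap EX EP s a) = α := fun α => by
      have := congrArg (fun L : EX →L[ℝ] EX => α.compContinuousLinearMap L) ha.dp_comp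
      exact this
    rw [← e3 ((gfrm (U (s a))).compContinuousLinearMap (p.hr (s a))), ← e2]
    rfl

namespace HasBase

variable {p} {U : GSec EP P} {x : VField EX X} {f g : DForm EX X 0 ℝ} {θ : DForm EX X 1 ℝ}

theorem inter_projForm (h : p.HasBase U x f g θ) (x₀ : X) :
    inter (fun z => (U z).1) (p.projForm x₀) = pull p.proj (inter x (chartForm x₀)) := by
  funext z
  refine form_ext_zero ?_
  have e1 := p.projForm_apply x₀ z (gvec (U z))
  rw [h.vec] at e1
  refine Eq.trans e1 ?_
  exact (zero_form_comp_apply (contract (x (p.proj z)) (chartForm x₀ (p.proj z) :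
    EX [⋀^Fin 1]→L[ℝ] EX)) (p.dp z)).symm

theorem inter_conn (h : p.HasBase U x f g θ) :
    inter (fun z => (U z).1) p.conn = pull p.proj f := by
  funext z
  refine form_ext_zero ?_
  refine Eq.trans (h.conn z) ?_
  exact (zero_form_comp_apply (f (p.proj z) : EX [⋀^Fin 0]→L[ℝ] ℝ) (p.dp z)).symm

theorem form_eq (h : p.HasBase U x f g θ) :
    (fun z => (U z).2) = pull p.proj θ + fwedge (zero_add 1) (pull p.proj g) p.conn := by
  funext z
  have e1 := (p.isSplitting z).one_form_decomp (gfrm (U z))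
  rw [h.hor, h.vert] at e1
  refine Eq.trans e1 ?_
  have e2 := wedge_deg_zero (zero_add 1) ((g (p.proj z) : EX [⋀^Fin 0]→L[ℝ] ℝ).compContinuousLinearMap
    (p.dp z)) (p.A z)
  have e3 := zero_form_comp_apply (g (p.proj z) : EX [⋀^Fin 0]→L[ℝ] ℝ) (p.dp z)
  have e4 := e2.trans (congrArg (fun c : ℝ => c • p.A z) e3)
  exact congrArg (fun α : EP [⋀^Fin 1]→L[ℝ] ℝ => (θ (p.proj z) :
    EX [⋀^Fin 1]→L[ℝ] ℝ).compContinuousLinearMap (p.dp z) + α) e4.symm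

theorem contDiffAt_vec (h : p.HasBase U x f g θ) (z : P) :
    ContDiffAt ℝ ∞ (vecRep (E := EP) (fun z => (U z).1) z) (extChartAt 𝓘(ℝ, EP) z z) := by
  refine p.contDiffAt_vecRep ?_ ?_
  · rw [h.inter_projForm]
    exact ((smoothFormAt_chartForm (mem_extChartAt_source _)).inter (h.smooth_vec _)).pull
      p.smooth_proj.contMDiffAt
  · rw [h.inter_conn]
    exact (h.smooth_conn _).pull p.smooth_proj.contMDiffAt

theorem smoothFormAt (h : p.HasBase U x f g θ) (z : P) : SmoothFormAt (fun z => (U z).2) z := by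
  rw [h.form_eq]
  exact ((h.smooth_hor _).pull p.smooth_proj.contMDiffAt).add
    (((h.smooth_vert _).pull p.smooth_proj.contMDiffAt).fwedge _ (p.conn_smooth z))

/-- Converse to `exists_hasBase`. Together they show that φ preserves smoothness and invariance,
despite the choice of points in its definition. -/
theorem isInvSection (h : p.HasBase U x f g θ) : IsInvSection U := by
  refine ⟨fun z => (contMDiffAt_section_iff_vecRep (fun z => (U z).1) z).mpr (h.contDiffAt_vec z),
    h.smoothFormAt, fun c z => ?_, fun c => ?_⟩
  · refine p.tangent_ext (z := c • z) (u := dact EP c z (gvec (U z))) (w := gvec (U (c • z))) ?_ ?_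
    · rw [h.vec, p.proj_smul, ← h.vec, ← p.dp_dact c z]
      rfl
    · rw [h.conn, p.proj_smul, ← h.conn, ← p.A_dact c z, one_form_comp_apply]
  · funext z
    have e : ∀ α : EP [⋀^Fin 1]→L[ℝ] ℝ, (α.compContinuousLinearMap
      (dact EP c z)).compContinuousLinearMap (p.hr z) =
        α.compContinuousLinearMap ((dact EP c z).comp (p.hr z)) := fun _ => rfl
    have key : (gfrm (U (c • z))).compContinuousLinearMap (dact EP c z) = gfrm (U z) := by
      rw [(p.isSplitting z).one_form_decomp (gfrm (U z)),
        (p.isSplitting z).one_form_decomp (ContinuousAlternatingMap.compContinuousLinearMap _ _),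
        one_form_comp_apply, p.dact_vv, e, p.dact_hr, h.hor, h.hor, h.vert, h.vert, p.proj_smul]
    exact key

end HasBase

end One

section Two

variable {EX : Type*} [NormedAddCommGroup EX] [NormedSpace ℝ EX] [FiniteDimensional ℝ EX]
  {X : Type*} [TopologicalSpace X] [ChartedSpace EX X] [IsManifold 𝓘(ℝ, EX) ∞ X]
  {EP : Type*} [NormedAddCommGroup EP] [NormedSpace ℝ EP] [FiniteDimensional ℝ EP]
  {P : Type*} [TopologicalSpace P] [ChartedSpace EP P] [IsManifold 𝓘(ℝ, EP) ∞ P]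
  [MulAction Circle P]
  {EQ : Type*} [NormedAddCommGroup EQ] [NormedSpace ℝ EQ] [FiniteDimensional ℝ EQ]
  {Q : Type*} [TopologicalSpace Q] [ChartedSpace EQ Q] [IsManifold 𝓘(ℝ, EQ) ∞ Q]
  [MulAction Circle Q]
  (p : CircleBundle EX X EP P) (q : CircleBundle EX X EQ Q)

variable {p} in
theorem HasBase.phi {U : GSec EP P} {x : VField EX X} {f g : DForm EX X 0 ℝ} {θ : DForm EX X 1 ℝ}
    (h : p.HasBase U x f g θ) : q.HasBase (phi p q U) x g f θ := by
  have hpt : ∀ w, p.proj (p.pt (q.proj w)) = q.proj w := fun w => Function.surjInv_eq _ _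
  refine ⟨fun w => ?_, fun w => ?_, fun w => ?_, fun w => ?_, h.smooth_vec, h.smooth_vert,
    h.smooth_conn, h.smooth_hor⟩
  · rw [CircleBundle.phi, dp_phiAt, h.vec, hpt]
  · rw [CircleBundle.phi, A_phiAt, h.vert, hpt]
  · rw [CircleBundle.phi, vv_phiAt, h.conn, hpt]
  · rw [CircleBundle.phi, hr_phiAt, h.hor, hpt]

theorem isInvSection_phi {U : GSec EP P} (hU : IsInvSection U) : IsInvSection (phi p q U) := by
  obtain ⟨x, f, g, θ, h⟩ := p.exists_hasBase hU
  exact (h.phi q).isInvSection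

theorem phi_linear (U W : GSec EP P) (a : X → ℝ) :
    phi p q (fun z => a (p.proj z) • U z + W z) =
      fun w => a (q.proj w) • phi p q U w + phi p q W w := by
  funext w
  have hpt : p.proj (p.pt (q.proj w)) = q.proj w := Function.surjInv_eq _ _
  rw [phi, phiAt_add, phiAt_smul, hpt]
  rfl

theorem pairing_phi {U W : GSec EP P} (hU : IsInvSection U) (hW : IsInvSection W) {z : P} {w : Q}
    (h : p.proj z = q.proj w) :
    pairing w (phi p q U w) (phi p q W w) = pairing z (U z) (W z) := by
  rw [phi_eq hU h, phi_eq hW h, pairing_phiAt]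

theorem exists_fibre_cliffordEquiv (z : P) (w : Q) (h : p.proj z = q.proj w) :
    ∃ Φ : CliffordAlgebra (pairingQ (E := EP) z) ≃ₐ[ℝ] CliffordAlgebra (pairingQ (E := EQ) w),
      ∀ U : GSec EP P, IsInvSection U →
        Φ (CliffordAlgebra.ι _ (U z)) = CliffordAlgebra.ι _ (phi p q U w) := by
  refine ⟨CliffordAlgebra.equivOfIsometry (phiIsometry p q z w), fun U hU => ?_⟩
  rw [phi_eq hU h]
  exact CliffordAlgebra.map_apply_ι _ _

/-- The homomorphism of algebras of sections of the bundles of Clifford algebras which is induced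
by the isometries of the fibres. -/
noncomputable def cliffordSecHom : (∀ z : P, CliffordAlgebra (pairingQ (E := EP) z)) →ₐ[ℝ]
    ∀ w : Q, CliffordAlgebra (pairingQ (E := EQ) w) :=
  AlgHom.pi fun w =>
    (CliffordAlgebra.equivOfIsometry (phiIsometry p q (p.pt (q.proj w)) w)).toAlgHom.comp
      (Pi.evalAlgHom ℝ _ (p.pt (q.proj w)))

theorem cliffordSecHom_gammaSec (U : GSec EP P) :
    cliffordSecHom p q (gammaSec U) = gammaSec (phi p q U) := by
  funext w
  exact CliffordAlgebra.map_apply_ι _ _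

theorem cliffordSecHom_mem {a : ∀ z : P, CliffordAlgebra (pairingQ (E := EP) z)}
    (ha : a ∈ invCliff EP P) : cliffordSecHom p q a ∈ invCliff EQ Q := by
  have h : invCliff EP P ≤ (invCliff EQ Q).comap (cliffordSecHom p q) := by
    refine Algebra.adjoin_le ?_
    rintro a ⟨U, hU, rfl⟩
    refine Algebra.subset_adjoin ⟨phi p q U, isInvSection_phi p q hU, ?_⟩
    exact cliffordSecHom_gammaSec p q U
  exact h ha

/-- On arbitrary sections the composite need not be the identity, since only values at the chosen
points enter. On the generated subalgebra it suffices to check the generators, where `phi_phi`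
applies. -/
theorem cliffordSecHom_cliffordSecHom {a : ∀ z : P, CliffordAlgebra (pairingQ (E := EP) z)}
    (ha : a ∈ invCliff EP P) : cliffordSecHom q p (cliffordSecHom p q a) = a := by
  have h : invCliff EP P ≤ AlgHom.equalizer
      ((cliffordSecHom q p).comp (cliffordSecHom p q)) (AlgHom.id ℝ _) := by
    refine Algebra.adjoin_le ?_
    rintro a ⟨U, hU, rfl⟩
    change cliffordSecHom q p (cliffordSecHom p q (gammaSec U)) = gammaSec U
    rw [cliffordSecHom_gammaSec, cliffordSecHom_gammaSec, phi_phi p q hU]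
  exact h ha

/-- The isomorphism of the algebras generated by the `γ_U` for invariant sections `U`. -/
noncomputable def invCliffEquiv : invCliff EP P ≃ₐ[ℝ] invCliff EQ Q :=
  AlgEquiv.ofAlgHom
    (((cliffordSecHom p q).comp (invCliff EP P).val).codRestrict (invCliff EQ Q)
      fun a => cliffordSecHom_mem p q a.2)
    (((cliffordSecHom q p).comp (invCliff EQ Q).val).codRestrict (invCliff EP P)
      fun a => cliffordSecHom_mem q p a.2)
    (AlgHom.ext fun a => Subtype.ext (cliffordSecHom_cliffordSecHom q p a.2))
    (AlgHom.ext fun a => Subtype.ext (cliffordSecHom_cliffordSecHom p q a.2))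

theorem invCliffEquiv_gammaSec {U : GSec EP P} (a : invCliff EP P) (ha : a.1 = gammaSec U) :
    (invCliffEquiv p q a).1 = gammaSec (phi p q U) := by
  rw [← cliffordSecHom_gammaSec, ← ha]
  rfl

/-! ### Clifford modules -/

theorem cliff_mem {n : ℤ} {U : GSec EP P} (hU : IsInvSection U) {η : GForm EP P ℂ}
    (hη : η ∈ weightForms EP P n) (p : CircleBundle EX X EP P) :
    cliff U η ∈ weightForms EP P n := by
  obtain ⟨hs, hw⟩ := (mem_weightForms_iff p n η).mp hη
  refine (mem_weightForms_iff p n _).mpr ⟨fun k z => ?_, isWeight_cliff hU hw⟩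
  have hV := (contMDiffAt_section_iff_vecRep (fun z => (U z).1) z).mp (hU.smooth_vec z)
  exact SmoothFormAt.add ((hs (k + 1) z).inter hV)
    (smoothFormAt_gfwedge (hU.smooth_form z) (fun k => hs k z) k)

/-- Deduced from `tau_cliff` at σ̂_n ψ, both composites of τ_n and σ̂_n being -1. -/
theorem sigmaInv_cliff {n : ℤ} {U : GSec EP P} (hU : IsInvSection U) {ψ : GForm EQ Q (P → ℂ)}
    (hψ : ψ ∈ twistedForms p q n) :
    sigmaInv p q (cliff (phi p q U) ψ) = -cliff U (sigmaInv p q ψ) := by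
  have h1 := sigmaInv_mem p q hψ
  have h2 := tau_cliff p q hU ((mem_weightForms_iff p (-n) _).mp h1).2
  have h3 : -cliff (phi p q U) (-ψ) = cliff (phi p q U) ψ := by
    refine coeffAt_ext fun w z => ?_
    have e1 : coeffAt (-cliff (phi p q U) (-ψ)) w z = -coeffAt (cliff (phi p q U) (-ψ)) w z := rfl
    have e2 : coeffAt (-ψ) w z = -coeffAt ψ w z := rfl
    rw [e1, coeffAt_cliff, coeffAt_cliff, e2, gcontract_neg, gwedge_neg]
    abel
  rw [tau_sigmaInv p q hψ, h3] at h2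
  rw [← h2, sigmaInv_tau p q (cliff_mem hU h1 p)]

end Two

end CircleBundle

end ExoticHori

namespace ExoticHori

open Filter Topology

/-! ### The twisted differentials in coordinates. -/

section GradedDifferential

/-- The value of a form at a point, with the tangent space identified with the model space. -/
def valAt {E : Type*} [NormedAddCommGroup E] [NormedSpace ℝ E] {M : Type*} [TopologicalSpace M]
    [ChartedSpace E M] {F : Type*} [AddCommGroup F] [Module ℝ F] [TopologicalSpace F] {k : ℕ}
    (η : DForm E M k F) (x : M) : E [⋀^Fin k]→L[ℝ] F := η x

variable {E : Type*} [NormedAddCommGroup E] [NormedSpace ℝ E] [FiniteDimensional ℝ E]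
  {M : Type*} [TopologicalSpace M] [ChartedSpace E M] [IsManifold 𝓘(ℝ, E) ∞ M]
  {E' : Type*} [NormedAddCommGroup E'] [NormedSpace ℝ E'] [FiniteDimensional ℝ E']
  {M' : Type*} [TopologicalSpace M'] [ChartedSpace E' M'] [IsManifold 𝓘(ℝ, E') ∞ M']
  {F : Type*} [NormedAddCommGroup F] [NormedSpace ℝ F] [FiniteDimensional ℝ F]

theorem formAt_gextD_add {η ζ : GForm E M F} {x : M} (h1 : ∀ k, SmoothFormAt (η k) x)
    (h2 : ∀ k, SmoothFormAt (ζ k) x) :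
    formAt (gextD (η + ζ)) x = formAt (gextD η) x + formAt (gextD ζ) x := by
  funext k
  cases k with
  | zero => exact (add_zero (0 : E [⋀^Fin 0]→L[ℝ] F)).symm
  | succ k => exact extD_add (h1 k) (h2 k)

theorem gextD_neg (η : GForm E M F) : gextD (-η) = -gextD η := by
  funext k
  cases k with
  | zero => exact (neg_zero (G := DForm E M 0 F)).symm
  | succ k => exact funext fun x => extD_neg (η k) x

theorem formAt_gextD_congr {η ζ : GForm E M F} {x : M} (h : ∀ k, ∀ᶠ y in 𝓝 x, η k y = ζ k y) :
    formAt (gextD η) x = formAt (gextD ζ) x := by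
  funext k
  cases k with
  | zero => exact Eq.trans (b := (0 : E [⋀^Fin 0]→L[ℝ] F)) rfl rfl
  | succ k => exact extD_congr (h k)

theorem smoothFormAt_gextD {η : GForm E M F} {x : M} (h : ∀ k, ∀ᶠ y in 𝓝 x, SmoothFormAt (η k) y)
    (k : ℕ) : SmoothFormAt (gextD η k) x := by
  cases k with
  | zero => exact smoothFormAt_zero
  | succ k => exact SmoothFormAt.extD (h k)

theorem formAt_gextD_gpull {f : M → M'} {η : GForm E' M' F} {x : M}
    (hη : ∀ k, SmoothFormAt (η k) (f x)) (hf : ContMDiffAt 𝓘(ℝ, E) 𝓘(ℝ, E') ∞ f x) :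
    formAt (gextD (gpull f η : GForm E M F)) x = gcomp (dmap E E' f x) (formAt (gextD η) (f x)) := by
  funext k
  cases k with
  | zero => rfl
  | succ k => exact extD_pull (hη k) hf

/-- The Leibniz rule. Degrees 0 and 1 are separate because wedge products vanish below the degree of
the left factor and `gextD` is zero in degree 0. -/
theorem formAt_gextD_gfwedge {α : DForm E M 1 ℝ} {η : GForm E M F} {x : M}
    (hα : SmoothFormAt α x) (hη : ∀ k, SmoothFormAt (η k) x) :
    formAt (gextD (gfwedge α η)) x =
      gwedge (valAt (extD α) x) (formAt η x) - gwedge (valAt α x) (formAt (gextD η) x) := by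
  funext k
  match k with
  | 0 =>
    refine Eq.trans (b := (0 : E [⋀^Fin 0]→L[ℝ] F)) rfl ?_
    have h1 := gwedge_of_lt (by omega : 0 < 2) (valAt (extD α) x) (formAt (E := E) η x)
    have h2 := gwedge_of_lt (by omega : 0 < 1) (valAt α x) (formAt (E := E) (gextD η) x)
    exact ((congrArg₂ (fun a b : E [⋀^Fin 0]→L[ℝ] F => a - b) h1 h2).trans (sub_zero _)).symm
  | 1 =>
    have h0 : gfwedge α η 0 = (0 : DForm E M 0 F) := funext fun y =>
      gwedge_of_lt (by omega : 0 < 1) (valAt α y) (formAt (E := E) η y)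
    have h1 := gwedge_of_lt (by omega : 1 < 2) (valAt (extD α) x) (formAt (E := E) η x)
    have h2 := gwedge_eq (add_zero 1) (valAt α x) (formAt (E := E) (gextD η) x)
    have h3 : extD (gfwedge α η 0) x = 0 := by
      rw [h0]
      have := extD_const_smul (0 : ℝ) (0 : DForm E M 0 F) x
      simpa only [zero_smul] using this
    refine h3.trans ?_
    refine ((congrArg₂ (fun a b : E [⋀^Fin 1]→L[ℝ] F => a - b) h1
      (h2.trans (wedge_zero_right (V := E) _ _))).trans (sub_zero _)).symm
  | k + 2 =>
    have h0 : gfwedge α η (k + 1) = fwedge (add_comm 1 k) α (η k) := funext fun y =>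
      gwedge_eq (add_comm 1 k) (valAt α y) (formAt (E := E) η y)
    have h1 := gwedge_eq (add_comm 2 k) (valAt (extD α) x) (formAt (E := E) η x)
    have h2 := gwedge_eq (add_comm 1 (k + 1)) (valAt α x) (formAt (E := E) (gextD η) x)
    have h3 : extD (gfwedge α η (k + 1)) x = _ := (congrArg (fun β => extD β x) h0).trans
      (extD_fwedge (add_comm 1 k) (add_comm 2 k) (add_comm 1 (k + 1)) hα (hη k))
    refine h3.trans ?_
    refine Eq.trans ?_ (congrArg₂ (fun a b : E [⋀^Fin (k + 2)]→L[ℝ] F => a - b) h1 h2).symm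
    rw [pow_one, neg_one_smul, ← sub_eq_add_neg]
    rfl

/-- The exterior derivative of `f η` for a function `f` with `df = c f τ`. -/
theorem formAt_gextD_smul {x : M} {c : ℂ} {f : M → ℂ} {τ : E [⋀^Fin 1]→L[ℝ] ℝ}
    (hf : MDifferentiableAt 𝓘(ℝ, E) 𝓘(ℝ, ℂ) f x)
    (hτ : ∀ u : E, dmap E ℂ f x u = f x * (c * ((τ ![u] : ℝ) : ℂ)))
    {η : GForm E M ℂ} (hη : ∀ k, SmoothFormAt (η k) x) :
    formAt (gextD (fun k y => f y • η k y)) x =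
      f x • (formAt (gextD η) x + c • gwedge τ (formAt η x)) := by
  funext k
  cases k with
  | zero =>
    refine Eq.trans (b := (0 : E [⋀^Fin 0]→L[ℝ] ℂ)) rfl ?_
    have h2 := gwedge_of_lt (V := E) (by omega : 0 < 1) τ (formAt (E := E) η x)
    have h3 : (f x • (formAt (E := E) (gextD η) x + c • gwedge τ (formAt (E := E) η x)) : GAlt E ℂ) 0 =
      f x • ((0 : E [⋀^Fin 0]→L[ℝ] ℂ) + c • gwedge τ (formAt (E := E) η x) 0) := rfl
    refine Eq.trans ?_ (h3.trans (congrArg (fun b : E [⋀^Fin 0]→L[ℝ] ℂ =>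
      f x • ((0 : E [⋀^Fin 0]→L[ℝ] ℂ) + c • b)) h2)).symm
    module
  | succ k =>
    have h2 := gwedge_eq (V := E) (add_comm 1 k) τ (formAt (E := E) η x)
    refine (extD_complex_smul (c := c) hf hτ (add_comm 1 k) (hη k)).trans ?_
    exact congrArg (fun b : E [⋀^Fin (k + 1)]→L[ℝ] ℂ => f x • (valAt (extD (η k)) x + c • b)) h2.symm

end GradedDifferential

namespace CircleBundle

section One

variable {EX : Type*} [NormedAddCommGroup EX] [NormedSpace ℝ EX] [FiniteDimensional ℝ EX]
  {X : Type*} [TopologicalSpace X] [ChartedSpace EX X] [IsManifold 𝓘(ℝ, EX) ∞ X]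
  {EP : Type*} [NormedAddCommGroup EP] [NormedSpace ℝ EP] [FiniteDimensional ℝ EP]
  {P : Type*} [TopologicalSpace P] [ChartedSpace EP P] [IsManifold 𝓘(ℝ, EP) ∞ P]
  [MulAction Circle P]
  (p : CircleBundle EX X EP P)

/-- The form `A ∧ p^* F' + p^* Ω`. -/
noncomputable def flux (F' : DForm EX X 2 ℝ) (Om : DForm EX X 3 ℝ) : DForm EP P 3 ℝ :=
  fwedge (rfl : 1 + 2 = 3) p.conn (pull p.proj F') + pull p.proj Om

variable {F F' : DForm EX X 2 ℝ} {Om : DForm EX X 3 ℝ}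

theorem smoothFormAt_flux (hF' : ∀ x, SmoothFormAt F' x) (hOm : ∀ x, SmoothFormAt Om x) (z : P) :
    SmoothFormAt (p.flux F' Om) z :=
  ((p.conn_smooth z).fwedge _ ((hF' _).pull p.smooth_proj.contMDiffAt)).add
    ((hOm _).pull p.smooth_proj.contMDiffAt)

theorem asm_def (z : P) (a b : GAlt EX ℂ) :
    p.asm z a b = gcomp (p.dp z) a + gwedge (p.A z) (gcomp (p.dp z) b) := rfl

theorem base_wedge_asm {k : ℕ} (z : P) (β : EX [⋀^Fin k]→L[ℝ] ℝ) (a b : GAlt EX ℂ) :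
    gwedge (β.compContinuousLinearMap (p.dp z)) (p.asm z a b) =
      p.asm z (gwedge β a) ((-1 : ℝ) ^ k • gwedge β b) := by
  rw [asm_def, asm_def, gwedge_add, gwedge_swap, ← gwedge_comp, ← gwedge_comp, gcomp_smul,
    gwedge_smul]

theorem base_wedge_asm_one (z : P) (β : EX [⋀^Fin 1]→L[ℝ] ℝ) (a b : GAlt EX ℂ) :
    gwedge (β.compContinuousLinearMap (p.dp z)) (p.asm z a b) =
      p.asm z (gwedge β a) (-gwedge β b) := by
  rw [base_wedge_asm, pow_one]
  congr 1
  module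

theorem conn_wedge_asm (z : P) (a b : GAlt EX ℂ) : gwedge (p.A z) (p.asm z a b) = p.asm z 0 a := by
  rw [asm_def, asm_def, gwedge_add, gwedge_self, add_zero]
  exact (zero_add _).symm

/-- (A ∧ F' + Ω) ∧ (a + A ∧ b) = Ω ∧ a + A ∧ (F' ∧ a - Ω ∧ b), since A ∧ A = 0 and Ω has odd degree.
-/
theorem flux_wedge_asm (z : P) (a b : GAlt EX ℂ) :
    gwedge (valAt (p.flux F' Om) z) (p.asm z a b) =
      p.asm z (gwedge (valAt Om (p.proj z)) a)
        (gwedge (valAt F' (p.proj z)) a - gwedge (valAt Om (p.proj z)) b) := by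
  have h : (valAt (p.flux F' Om) z) =
      wedge (rfl : 1 + 2 = 3) (p.A z) ((valAt F' (p.proj z)).compContinuousLinearMap (p.dp z)) +
        (valAt Om (p.proj z)).compContinuousLinearMap (p.dp z) := rfl
  rw [h, gwedge_add_left, gwedge_wedge, base_wedge_asm, base_wedge_asm, conn_wedge_asm, ← asm_add,
    zero_add, sub_eq_add_neg]
  congr 2
  rw [Odd.neg_one_pow (by decide)]
  module

/-- As dA is pulled back from F, differentiating the factor A moves F ∧ b into the horizontal
component. -/
theorem formAt_gextD_fasm (hF : pull p.proj F = extD p.conn) {a b : GForm EX X ℂ} {z : P}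
    (ha : ∀ k, SmoothFormAt (a k) (p.proj z)) (hb : ∀ k, SmoothFormAt (b k) (p.proj z)) :
    formAt (gextD (p.fasm a b)) z = p.asm z
      (formAt (gextD a) (p.proj z) + gwedge (valAt F (p.proj z)) (formAt b (p.proj z)))
      (-formAt (gextD b) (p.proj z)) := by
  have hπ := p.smooth_proj.contMDiffAt (x := z)
  have hb' : ∀ k, SmoothFormAt (gpull p.proj b k : DForm EP P k ℂ) z := fun k => (hb k).pull hπ
  have e1 := congrFun hF z
  have e2 : valAt (extD p.conn) z = (valAt F (p.proj z)).compContinuousLinearMap (p.dp z) := e1.symm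
  have e3 := formAt_gextD_gfwedge (p.conn_smooth z) hb'
  have e4 := formAt_gextD_gpull (f := p.proj) hb hπ
  have e5 := formAt_gextD_gpull (f := p.proj) ha hπ
  have e6 : formAt (E := EP) (gpull p.proj b) z = gcomp (p.dp z) (formAt b (p.proj z)) := rfl
  rw [fasm, formAt_gextD_add (η := gpull p.proj a) (fun k => (ha k).pull hπ) (smoothFormAt_gfwedge (p.conn_smooth z) hb'),
    e3, e4, e5, e6]
  refine Eq.trans (congrArg (fun β : EP [⋀^Fin 2]→L[ℝ] ℝ => gcomp (p.dp z) (formAt (gextD a)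
    (p.proj z)) + (gwedge β (gcomp (p.dp z) (formAt (E := EX) b (p.proj z))) - gwedge (p.A z)
      (gcomp (p.dp z) (formAt (E := EX) (gextD b) (p.proj z))))) e2) ?_
  rw [← gwedge_comp, asm_def, gcomp_add, gcomp_neg, gwedge_neg]
  abel

theorem mfderiv_rot_zpow {θ : P → ℝ} {z : P} (n : ℤ)
    (hθ : MDifferentiableAt 𝓘(ℝ, EP) 𝓘(ℝ, ℝ) θ z) :
    MDifferentiableAt 𝓘(ℝ, EP) 𝓘(ℝ, ℂ) (fun y => (rot (θ y) : ℂ) ^ n) z ∧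
      ∀ u, dmap EP ℂ (fun y => (rot (θ y) : ℂ) ^ n) z u =
        (rot (θ z) : ℂ) ^ n * (2 * Real.pi * Complex.I * n * (dmap EP ℝ θ z u : ℝ)) := by
  have e : (fun y => (rot (θ y) : ℂ) ^ n) =
      fun y => (fun t : ℝ => Complex.exp (2 * Real.pi * Complex.I * n * t)) (θ y) :=
    funext fun y => rot_zpow _ _
  have h1 := hasDerivAt_exp_mul (2 * Real.pi * Complex.I * n) (θ z)
  have h2 : MDifferentiableAt 𝓘(ℝ, ℝ) 𝓘(ℝ, ℂ)
      (fun t : ℝ => Complex.exp (2 * Real.pi * Complex.I * n * t)) (θ z) :=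
    h1.differentiableAt.mdifferentiableAt
  rw [e]
  refine ⟨h2.comp z hθ, fun u => ?_⟩
  rw [dmap_comp z h2 hθ, ContinuousLinearMap.comp_apply]
  have h3 : dmap ℝ ℂ (fun t : ℝ => Complex.exp (2 * Real.pi * Complex.I * n * t)) (θ z) =
      fderiv ℝ (fun t : ℝ => Complex.exp (2 * Real.pi * Complex.I * n * t)) (θ z) :=
    mfderiv_eq_fderiv
  rw [h3, h1.hasFDerivAt.fderiv, rot_zpow]
  simp only [ContinuousLinearMap.toSpanSingleton_apply, Complex.real_smul]
  ring

/-- The exterior derivative of a form of weight `-n` in terms of a local section. -/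
theorem formAt_gextD_weight (hF : pull p.proj F = extD p.conn) {n : ℤ} {η : GForm EP P ℂ}
    (hη : η ∈ weightForms EP P (-n)) (z : P) {a b : GForm EX X ℂ} {α : EX [⋀^Fin 1]→L[ℝ] ℝ}
    (ha : a = p.secH (p.secThrough z) η) (hb : b = secV (p.secThrough z) η)
    (hα : α = (p.A z).compContinuousLinearMap (dmap EX EP (p.secThrough z) (p.proj z))) :
    formAt (gextD η) z = p.asm z
      (formAt (gextD a) (p.proj z) + gwedge (valAt F (p.proj z)) (formAt b (p.proj z)) +
        (2 * Real.pi * Complex.I * n : ℂ) • gwedge α (formAt a (p.proj z)))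
      (-formAt (gextD b) (p.proj z) - (2 * Real.pi * Complex.I * n : ℂ) •
        (formAt a (p.proj z) + gwedge α (formAt b (p.proj z)))) := by
  obtain ⟨hs, hw⟩ := (mem_weightForms_iff p (-n) η).mp hη
  obtain ⟨U, hU, hz, hsU, hps, hsz, θ, hθ, h0, hr⟩ := p.exists_section z
  set s := p.secThrough z
  have hsx := p.isLocalSection_of_isOpen hU hsU hps hz
  have hθz : MDifferentiableAt 𝓘(ℝ, EP) 𝓘(ℝ, ℝ) θ z := hθ.self_of_nhds.mdifferentiableAt (by simp)
  have hnhds := p.smooth_proj.continuous.continuousAt.preimage_mem_nhds (hU.mem_nhds hz)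
  have has : ∀ k, SmoothFormAt (a k) (p.proj z) := fun k => by
    rw [ha]; exact smoothFormAt_secH hsx.smooth (fun k => hs k _) k
  have hbs : ∀ k, SmoothFormAt (b k) (p.proj z) := fun k => by
    rw [hb]; exact smoothFormAt_secV hsx.smooth p (fun k => hs k _) k
  -- Near z the point y is `rot (θ y)` applied to the section, so the weight contributes the factor
  -- e^{-2πinθ} and the coordinates are those along the section.
  have hloc : ∀ k, ∀ᶠ y in 𝓝 z, η k y = (rot (θ y) : ℂ) ^ (-n) • p.fasm a b k y := by
    intro k
    filter_upwards [hnhds] with y hy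
    have h1 := IsWeight.formAt_smul p hw (rot (θ y)) (s (p.proj y))
    have hsy := p.isLocalSection_of_isOpen hU hsU hps hy
    rw [hr y hy, ← hsy.formAt_secH, ← hsy.formAt_secV, ← ha, ← hb] at h1
    exact congrFun h1 k
  obtain ⟨hf, hdf⟩ := mfderiv_rot_zpow (-n) hθz
  rw [formAt_gextD_congr hloc]
  have hdθ := p.dangle (hsx.smooth.mdifferentiableAt (by simp)) hθz hsz h0
    (by filter_upwards [hnhds] with y hy using hr y hy)
  -- dθ = A - π^*α. The part -π^*α gives the connection terms, and the part A gives -2πin a in the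
  -- vertical component.
  have hτ : ∀ u, dmap EP ℝ θ z u = (p.A z - α.compContinuousLinearMap (p.dp z)) ![u] := fun u => by
    rw [hdθ u, ContinuousAlternatingMap.sub_apply, one_form_comp_apply, hα, one_form_comp_apply]
  simp only [hτ] at hdf
  rw [formAt_gextD_smul hf hdf (smoothFormAt_fasm p has hbs), h0, rot_zero,
    p.formAt_gextD_fasm hF has hbs, formAt_fasm, sub_eq_add_neg (p.A z), gwedge_add_left,
    gwedge_neg_left, base_wedge_asm_one, conn_wedge_asm, ← asm_neg, ← asm_add, ← asm_smul, ← asm_add]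
  simp only [Circle.coe_one, one_zpow, one_smul]
  push_cast
  congr 1 <;> module

theorem formAt_twistedDeRham (hF : pull p.proj F = extD p.conn) {n : ℤ} {η : GForm EP P ℂ}
    (hη : η ∈ weightForms EP P (-n)) (z : P) {a b : GForm EX X ℂ} {α : EX [⋀^Fin 1]→L[ℝ] ℝ}
    (ha : a = p.secH (p.secThrough z) η) (hb : b = secV (p.secThrough z) η)
    (hα : α = (p.A z).compContinuousLinearMap (dmap EX EP (p.secThrough z) (p.proj z))) :
    formAt (twistedDeRham (p.flux F' Om) η) z = p.asm z
      (formAt (gextD a) (p.proj z) + gwedge (valAt F (p.proj z)) (formAt b (p.proj z)) +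
        (2 * Real.pi * Complex.I * n : ℂ) • gwedge α (formAt a (p.proj z)) +
        gwedge (valAt Om (p.proj z)) (formAt a (p.proj z)))
      (-formAt (gextD b) (p.proj z) - (2 * Real.pi * Complex.I * n : ℂ) •
        (formAt a (p.proj z) + gwedge α (formAt b (p.proj z))) +
        (gwedge (valAt F' (p.proj z)) (formAt a (p.proj z)) -
          gwedge (valAt Om (p.proj z)) (formAt b (p.proj z)))) := by
  have h1 : formAt (twistedDeRham (p.flux F' Om) η) z = formAt (gextD η) z +
    gwedge (valAt (p.flux F' Om) z) (formAt η z) := rfl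
  obtain ⟨U, hU, hz, hsU, hps, hsz, -⟩ := p.exists_section z
  have hsx := p.isLocalSection_of_isOpen hU hsU hps hz
  have e1 := hsx.formAt_secH η
  have e2 := hsx.formAt_secV η
  rw [hsz, ← ha] at e1
  rw [hsz, ← hb] at e2
  have h2 : formAt η z = p.asm z (formAt a (p.proj z)) (formAt b (p.proj z)) := by
    rw [e1, e2, asm_parts]
  rw [h1, p.formAt_gextD_weight hF hη z ha hb hα]
  rw [asm_add, ← flux_wedge_asm, h2]

theorem isWeight_gextD (p : CircleBundle EX X EP P) {n : ℤ} {η : GForm EP P ℂ}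
    (hs : ∀ k z, SmoothFormAt (η k) z) (hη : IsWeight EP n η) : IsWeight EP n (gextD η) := by
  intro c z
  have h1 := formAt_gextD_gpull (f := fun y : P => c • y) (fun k => hs k (c • z))
    (p.contMDiff_smul c).contMDiffAt
  refine h1.symm.trans ?_
  have h2 : gpull (fun y : P => c • y) η = fun k y => (c : ℂ) ^ n • η k y := by
    funext k y
    exact congrFun (hη c y) k
  -- A constant function satisfies df = c f τ with c = 0 and τ = 0.
  have h3 := formAt_gextD_smul (x := z) (c := 0) (f := fun _ : P => (c : ℂ) ^ n)
    (τ := (0 : EP [⋀^Fin 1]→L[ℝ] ℝ)) mdifferentiableAt_const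
    (fun u => by rw [dmap_const]; simp) (fun k => hs k z)
  refine (congrArg (fun ζ => formAt (E := EP) (gextD ζ) z) h2).trans (h3.trans ?_)
  exact congrArg (fun ζ : GAlt EP ℂ => (c : ℂ) ^ n • ζ)
    ((congrArg (fun ζ : GAlt EP ℂ => formAt (gextD η) z + ζ) (zero_smul ℂ _)).trans (add_zero _))

theorem isWeight_flux_wedge {n : ℤ} {η : GForm EP P ℂ} (hη : IsWeight EP n η) :
    IsWeight EP n (gfwedge (p.flux F' Om) η) := by
  intro c z
  have e : ∀ z, formAt (gfwedge (p.flux F' Om) η) z = p.asm z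
      (gwedge (valAt Om (p.proj z)) (p.hpart z (formAt η z)))
      (gwedge (valAt F' (p.proj z)) (p.hpart z (formAt η z)) -
        gwedge (valAt Om (p.proj z)) (p.vpart z (formAt η z))) := fun z => by
    rw [← flux_wedge_asm, asm_parts]
    rfl
  rw [e, e, asm_dact, IsWeight.vpart_smul hη, IsWeight.hpart_smul hη, p.proj_smul, gwedge_smul,
    gwedge_smul, gwedge_smul, ← asm_smul]
  congr 1
  module

theorem twistedDeRham_mem (hF' : ∀ x, SmoothFormAt F' x) (hOm : ∀ x, SmoothFormAt Om x) {n : ℤ}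
    {η : GForm EP P ℂ} (hη : η ∈ weightForms EP P n) :
    twistedDeRham (p.flux F' Om) η ∈ weightForms EP P n := by
  obtain ⟨hs, hw⟩ := (mem_weightForms_iff p n η).mp hη
  refine (mem_weightForms_iff p n _).mpr ⟨fun k z => ?_,
    CircleBundle.IsWeight.add (p.isWeight_gextD hs hw) (p.isWeight_flux_wedge hw)⟩
  exact (smoothFormAt_gextD (fun k => Eventually.of_forall (hs k)) k).add
    (smoothFormAt_gfwedge (p.smoothFormAt_flux hF' hOm z) (fun k => hs k z) k)

theorem twistedDeRham_neg (K : DForm EP P 3 ℝ) (η : GForm EP P ℂ) :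
    twistedDeRham K (-η) = -twistedDeRham K η := by
  have h : gfwedge K (-η) = -gfwedge K η := gform_ext fun z =>
    gwedge_neg (valAt K z) (formAt η z)
  rw [twistedDeRham, gextD_neg, h, ← neg_add]
  rfl

end One

section Two

variable {EX : Type*} [NormedAddCommGroup EX] [NormedSpace ℝ EX] [FiniteDimensional ℝ EX]
  {X : Type*} [TopologicalSpace X] [ChartedSpace EX X] [IsManifold 𝓘(ℝ, EX) ∞ X]
  {EP : Type*} [NormedAddCommGroup EP] [NormedSpace ℝ EP] [FiniteDimensional ℝ EP]
  {P : Type*} [TopologicalSpace P] [ChartedSpace EP P] [IsManifold 𝓘(ℝ, EP) ∞ P]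
  [MulAction Circle P]
  {EQ : Type*} [NormedAddCommGroup EQ] [NormedSpace ℝ EQ] [FiniteDimensional ℝ EQ]
  {Q : Type*} [TopologicalSpace Q] [ChartedSpace EQ Q] [IsManifold 𝓘(ℝ, EQ) ∞ Q]
  [MulAction Circle Q]
  (p : CircleBundle EX X EP P) (q : CircleBundle EX X EQ Q)

theorem coeffAt_twistedD (n : ℤ) (K : DForm EQ Q 3 ℝ) (ψ : GForm EQ Q (P → ℂ)) {w : Q} {z : P}
    (h : p.proj z = q.proj w) :
    coeffAt (twistedD p q n K ψ) w z =
      formAt (E := EQ) (gextD fun k => coeff q (p.secThrough z) (ψ k)) w +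
        (2 * Real.pi * Complex.I * n : ℂ) • gwedge
          (((p.A (p.secThrough z (q.proj w))).compContinuousLinearMap
            (dmap EX EP (p.secThrough z) (q.proj w))).compContinuousLinearMap (q.dp w))
          (formAt (E := EQ) (fun k => coeff q (p.secThrough z) (ψ k)) w) -
        (2 * Real.pi * Complex.I * n : ℂ) • gcontract (vv EQ w) (coeffAt ψ w z) +
        gwedge (valAt K w) (coeffAt ψ w z) := by
  have h1 : coeffAt (gfwedge K ψ) w z = gwedge (valAt K w) (coeffAt ψ w z) :=
    gpost_gwedge (V := EQ) (ContinuousLinearMap.proj (R := ℝ) (φ := fun _ : P => ℂ) z)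
      (valAt K w) (formAt ψ w)
  have h2 : coeffAt (covD p q n ψ) w z =
      formAt (E := EQ) (gextD fun k => coeff q (p.secThrough z) (ψ k)) w +
        (2 * Real.pi * Complex.I * n : ℂ) • gwedge
          (((p.A (p.secThrough z (q.proj w))).compContinuousLinearMap
            (dmap EX EP (p.secThrough z) (q.proj w))).compContinuousLinearMap (q.dp w))
          (formAt (E := EQ) (fun k => coeff q (p.secThrough z) (ψ k)) w) := by
    funext k
    ext u
    exact congrArg (fun α : EQ [⋀^Fin k]→L[ℝ] ℂ => α u) (if_pos h)
  rw [← h1, ← h2]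
  rfl

theorem coeffAt_twistedD_of_ne (n : ℤ) (K : DForm EQ Q 3 ℝ) {ψ : GForm EQ Q (P → ℂ)} {w : Q} {z : P}
    (h : p.proj z ≠ q.proj w) (hψ : coeffAt ψ w z = 0) :
    coeffAt (twistedD p q n K ψ) w z = 0 := by
  have h1 : coeffAt (gfwedge K ψ) w z = gwedge (valAt K w) (coeffAt ψ w z) :=
    gpost_gwedge (V := EQ) (ContinuousLinearMap.proj (R := ℝ) (φ := fun _ : P => ℂ) z)
      (valAt K w) (formAt ψ w)
  have h2 : coeffAt (covD p q n ψ) w z = 0 := by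
    funext k
    ext u
    exact congrArg (fun α : EQ [⋀^Fin k]→L[ℝ] ℂ => α u) (if_neg h)
  have h3 : coeffAt (twistedD p q n K ψ) w z = coeffAt (covD p q n ψ) w z -
    (2 * Real.pi * Complex.I * n : ℂ) • gcontract (vv EQ w) (coeffAt ψ w z) +
      coeffAt (gfwedge K ψ) w z := rfl
  rw [h3, h1, h2, hψ, gwedge_zero]
  have h4 : gcontract (vv EQ w) (0 : GAlt EQ ℂ) = 0 := rfl
  rw [h4]
  module

variable {F F' : DForm EX X 2 ℝ} {Om : DForm EX X 3 ℝ}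

/-- Compare coordinates. With ν = 2πin, the twisted differential on `Q` takes (b, -a) to (db - F' ∧
a + ν α ∧ b + ν a + Ω ∧ b, da + F ∧ b + ν α ∧ a + Ω ∧ a), where ν a comes from the contraction with
v̂. This is minus the quarter turn of (d + H)(a, b). -/
theorem tau_twistedDeRham (hF : pull p.proj F = extD p.conn) (hF' : pull q.proj F' = extD q.conn)
    (hFs' : ∀ x, SmoothFormAt F' x) (hOms : ∀ x, SmoothFormAt Om x) {n : ℤ}
    {η : GForm EP P ℂ} (hη : η ∈ weightForms EP P (-n)) :
    tau p q n (twistedDeRham (p.flux F' Om) η) =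
      -twistedD p q n (q.flux F Om) (tau p q n η) := by
  obtain ⟨hs, hw⟩ := (mem_weightForms_iff p (-n) η).mp hη
  have hD := ((mem_weightForms_iff p (-n) _).mp (p.twistedDeRham_mem hFs' hOms hη)).2
  refine coeffAt_ext fun w z => ?_
  have e : coeffAt (-twistedD p q n (q.flux F Om) (tau p q n η)) w z =
    -coeffAt (twistedD p q n (q.flux F Om) (tau p q n η)) w z := rfl
  rw [e]
  by_cases h : p.proj z = q.proj w
  swap
  · rw [coeffAt_tau_of_ne p q _ h, coeffAt_twistedD_of_ne p q n _ h (coeffAt_tau_of_ne p q _ h),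
      neg_zero]
  obtain ⟨U, hU, hz, hsU, hps, hsz, -⟩ := p.exists_section z
  have hsx := p.isLocalSection_of_isOpen hU hsU hps hz
  rw [h] at hsx hsz hz
  obtain ⟨a, ha⟩ : ∃ a, a = p.secH (p.secThrough z) η := ⟨_, rfl⟩
  obtain ⟨b, hb⟩ : ∃ b : GForm EX X ℂ, b = secV (p.secThrough z) η := ⟨_, rfl⟩
  obtain ⟨α, hα⟩ : ∃ α : EX [⋀^Fin 1]→L[ℝ] ℝ, α = (p.A z).compContinuousLinearMap
    (dmap EX EP (p.secThrough z) (p.proj z)) := ⟨_, rfl⟩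
  have has : ∀ k, SmoothFormAt (a k) (q.proj w) := fun k => by
    rw [ha]; exact smoothFormAt_secH hsx.smooth (fun k => hs k _) k
  have hbs : ∀ k, SmoothFormAt (b k) (q.proj w) := fun k => by
    rw [hb]; exact smoothFormAt_secV hsx.smooth p (fun k => hs k _) k
  have hloc : ∀ k, ∀ᶠ y in 𝓝 w, coeff q (p.secThrough z) (tau p q n η k) y =
      q.fasm b (-a) k y := fun k => by
    rw [ha, hb]
    refine coeff_tau_eventually p q hw ?_ k
    filter_upwards [hU.mem_nhds hz] with x hx using p.isLocalSection_of_isOpen hU hsU hps hx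
  have h1 : formAt (E := EQ) (fun k => coeff q (p.secThrough z) (tau p q n η k)) w =
      q.asm w (formAt b (q.proj w)) (-formAt a (q.proj w)) :=
    funext fun k => (hloc k).self_of_nhds
  have h2 : coeffAt (tau p q n η) w z = q.asm w (formAt b (q.proj w)) (-formAt a (q.proj w)) := by
    rw [← h1, formAt_coeff, hsz]
  have h3 := formAt_gextD_congr hloc
  rw [q.formAt_gextD_fasm hF' (b := -a) hbs (fun k => (has k).neg), gextD_neg] at h3
  have h4 : (p.A (p.secThrough z (q.proj w))).compContinuousLinearMap
      (dmap EX EP (p.secThrough z) (q.proj w)) = α := by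
    rw [hα, hsz, h]
  -- The contraction with v̂ takes the coordinates (b, -a) to (-a, 0).
  have h5 : gcontract (vv EQ w) (q.asm w (formAt b (q.proj w)) (-formAt a (q.proj w))) =
      q.asm w (-formAt a (q.proj w)) 0 := by
    rw [asm_def, asm_def]
    have := (q.isSplitting w).gcontract_vert_assemble (formAt b (q.proj w)) (-formAt a (q.proj w))
    refine this.trans ?_
    have h6 : gcomp (q.dp w) (0 : GAlt EX ℂ) = 0 := rfl
    rw [h6, gwedge_zero, add_zero]
  rw [coeffAt_tau p q hD h, p.formAt_twistedDeRham hF hη z ha hb hα, hpart_asm, vpart_asm,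
    coeffAt_twistedD p q n _ _ h, h1, h2, h3, h4, h5, flux_wedge_asm, base_wedge_asm_one,
    ← asm_smul, ← asm_smul, sub_eq_add_neg (_ + _), ← asm_neg, ← asm_add, ← asm_add, ← asm_add,
    ← asm_neg, h]
  have e1 : formAt (-a) (q.proj w) = -formAt a (q.proj w) := rfl
  have e2 : formAt (-gextD a) (q.proj w) = -formAt (gextD a) (q.proj w) := rfl
  rw [e1, e2]
  simp only [gwedge_neg]
  congr 1 <;> module

theorem sigmaInv_neg {n : ℤ} {ψ : GForm EQ Q (P → ℂ)} (hψ : ψ ∈ twistedForms p q n) :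
    sigmaInv p q (-ψ) = -sigmaInv p q ψ := by
  have h := sigmaInv_linear p q (-1) 0 hψ hψ
  have e1 : (-1 : ℂ) • ψ + (0 : ℂ) • ψ = -ψ := by
    funext k w
    ext u z
    change (-1 : ℂ) * ψ k w u z + 0 * ψ k w u z = -ψ k w u z
    ring
  have e2 : (-1 : ℂ) • sigmaInv p q ψ + (0 : ℂ) • sigmaInv p q ψ = -sigmaInv p q ψ := by
    funext k z
    ext u
    change (-1 : ℂ) * sigmaInv p q ψ k z u + 0 * sigmaInv p q ψ k z u = -sigmaInv p q ψ k z u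
    ring
  rwa [e1, e2] at h

/-- Every ψ is τ_n of some form, so the claim is inherited from d + H. No direct check of smoothness
or equivariance of the covariant derivative is needed. -/
theorem twistedD_mem (hF : pull p.proj F = extD p.conn) (hF' : pull q.proj F' = extD q.conn)
    (hFs' : ∀ x, SmoothFormAt F' x) (hOms : ∀ x, SmoothFormAt Om x) {n : ℤ}
    {ψ : GForm EQ Q (P → ℂ)} (hψ : ψ ∈ twistedForms p q n) :
    twistedD p q n (q.flux F Om) ψ ∈ twistedForms p q n := by
  obtain ⟨η, hη, rfl⟩ := (bijOn_tau p q n).surjOn hψ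
  have h := tau_twistedDeRham p q hF hF' hFs' hOms hη
  rw [← neg_eq_iff_eq_neg] at h
  rw [← h]
  exact neg_mem_twistedForms (tau_mem p q (p.twistedDeRham_mem hFs' hOms hη))

theorem sigmaInv_twistedD (hF : pull p.proj F = extD p.conn) (hF' : pull q.proj F' = extD q.conn)
    (hFs' : ∀ x, SmoothFormAt F' x) (hOms : ∀ x, SmoothFormAt Om x) {n : ℤ}
    {ψ : GForm EQ Q (P → ℂ)} (hψ : ψ ∈ twistedForms p q n) :
    sigmaInv p q (twistedD p q n (q.flux F Om) ψ) =
      -twistedDeRham (p.flux F' Om) (sigmaInv p q ψ) := by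
  obtain ⟨η, hη, rfl⟩ := (bijOn_tau p q n).surjOn hψ
  have hm := p.twistedDeRham_mem hFs' hOms hη
  have h := tau_twistedDeRham p q hF hF' hFs' hOms hη
  rw [← neg_eq_iff_eq_neg] at h
  rw [← h, sigmaInv_neg p q (tau_mem p q hm), sigmaInv_tau p q hm, sigmaInv_tau p q hη,
    twistedDeRham_neg]

end Two

end CircleBundle

end ExoticHori

namespace ExoticHori

open Filter Topology

/-! ### The twisted Courant bracket in terms of the base. -/

section Values

variable {V W : Type*} [AddCommGroup V] [Module ℝ V] [TopologicalSpace V]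
  [AddCommGroup W] [Module ℝ W] [TopologicalSpace W]
  {F : Type*} [AddCommGroup F] [Module ℝ F] [TopologicalSpace F]

theorem two_form_comp_apply (α : V [⋀^Fin 2]→L[ℝ] F) (L : W →L[ℝ] V) (u w : W) :
    α.compContinuousLinearMap L ![u, w] = α ![L u, L w] := by
  rw [ContinuousAlternatingMap.compContinuousLinearMap_apply]
  congr 1
  funext i
  fin_cases i <;> rfl

theorem three_form_comp_apply (α : V [⋀^Fin 3]→L[ℝ] F) (L : W →L[ℝ] V) (t u w : W) :
    α.compContinuousLinearMap L ![t, u, w] = α ![L t, L u, L w] := by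
  rw [ContinuousAlternatingMap.compContinuousLinearMap_apply]
  congr 1
  funext i
  fin_cases i <;> rfl

variable [IsTopologicalAddGroup F] [ContinuousSMul ℝ F]

theorem two_form_swap (α : V [⋀^Fin 2]→L[ℝ] F) (u w : V) : α ![u, w] = -α ![w, u] :=
  congrArg (fun β : V [⋀^Fin 0]→L[ℝ] F => β ![]) (contract_contract_swap w u α)

theorem wedge_zero_one_apply (h : 0 + 1 = 1) (α : V [⋀^Fin 0]→L[ℝ] ℝ) (β : V [⋀^Fin 1]→L[ℝ] F)
    (u : V) : wedge h α β ![u] = α ![] • β ![u] := by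
  rw [wedge_deg_zero]
  rfl

theorem wedge_zero_two_apply (h : 0 + 2 = 2) (α : V [⋀^Fin 0]→L[ℝ] ℝ) (β : V [⋀^Fin 2]→L[ℝ] F)
    (u w : V) : wedge h α β ![u, w] = α ![] • β ![u, w] := by
  rw [wedge_deg_zero]
  rfl

theorem wedge_zero_zero_apply (h : 0 + 0 = 0) (α : V [⋀^Fin 0]→L[ℝ] ℝ) (β : V [⋀^Fin 0]→L[ℝ] F) :
    wedge h α β ![] = α ![] • β ![] := by
  rw [wedge_deg_zero]
  rfl

theorem wedge_one_zero_apply (h : 1 + 0 = 1) (α : V [⋀^Fin 1]→L[ℝ] ℝ) (β : V [⋀^Fin 0]→L[ℝ] F)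
    (u : V) : wedge h α β ![u] = α ![u] • β ![] :=
  congrArg (fun γ : V [⋀^Fin 0]→L[ℝ] F => γ ![]) (contract_wedge_one_zero h u α β)

theorem wedge_one_two_apply (h : 1 + 2 = 3) (α : V [⋀^Fin 1]→L[ℝ] ℝ) (β : V [⋀^Fin 2]→L[ℝ] F)
    (t u w : V) : wedge h α β ![t, u, w] =
      α ![t] • β ![u, w] - α ![u] • β ![t, w] + α ![w] • β ![t, u] := by
  have h1 := congrArg (fun γ : V [⋀^Fin 2]→L[ℝ] F => γ ![u, w])
    (contract_wedge_one (l := 1) h rfl t α β)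
  refine h1.trans ?_
  have h2 := wedge_one_one_apply (rfl : 1 + 1 = 2) α (contract t β) u w
  have h3 : (α ![t] • β - wedge (rfl : 1 + 1 = 2) α (contract t β)) ![u, w] =
    α ![t] • β ![u, w] - wedge (rfl : 1 + 1 = 2) α (contract t β) ![u, w] := rfl
  refine h3.trans ?_
  rw [h2, sub_sub_eq_add_sub, sub_add_eq_add_sub]
  rfl

end Values

/-- The value of a vector field at a point, with the tangent space identified with the model
space. -/
def vecAt {E : Type*} [NormedAddCommGroup E] [NormedSpace ℝ E] {M : Type*} [TopologicalSpace M]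
    [ChartedSpace E M] (V : VField E M) (x : M) : E := V x

namespace CircleBundle

section One

variable {EX : Type*} [NormedAddCommGroup EX] [NormedSpace ℝ EX] [FiniteDimensional ℝ EX]
  {X : Type*} [TopologicalSpace X] [ChartedSpace EX X] [IsManifold 𝓘(ℝ, EX) ∞ X]
  {EP : Type*} [NormedAddCommGroup EP] [NormedSpace ℝ EP] [FiniteDimensional ℝ EP]
  {P : Type*} [TopologicalSpace P] [ChartedSpace EP P] [IsManifold 𝓘(ℝ, EP) ∞ P]
  [MulAction Circle P]
  {p : CircleBundle EX X EP P}
  {U W : GSec EP P} {x x' : VField EX X} {f f' g g' : DForm EX X 0 ℝ} {θ θ' : DForm EX X 1 ℝ}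
  {F F' : DForm EX X 2 ℝ} {Om : DForm EX X 3 ℝ}

theorem valAt_extD_pull_zero {G : Type*} [NormedAddCommGroup G] [NormedSpace ℝ G]
    [FiniteDimensional ℝ G] (p : CircleBundle EX X EP P) {h : DForm EX X 0 G} {z : P}
    (hh : SmoothFormAt h (p.proj z)) (u : EP) :
    valAt (extD (pull p.proj h : DForm EP P 0 G)) z ![u] =
      valAt (extD h) (p.proj z) ![p.dp z u] := by
  have h1 : valAt (extD (pull p.proj h : DForm EP P 0 G)) z =
      (valAt (extD h) (p.proj z)).compContinuousLinearMap (p.dp z) :=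
    extD_pull hh p.smooth_proj.contMDiffAt
  rw [h1, one_form_comp_apply]

/-- The formula for dβ(V, W) is applied to dπ in a chart, a vector-valued 1-form whose exterior
derivative vanishes at z; it expresses dπ([V, W]) through x and x'. -/
theorem dp_dorfman (hU : p.HasBase U x f g θ) (hW : p.HasBase W x' f' g' θ') (H : DForm EP P 3 ℝ)
    (z : P) : p.dp z (gvec (dorfman H U W z)) =
      valAt (extD (inter x' (chartForm (p.proj z)))) (p.proj z) ![vecAt x (p.proj z)] -
        valAt (extD (inter x (chartForm (p.proj z)))) (p.proj z) ![vecAt x' (p.proj z)] := by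
  have hm := mem_extChartAt_source (I := 𝓘(ℝ, EX)) (p.proj z)
  have hc := smoothFormAt_chartForm hm
  have h1 := extD_one_form (p.smoothFormAt_projForm hm) (hU.contDiffAt_vec z) (hW.contDiffAt_vec z)
  have h2 : extD (p.projForm (p.proj z)) z = 0 := by
    refine (extD_pull hc p.smooth_proj.contMDiffAt).trans ?_
    have h3 := extD_chartForm (EX := EX) (p.proj z)
    exact congrArg (fun α : EX [⋀^Fin 2]→L[ℝ] EX => α.compContinuousLinearMap (p.dp z)) h3
  have h4 := p.projForm_apply (p.proj z) z (gvec (dorfman H U W z))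
  rw [chartForm_self] at h4
  rw [hU.inter_projForm, hW.inter_projForm, h2] at h1
  have h5 := p.valAt_extD_pull_zero (hc.inter (hW.smooth_vec _)) (gvec (U z))
  have h6 := p.valAt_extD_pull_zero (hc.inter (hU.smooth_vec _)) (gvec (W z))
  rw [hU.vec] at h5
  rw [hW.vec] at h6
  have h7 : (0 : EX) = valAt (extD (inter x' (chartForm (p.proj z)))) (p.proj z)
        ![vecAt x (p.proj z)] -
      valAt (extD (inter x (chartForm (p.proj z)))) (p.proj z) ![vecAt x' (p.proj z)] -
      p.dp z (gvec (dorfman H U W z)) := by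
    refine Eq.trans h1 (congrArg₂ (fun a b : EX => a - b) (congrArg₂ (fun a b : EX => a - b) h5 h6)
      h4)
  exact (sub_eq_zero.mp h7.symm).symm

/-- The same formula applied to A, with dA = π^*F. -/
theorem A_dorfman (hF : pull p.proj F = extD p.conn) (hU : p.HasBase U x f g θ)
    (hW : p.HasBase W x' f' g' θ') (H : DForm EP P 3 ℝ) (z : P) :
    p.A z ![gvec (dorfman H U W z)] =
      valAt (extD f') (p.proj z) ![vecAt x (p.proj z)] -
        valAt (extD f) (p.proj z) ![vecAt x' (p.proj z)] +
        valAt F (p.proj z) ![vecAt x' (p.proj z), vecAt x (p.proj z)] := by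
  have h1 := extD_one_form (p.conn_smooth z) (hU.contDiffAt_vec z) (hW.contDiffAt_vec z)
  rw [hU.inter_conn, hW.inter_conn, ← hF] at h1
  have h5 := p.valAt_extD_pull_zero (z := z) (hW.smooth_conn _) (gvec (U z))
  have h6 := p.valAt_extD_pull_zero (z := z) (hU.smooth_conn _) (gvec (W z))
  have h3 := two_form_comp_apply (valAt F (p.proj z)) (p.dp z) (gvec (U z)) (gvec (W z))
  rw [hU.vec] at h5
  rw [hW.vec] at h6
  rw [hU.vec, hW.vec] at h3
  have h8 := two_form_swap (valAt F (p.proj z)) (vecAt x (p.proj z)) (vecAt x' (p.proj z))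
  have h7 : valAt F (p.proj z) ![vecAt x (p.proj z), vecAt x' (p.proj z)] =
      valAt (extD f') (p.proj z) ![vecAt x (p.proj z)] -
        valAt (extD f) (p.proj z) ![vecAt x' (p.proj z)] - p.A z ![gvec (dorfman H U W z)] :=
    h3.symm.trans (h1.trans (congrArg₂ (fun a b : ℝ => a - b)
      (congrArg₂ (fun a b : ℝ => a - b) h5 h6) rfl))
  linarith

/-- The horizontal part of the form part of the Dorfman bracket. -/
noncomputable def dorfmanHor (x x' : VField EX X) (f f' g g' : DForm EX X 0 ℝ)
    (θ θ' : DForm EX X 1 ℝ) (F F' : DForm EX X 2 ℝ) (Om : DForm EX X 3 ℝ) (y : X) (b : EX) : ℝ :=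
  valAt (extD (inter x θ')) y ![b] + valAt g' y ![] * valAt (extD f) y ![b] +
    valAt f' y ![] * valAt (extD g) y ![b] + valAt (extD θ') y ![vecAt x y, b] -
    valAt (extD θ) y ![vecAt x' y, b] + valAt g' y ![] * valAt F y ![vecAt x y, b] -
    valAt g y ![] * valAt F y ![vecAt x' y, b] + valAt f' y ![] * valAt F' y ![vecAt x y, b] -
    valAt f y ![] * valAt F' y ![vecAt x' y, b] + valAt Om y ![vecAt x' y, vecAt x y, b]

/-- The symmetry behind the theorem for brackets: exchanging (f, F) with (g, F') only permutes the
summands. -/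
theorem dorfmanHor_swap (y : X) (b : EX) : dorfmanHor x x' f f' g g' θ θ' F F' Om y b =
    dorfmanHor x x' g g' f f' θ θ' F' F Om y b := by
  unfold dorfmanHor
  ring

theorem extD_form_apply (hF : pull p.proj F = extD p.conn) (hU : p.HasBase U x f g θ) (z : P)
    (u w : EP) : valAt (extD fun z => (U z).2) z ![u, w] =
      valAt (extD θ) (p.proj z) ![p.dp z u, p.dp z w] +
        (valAt (extD g) (p.proj z) ![p.dp z u] * p.A z ![w] -
          valAt (extD g) (p.proj z) ![p.dp z w] * p.A z ![u]) +
        valAt g (p.proj z) ![] * valAt F (p.proj z) ![p.dp z u, p.dp z w] := by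
  have hπ := p.smooth_proj.contMDiffAt (x := z)
  have hg := (hU.smooth_vert (p.proj z)).pull hπ
  have hθ := (hU.smooth_hor (p.proj z)).pull hπ
  have h1 := extD_fwedge (zero_add 1) (rfl : 0 + 1 + 1 = 1 + 1) (zero_add 2) hg (p.conn_smooth z)
  have h2 := extD_add hθ (hg.fwedge (zero_add 1) (p.conn_smooth z))
  rw [← hU.form_eq, h1, ← hF] at h2
  have h3 : valAt (extD fun z => (U z).2) z =
      (valAt (extD (pull p.proj θ : DForm EP P 1 ℝ)) z) +
        (wedge (rfl : 1 + 1 = 2) (valAt (extD (pull p.proj g : DForm EP P 0 ℝ)) z) (p.A z) +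
          (-1 : ℝ) ^ 0 • wedge (zero_add 2)
            ((valAt g (p.proj z)).compContinuousLinearMap (p.dp z))
            ((valAt F (p.proj z)).compContinuousLinearMap (p.dp z))) := h2
  have h4 : valAt (extD (pull p.proj θ : DForm EP P 1 ℝ)) z =
      (valAt (extD θ) (p.proj z)).compContinuousLinearMap (p.dp z) :=
    extD_pull (hU.smooth_hor (p.proj z)) hπ
  rw [h3, h4, pow_zero, one_smul, ContinuousAlternatingMap.add_apply,
    ContinuousAlternatingMap.add_apply, two_form_comp_apply, wedge_one_one_apply,
    wedge_zero_two_apply, zero_form_comp_apply, two_form_comp_apply,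
    p.valAt_extD_pull_zero (hU.smooth_vert _), p.valAt_extD_pull_zero (hU.smooth_vert _)]
  simp only [smul_eq_mul]
  ring

theorem inter_form (hU : p.HasBase U x f g θ) (hW : p.HasBase W x' f' g' θ') :
    inter (fun z => (U z).1) (fun z => (W z).2) =
      pull p.proj (inter x θ' + fwedge (zero_add 0) g' f) := by
  funext z
  refine form_ext_zero ?_
  have h1 := p.one_form_eval z (gfrm (W z)) (gvec (U z))
  rw [hU.vec, hU.conn, hW.vert, hW.hor] at h1
  have h2 := zero_form_comp_apply (valAt (inter x θ' + fwedge (zero_add 0) g' f) (p.proj z)) (p.dp z)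
  have h3 := wedge_zero_zero_apply (zero_add 0) (valAt g' (p.proj z)) (valAt f (p.proj z))
  refine Eq.trans h1 (Eq.trans ?_ h2.symm)
  exact congrArg (fun a : ℝ => valAt θ' (p.proj z) ![vecAt x (p.proj z)] + a) h3.symm

theorem flux_apply (p : CircleBundle EX X EP P) (z : P) (t u w : EP) :
    valAt (p.flux F' Om) z ![t, u, w] =
      p.A z ![t] * valAt F' (p.proj z) ![p.dp z u, p.dp z w] -
        p.A z ![u] * valAt F' (p.proj z) ![p.dp z t, p.dp z w] +
        p.A z ![w] * valAt F' (p.proj z) ![p.dp z t, p.dp z u] +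
        valAt Om (p.proj z) ![p.dp z t, p.dp z u, p.dp z w] := by
  have h : valAt (p.flux F' Om) z =
      wedge (rfl : 1 + 2 = 3) (p.A z) ((valAt F' (p.proj z)).compContinuousLinearMap (p.dp z)) +
        (valAt Om (p.proj z)).compContinuousLinearMap (p.dp z) := rfl
  rw [h, ContinuousAlternatingMap.add_apply, wedge_one_two_apply, three_form_comp_apply]
  simp only [two_form_comp_apply, smul_eq_mul]

/-- The coefficient of A is the expression in `A_dorfman` with f and F replaced by g and F'. So φ,
which exchanges the two components, is compatible with the bracket. -/
theorem gfrm_dorfman (hF : pull p.proj F = extD p.conn) (hU : p.HasBase U x f g θ)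
    (hW : p.HasBase W x' f' g' θ') (z : P) (u : EP) :
    gfrm (dorfman (p.flux F' Om) U W z) ![u] =
      dorfmanHor x x' f f' g g' θ θ' F F' Om (p.proj z) (p.dp z u) +
        p.A z ![u] * (valAt (extD g') (p.proj z) ![vecAt x (p.proj z)] -
          valAt (extD g) (p.proj z) ![vecAt x' (p.proj z)] +
          valAt F' (p.proj z) ![vecAt x' (p.proj z), vecAt x (p.proj z)]) := by
  have e : gfrm (dorfman (p.flux F' Om) U W z) ![u] =
      valAt (extD (inter (fun z => (U z).1) (fun z => (W z).2))) z ![u] +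
        valAt (extD fun z => (W z).2) z ![gvec (U z), u] -
        valAt (extD fun z => (U z).2) z ![gvec (W z), u] +
        valAt (p.flux F' Om) z ![gvec (W z), gvec (U z), u] := rfl
  have hθ := (hW.smooth_hor (p.proj z)).inter (hU.smooth_vec (p.proj z))
  have hgf := (hW.smooth_vert (p.proj z)).fwedge (zero_add 0) (hU.smooth_conn (p.proj z))
  have h1 : valAt (extD (inter x θ' + fwedge (zero_add 0) g' f)) (p.proj z) =
      valAt (extD (inter x θ')) (p.proj z) +
        (wedge (rfl : 1 + 0 = 1) (valAt (extD g') (p.proj z)) (valAt f (p.proj z)) +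
          (-1 : ℝ) ^ 0 • wedge (zero_add 1) (valAt g' (p.proj z)) (valAt (extD f) (p.proj z))) :=
    (extD_add hθ hgf).trans (congrArg (fun a => extD (inter x θ') (p.proj z) + a)
      (extD_fwedge (zero_add 0) rfl (zero_add 1) (hW.smooth_vert (p.proj z))
        (hU.smooth_conn (p.proj z))))
  have hUc : p.A z ![gvec (U z)] = valAt f (p.proj z) ![] := hU.conn z
  have hWc : p.A z ![gvec (W z)] = valAt f' (p.proj z) ![] := hW.conn z
  have hUv : p.dp z (gvec (U z)) = vecAt x (p.proj z) := hU.vec z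
  have hWv : p.dp z (gvec (W z)) = vecAt x' (p.proj z) := hW.vec z
  rw [e, inter_form hU hW, p.valAt_extD_pull_zero (hθ.add hgf), h1, extD_form_apply hF hU,
    extD_form_apply hF hW, flux_apply, pow_zero, one_smul, ContinuousAlternatingMap.add_apply,
    ContinuousAlternatingMap.add_apply, wedge_one_zero_apply, wedge_zero_one_apply, hUc, hWc, hUv,
    hWv, dorfmanHor]
  simp only [smul_eq_mul]
  ring

end One

section Two

variable {EX : Type*} [NormedAddCommGroup EX] [NormedSpace ℝ EX] [FiniteDimensional ℝ EX]
  {X : Type*} [TopologicalSpace X] [ChartedSpace EX X] [IsManifold 𝓘(ℝ, EX) ∞ X]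
  {EP : Type*} [NormedAddCommGroup EP] [NormedSpace ℝ EP] [FiniteDimensional ℝ EP]
  {P : Type*} [TopologicalSpace P] [ChartedSpace EP P] [IsManifold 𝓘(ℝ, EP) ∞ P]
  [MulAction Circle P]
  {EQ : Type*} [NormedAddCommGroup EQ] [NormedSpace ℝ EQ] [FiniteDimensional ℝ EQ]
  {Q : Type*} [TopologicalSpace Q] [ChartedSpace EQ Q] [IsManifold 𝓘(ℝ, EQ) ∞ Q]
  [MulAction Circle Q]
  (p : CircleBundle EX X EP P) (q : CircleBundle EX X EQ Q)
  {F F' : DForm EX X 2 ℝ} {Om : DForm EX X 3 ℝ}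

theorem phiAt_dorfman (hF : pull p.proj F = extD p.conn) (hF' : pull q.proj F' = extD q.conn)
    {U W : GSec EP P} (hU : IsInvSection U) (hW : IsInvSection W) {z : P} {w : Q}
    (h : p.proj z = q.proj w) :
    phiAt p q z w (dorfman (p.flux F' Om) U W z) =
      dorfman (q.flux F Om) (phi p q U) (phi p q W) w := by
  obtain ⟨x, f, g, θ, bU⟩ := p.exists_hasBase hU
  obtain ⟨x', f', g', θ', bW⟩ := p.exists_hasBase hW
  have bU' := bU.phi q
  have bW' := bW.phi q
  have h0 : ∀ α : EP [⋀^Fin 1]→L[ℝ] ℝ, α ![0] = 0 := fun α => by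
    simpa using one_form_smul α 0 0
  -- Vanishing at b = 0 follows from the linearity of the 1-form which the expression represents; it
  -- isolates the coefficient of A when u is the generator.
  have hz0 : dorfmanHor x x' f f' g g' θ θ' F F' Om (p.proj z) 0 = 0 := by
    have := gfrm_dorfman (Om := Om) (F' := F') hF bU bW z 0
    rw [h0, h0, map_zero, zero_mul, add_zero] at this
    exact this.symm
  have hv := gfrm_dorfman (Om := Om) (F' := F') hF bU bW z (vv EP z)
  rw [p.dp_vv, hz0, p.A_vv, zero_add, one_mul] at hv
  have e1 : gvec (phiAt p q z w (dorfman (p.flux F' Om) U W z)) =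
      gvec (dorfman (q.flux F Om) (phi p q U) (phi p q W) w) := by
    refine q.tangent_ext (z := w) ?_ ?_
    · rw [dp_phiAt, dp_dorfman bU bW, dp_dorfman bU' bW', h]
    · rw [A_phiAt, hv, A_dorfman hF' bU' bW', h]
  have e2 : gfrm (phiAt p q z w (dorfman (p.flux F' Om) U W z)) =
      gfrm (dorfman (q.flux F Om) (phi p q U) (phi p q W) w) := by
    refine form_ext_one fun u => ?_
    rw [gfrm_dorfman hF' bU' bW', gfrm_phiAt, ContinuousAlternatingMap.add_apply,
      one_form_comp_apply, one_form_comp_apply, gfrm_dorfman hF bU bW, (p.isSplitting z).proj_lift,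
      (p.isSplitting z).conn_lift, zero_mul, add_zero, ContinuousAlternatingMap.smul_apply,
      A_dorfman hF bU bW, smul_eq_mul, dorfmanHor_swap, h]
    ring
  exact Prod.ext e1 e2

/-- The map `φ` preserves the twisted Courant brackets. -/
theorem phi_courant (hF : pull p.proj F = extD p.conn) (hF' : pull q.proj F' = extD q.conn)
    {U W : GSec EP P} (hU : IsInvSection U) (hW : IsInvSection W) :
    phi p q (courant (p.flux F' Om) U W) =
      courant (q.flux F Om) (phi p q U) (phi p q W) := by
  funext w
  have h : p.proj (p.pt (q.proj w)) = q.proj w := Function.surjInv_eq _ _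
  -- Rewritten as a linear combination, so that additivity and homogeneity of `phiAt` apply.
  have e : ∀ (z : P) (A B : GTan EP P z), (1 / 2 : ℝ) • (A - B) =
      (1 / 2 : ℝ) • A + (-1 / 2 : ℝ) • B := fun z A B => by module
  have e' : ∀ A B : GTan EQ Q w, (1 / 2 : ℝ) • (A - B) =
      (1 / 2 : ℝ) • A + (-1 / 2 : ℝ) • B := fun A B => by module
  have h1 : courant (p.flux F' Om) U W (p.pt (q.proj w)) = _ := e _ _ _
  have h2 : courant (q.flux F Om) (phi p q U) (phi p q W) w = _ := e' _ _
  rw [phi, h1, phiAt_add, phiAt_smul, phiAt_smul, phiAt_dorfman p q hF hF' hU hW h,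
    phiAt_dorfman p q hF hF' hW hU h, h2]

end Two

end CircleBundle

end ExoticHori

/-! ### Assembly of the four statements and their duals. -/

theorem theorem2p5
    {EX : Type*} [NormedAddCommGroup EX] [NormedSpace ℝ EX] [FiniteDimensional ℝ EX]
    {X : Type*} [TopologicalSpace X] [ChartedSpace EX X] [IsManifold 𝓘(ℝ, EX) ∞ X]
    {EP : Type*} [NormedAddCommGroup EP] [NormedSpace ℝ EP] [FiniteDimensional ℝ EP]
    {P : Type*} [TopologicalSpace P] [ChartedSpace EP P] [IsManifold 𝓘(ℝ, EP) ∞ P]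
    [MulAction Circle P]
    {EQ : Type*} [NormedAddCommGroup EQ] [NormedSpace ℝ EQ] [FiniteDimensional ℝ EQ]
    {Q : Type*} [TopologicalSpace Q] [ChartedSpace EQ Q] [IsManifold 𝓘(ℝ, EQ) ∞ Q]
    [MulAction Circle Q]
    -- the circle bundles `P = Z` and `Q = Ẑ` with their connections
    (p : CircleBundle EX X EP P) (q : CircleBundle EX X EQ Q)
    -- the curvatures of the connections, as forms on the base
    (F : DForm EX X 2 ℝ) (hFs : ∀ x, SmoothFormAt F x) (hF : pull p.proj F = extD p.conn)
    (F' : DForm EX X 2 ℝ) (hFs' : ∀ x, SmoothFormAt F' x) (hF' : pull q.proj F' = extD q.conn)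
    -- the flux `H` on `Z`, closed and invariant, whose integral along the fibre is the curvature
    -- of `Ẑ`
    (H : DForm EP P 3 ℝ) (hHs : ∀ z, SmoothFormAt H z) (hHd : extD H = 0)
    (hHinv : ∀ c : Circle, pull (fun y : P => c • y) H = H)
    (hHv : inter (vert EP) H = pull p.proj F')
    -- the basic form `Ω = H - A ∧ F_Â`, as a form on the base
    (Om : DForm EX X 3 ℝ) (hOms : ∀ x, SmoothFormAt Om x)
    (hOm : pull p.proj Om = H - fwedge (rfl : 1 + 2 = 3) p.conn (pull p.proj F'))
    -- the dual flux `Ĥ = F_A ∧ Â + Ω`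
    (H' : DForm EQ Q 3 ℝ)
    (hH' : H' = fwedge (rfl : 2 + 1 = 3) (pull q.proj F) q.conn + pull q.proj Om) :
    -- (1) `φ` is an orthogonal isomorphism, with inverse the dual map, and induces isomorphisms of
    -- Clifford algebras
    ((∀ U : GSec EP P, IsInvSection U → IsInvSection (phi p q U)) ∧
      (∀ V : GSec EQ Q, IsInvSection V → IsInvSection (phi q p V)) ∧
      (∀ U : GSec EP P, IsInvSection U → phi q p (phi p q U) = U) ∧
      (∀ V : GSec EQ Q, IsInvSection V → phi p q (phi q p V) = V) ∧
      (∀ U W : GSec EP P, IsInvSection U → IsInvSection W →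
        ∀ a : X → ℝ, ContMDiff 𝓘(ℝ, EX) 𝓘(ℝ, ℝ) ∞ a →
          phi p q (fun z => a (p.proj z) • U z + W z) =
            fun w => a (q.proj w) • phi p q U w + phi p q W w) ∧
      (∀ U W : GSec EP P, IsInvSection U → IsInvSection W →
        ∀ z w, p.proj z = q.proj w →
          pairing w (phi p q U w) (phi p q W w) = pairing z (U z) (W z)) ∧
      (∀ z w, p.proj z = q.proj w →
        ∃ Φ : CliffordAlgebra (pairingQ (E := EP) z) ≃ₐ[ℝ] CliffordAlgebra (pairingQ (E := EQ) w),
          ∀ U : GSec EP P, IsInvSection U →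
            Φ (CliffordAlgebra.ι _ (U z)) = CliffordAlgebra.ι _ (phi p q U w)) ∧
      (∃ Φ : invCliff EP P ≃ₐ[ℝ] invCliff EQ Q,
        ∀ U : GSec EP P, IsInvSection U → ∀ a : invCliff EP P,
          a.1 = gammaSec U → (Φ a).1 = gammaSec (phi p q U))) ∧
    -- (2) `φ` preserves the twisted Courant brackets
    (∀ U W : GSec EP P, IsInvSection U → IsInvSection W →
      phi p q (courant H U W) = courant H' (phi p q U) (phi p q W)) ∧
    -- (3) `τ_n` and `σ̂_n`
    (∀ n : ℤ,
      (Set.BijOn (tau p q n) (weightForms EP P (-n)) (twistedForms p q n) ∧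
        Set.BijOn (sigmaInv p q) (twistedForms p q n) (weightForms EP P (-n)) ∧
        (∀ η ∈ weightForms EP P (-n), sigmaInv p q (tau p q n η) = -η) ∧
        (∀ ψ ∈ twistedForms p q n, tau p q n (sigmaInv p q ψ) = -ψ) ∧
        (∀ (a b : ℂ), ∀ η ∈ weightForms EP P (-n), ∀ ζ ∈ weightForms EP P (-n),
          tau p q n (a • η + b • ζ) = a • tau p q n η + b • tau p q n ζ) ∧
        (∀ (a b : ℂ), ∀ ψ ∈ twistedForms p q n, ∀ χ ∈ twistedForms p q n,
          sigmaInv p q (a • ψ + b • χ) = a • sigmaInv p q ψ + b • sigmaInv p q χ) ∧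
        (∀ U : GSec EP P, IsInvSection U → ∀ η ∈ weightForms EP P (-n),
          tau p q n (cliff U η) = -cliff (phi p q U) (tau p q n η)) ∧
        (∀ U : GSec EP P, IsInvSection U → ∀ ψ ∈ twistedForms p q n,
          sigmaInv p q (cliff (phi p q U) ψ) = -cliff U (sigmaInv p q ψ))) ∧
      -- the dual results for `τ̂_n` and `σ_n`
      (Set.BijOn (tau q p n) (weightForms EQ Q (-n)) (twistedForms q p n) ∧
        Set.BijOn (sigmaInv q p) (twistedForms q p n) (weightForms EQ Q (-n)) ∧
        (∀ η ∈ weightForms EQ Q (-n), sigmaInv q p (tau q p n η) = -η) ∧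
        (∀ ψ ∈ twistedForms q p n, tau q p n (sigmaInv q p ψ) = -ψ) ∧
        (∀ (a b : ℂ), ∀ η ∈ weightForms EQ Q (-n), ∀ ζ ∈ weightForms EQ Q (-n),
          tau q p n (a • η + b • ζ) = a • tau q p n η + b • tau q p n ζ) ∧
        (∀ (a b : ℂ), ∀ ψ ∈ twistedForms q p n, ∀ χ ∈ twistedForms q p n,
          sigmaInv q p (a • ψ + b • χ) = a • sigmaInv q p ψ + b • sigmaInv q p χ) ∧
        (∀ V : GSec EQ Q, IsInvSection V → ∀ η ∈ weightForms EQ Q (-n),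
          tau q p n (cliff V η) = -cliff (phi q p V) (tau q p n η)) ∧
        (∀ V : GSec EQ Q, IsInvSection V → ∀ ψ ∈ twistedForms q p n,
          sigmaInv q p (cliff (phi q p V) ψ) = -cliff V (sigmaInv q p ψ)))) ∧
    -- (4) `τ_n` and `σ̂_n` are chain maps
    (∀ n : ℤ,
      (Set.MapsTo (twistedDeRham H) (weightForms EP P (-n)) (weightForms EP P (-n)) ∧
        Set.MapsTo (twistedD p q n H') (twistedForms p q n) (twistedForms p q n) ∧
        (∀ η ∈ weightForms EP P (-n),
          tau p q n (twistedDeRham H η) = -twistedD p q n H' (tau p q n η)) ∧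
        (∀ ψ ∈ twistedForms p q n,
          sigmaInv p q (twistedD p q n H' ψ) = -twistedDeRham H (sigmaInv p q ψ))) ∧
      -- the dual results for `τ̂_n` and `σ_n`
      (Set.MapsTo (twistedDeRham H') (weightForms EQ Q (-n)) (weightForms EQ Q (-n)) ∧
        Set.MapsTo (twistedD q p n H) (twistedForms q p n) (twistedForms q p n) ∧
        (∀ η ∈ weightForms EQ Q (-n),
          tau q p n (twistedDeRham H' η) = -twistedD q p n H (tau q p n η)) ∧
        (∀ ψ ∈ twistedForms q p n,
          sigmaInv q p (twistedD q p n H ψ) = -twistedDeRham H' (sigmaInv q p ψ)))) := by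
  -- Once both fluxes have the form `flux`, with the connection form on the left, the situation is
  -- symmetric in `p` and `q`, and each dual statement is the same lemma with the roles exchanged.
  have hH₁ : H = p.flux F' Om := by
    rw [flux, hOm, add_sub_cancel]
  have hH₂ : H' = q.flux F Om := by
    rw [hH', flux]
    congr 1
    -- F has even degree, so moving the connection form to the left costs no sign.
    funext w
    refine (wedge_one_right (rfl : 2 + 1 = 3) (rfl : 1 + 2 = 3) (pull q.proj F w) (q.conn w)).trans ?_
    exact (congrArg (fun c : ℝ => c • wedge (rfl : 1 + 2 = 3) (q.conn w) (pull q.proj F w))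
      (show (-1 : ℝ) ^ 2 = 1 by norm_num)).trans (one_smul ℝ _)
  subst hH₁ hH₂
  refine ⟨⟨fun U hU => isInvSection_phi p q hU, fun V hV => isInvSection_phi q p hV,
    fun U hU => phi_phi p q hU, fun V hV => phi_phi q p hV,
    fun U W _ _ a _ => phi_linear p q U W a, fun U W hU hW z w h => pairing_phi p q hU hW h,
    fun z w h => exists_fibre_cliffordEquiv p q z w h,
    invCliffEquiv p q, fun U _ a ha => invCliffEquiv_gammaSec p q a ha⟩,
    fun U W hU hW => phi_courant p q hF hF' hU hW,
    fun n => ⟨⟨bijOn_tau p q n, bijOn_sigmaInv p q n, fun η hη => sigmaInv_tau p q hη,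
      fun ψ hψ => tau_sigmaInv p q hψ, fun a b η hη ζ hζ => tau_linear p q a b hη hζ,
      fun a b ψ hψ χ hχ => sigmaInv_linear p q a b hψ hχ,
      fun U hU η hη => tau_cliff p q hU ((mem_weightForms_iff p (-n) η).mp hη).2,
      fun U hU ψ hψ => sigmaInv_cliff p q hU hψ⟩,
      bijOn_tau q p n, bijOn_sigmaInv q p n, fun η hη => sigmaInv_tau q p hη,
      fun ψ hψ => tau_sigmaInv q p hψ, fun a b η hη ζ hζ => tau_linear q p a b hη hζ,
      fun a b ψ hψ χ hχ => sigmaInv_linear q p a b hψ hχ,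
      fun V hV η hη => tau_cliff q p hV ((mem_weightForms_iff q (-n) η).mp hη).2,
      fun V hV ψ hψ => sigmaInv_cliff q p hV hψ⟩,
    fun n => ⟨⟨fun η hη => twistedDeRham_mem p hFs' hOms hη,
      fun ψ hψ => twistedD_mem p q hF hF' hFs' hOms hψ,
      fun η hη => tau_twistedDeRham p q hF hF' hFs' hOms hη,
      fun ψ hψ => sigmaInv_twistedD p q hF hF' hFs' hOms hψ⟩,
      fun η hη => twistedDeRham_mem q hFs hOms hη,
      fun ψ hψ => twistedD_mem q p hF' hF hFs hOms hψ,
      fun η hη => tau_twistedDeRham q p hF' hF hFs hOms hη,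
      fun ψ hψ => sigmaInv_twistedD q p hF' hF hFs hOms hψ⟩⟩
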